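/- **Setting.** For $0<\theta\le\pi/2$ let $D(\theta)\subset\mathbb R^2$ be the closed rhombus with side length $1$, angle $\theta$ at its two corners on the $x$-axis, centre at the origin and diagonal joining these two corners (the long diagonal if $\theta<\pi/2$) on the $x$-axis. For $n\ge 1$ divide $D(\theta)$ into $n\times n$ congruent rhombuses and divide each small rhombus into two triangles along either its long diagonal (the one parallel to the $x$-axis) or its short diagonal; this gives a mesh $\mathcal T_h$ of $D=D(\theta)$, whose mesh size $h$ is the largest diameter of a triangle. Let $\tilde D$ be the union of the triangles of $\mathcal T_h$ that contain neither of the two corners of $D(\theta)$ on the $x$-axis, with the corresponding mesh. For $\ell\ge1$ the defect patch $G_\ell(\theta)$ is the mesh obtained from the partition of $D(\theta)$ into $(\ell+2)\times(\ell+2)$ small rhombuses by dividing the inner $\ell\times\ell$ small rhombuses along their long diagonals and the surrounding layer of small rhombuses along their short diagonals, and then deleting the two triangles containing the corners on the $x$-axis. Let $A_\ell(\theta)$ be the stiffness matrix $\big(\int\nabla\varphi_j\cdot\nabla\varphi_i\big)_{i,j}$ of $G_\ell(\theta)$ over its interior nodes, $\varphi_i$ being the nodal basis functions. For a meshed domain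 $E$ (here $E=D$ or $E=\tilde D$), let $V^h(\overline E)$ be the space of continuous functions on $\overline E$ that are affine on each triangle, $V^h_0(\overline E)$ the subspace of those vanishing on $\partial E$, and $V^h(\partial E)$ the space of restrictions of members of $V^h(\overline E)$ to $\partial E$. For a bounded measurable function $\tilde c\ge0$, the solution operator $S^E_h$ of $-\Delta u+\tilde c\,u=f$ maps $(f,g)\in (V^h_0(\overline E))^*\times V^h(\partial E)$ to $u\in V^h(\overline E)$ with $u=g$ on $\partial E$ and $$\int_E\nabla u\cdot\nabla v+\int_E\tilde c\,u\,v=\langle f,v\rangle\quad\text{for all }v\in V^h_0(\overline E).$$ The functional $f$ is nonnegative if $\langle f,\varphi_i\rangle\ge0$ for every nodal basis function $\varphi_i\in V_0^h(\overline E)$. The operator $S^E_h$ satisfies * wDMP-A if $\min_{\overline E}S^E_h(f,g)\ge\min_{\partial E}g$ for all nonnegative $f$ and all $g$; * sDMP-A if it satisfies wDMP-A and, for all nonnegative $f$ and all $g$, $u=S_h^E(f,g)$ is constant whenever it attains its global minimum over $\overline E$ at an interior vertex; * wDMP-B if $\min_{\overline E}S^E_h(f,g)\ge-\max_{\partial E}g^-$,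 $g^-=-\min(g,0)$, for all nonnegative $f$ and all $g$; * sDMP-B if it satisfies wDMP-B and, for all nonnegative $f$ and all $g$, $u=S_h^E(f,g)$ is constant whenever it attains a nonpositive global minimum over $\overline E$ at an interior vertex. **Theorem.** For every $\ell\ge1$ there is an angle $\theta_\ell\in(0,\pi/2)$ such that $$A_\ell(\theta)\text{ is invertible and all entries of }A_\ell(\theta)^{-1}\text{ are positive, for all }\theta_\ell<\theta\le\pi/2.\qquad(*)$$ Let $k\ge1$, let $\theta_1,\dots,\theta_k\in(0,\pi/2)$ be any angles with property $(*)$, and let $\max_{1\le\ell\le k}\theta_\ell<\theta<\pi/2$. Consider meshes $\mathcal T_h$ of $D=D(\theta)$ as above such that for each interior vertex $P$, either $P$ lies in the interior of the domain of a submesh of $\mathcal T_h$ that is the image of some $G_\ell(\theta)$, $1\le\ell\le k$, under a map $x\mapsto sx+b$ with $s>0$, or all the triangles of $\mathcal T_h$ with vertex $P$ have only acute angles. In both parts the solution operators $S_h^{\tilde D}$ and $S_h^D$ are well defined (the discrete problems have exactly one solution for all data), and: **(i)** If $\tilde c\equiv0$, then $S^{\tilde D}_h$ satisfies sDMP-A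 and $S^D_h$ satisfies wDMP-A. **(ii)** For every constant $\tilde c_{\max}$ there is $h_{\max}>0$, depending only on $k$, $\theta$ and $\tilde c_{\max}$, such that for all such meshes with $0<h<h_{\max}$ and all measurable $\tilde c$ with $0\le\tilde c\le\tilde c_{\max}$ almost everywhere on $D$, $S^{\tilde D}_h$ satisfies sDMP-B and $S^D_h$ satisfies wDMP-B. -/

import Mathlib

open MeasureTheory Real

noncomputable section

namespace DMP

/-- The Euclidean plane. -/
abbrev Plane := EuclideanSpace ℝ (Fin 2)

/-- A planar mesh, given by its triangles; every triangle is given by the set of its three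
vertices, the closed triangle being the convex hull of that set. -/
abbrev Mesh := Set (Set Plane)

/-- The closed domain covered by the mesh. -/
def domain (M : Mesh) : Set Plane := ⋃ t ∈ M, convexHull ℝ t

/-- The boundary of the domain covered by the mesh. -/
def bdry (M : Mesh) : Set Plane := frontier (domain M)

/-- All vertices of the mesh. -/
def vertices (M : Mesh) : Set Plane := ⋃₀ M

/-- The vertices of the mesh that lie in the interior of its domain. -/
def interiorVertices (M : Mesh) : Set Plane := vertices M ∩ interior (domain M)

/-- The mesh size: the largest diameter of a triangle. -/
def meshSize (M : Mesh) : ℝ := sSup ((fun t : Set Plane => Metric.diam t) '' M)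

/-! ### Piecewise linear finite elements -/

/-- The space `V^h` of continuous functions on the closed domain that are affine on each
triangle. A function on the closed domain is represented by its extension by zero to the plane, so
that two members are equal iff they agree on the closed domain. -/
def feSpace (M : Mesh) : Submodule ℝ (Plane → ℝ) where
  carrier := {u | ContinuousOn u (domain M) ∧
    (∀ t ∈ M, ∃ g : Plane →ᵃ[ℝ] ℝ, Set.EqOn u g (convexHull ℝ t)) ∧
    ∀ x, x ∉ domain M → u x = 0}
  zero_mem' := ⟨continuousOn_const, fun _ _ => ⟨0, fun _ _ => rfl⟩, fun _ _ => rfl⟩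
  add_mem' := by
    rintro u v ⟨hu, hu', hu''⟩ ⟨hv, hv', hv''⟩
    refine ⟨hu.add hv, fun t ht => ?_, fun x hx => ?_⟩
    · obtain ⟨a, ha⟩ := hu' t ht
      obtain ⟨b, hb⟩ := hv' t ht
      exact ⟨a + b, fun x hx => by simp [ha hx, hb hx]⟩
    · simp [hu'' x hx, hv'' x hx]
  smul_mem' := by
    rintro r u ⟨hu, hu', hu''⟩
    refine ⟨hu.const_smul r, fun t ht => ?_, fun x hx => ?_⟩
    · obtain ⟨a, ha⟩ := hu' t ht
      exact ⟨r • a, fun x hx => by simp [ha hx]⟩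
    · simp [hu'' x hx]

/-- The space `V_0^h` of the members of `V^h` that vanish on the boundary. -/
def feSpaceZero (M : Mesh) : Submodule ℝ (Plane → ℝ) where
  carrier := {u | u ∈ feSpace M ∧ ∀ x ∈ bdry M, u x = 0}
  zero_mem' := ⟨(feSpace M).zero_mem, fun _ _ => rfl⟩
  add_mem' := by
    rintro u v ⟨hu, hu'⟩ ⟨hv, hv'⟩
    exact ⟨(feSpace M).add_mem hu hv, fun x hx => by simp [hu' x hx, hv' x hx]⟩
  smul_mem' := by
    rintro r u ⟨hu, hu'⟩
    exact ⟨(feSpace M).smul_mem r hu, fun x hx => by simp [hu' x hx]⟩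

/-- The space `V^h(∂D)` of the restrictions to the boundary of the members of `V^h`. -/
def feBdry (M : Mesh) : Submodule ℝ (bdry M → ℝ) :=
  (feSpace M).map (LinearMap.funLeft ℝ ℝ (Subtype.val : bdry M → Plane))

/-- `φ` is the nodal basis function of `V^h` at the vertex `p`. -/
def IsNodal (M : Mesh) (p : Plane) (φ : Plane → ℝ) : Prop :=
  φ ∈ feSpace M ∧ φ p = 1 ∧ ∀ q ∈ vertices M, q ≠ p → φ q = 0

/-- The nodal basis function of `V^h` at the vertex `p`. -/
def nodal (M : Mesh) (p : Plane) : Plane → ℝ := Classical.epsilon (IsNodal M p)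

/-- The Dirichlet form `a_D(u,v) = ∫_D ∇u · ∇v`. -/
def dirichletForm (M : Mesh) (u v : Plane → ℝ) : ℝ :=
  ∫ x in domain M, inner ℝ (gradient u x) (gradient v x)

/-- The reaction form `(c u, v)_D = ∫_D c u v`. -/
def reactionForm (M : Mesh) (c u v : Plane → ℝ) : ℝ :=
  ∫ x in domain M, c x * u x * v x

/-! ### Solution operators and discrete maximum principles -/

/-- Operators taking a functional on `V_0^h` and boundary data in `V^h(∂D)` to a member
of `V^h`. -/
abbrev Operator (M : Mesh) := Module.Dual ℝ (feSpaceZero M) → feBdry M → feSpace M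

/-- `S` is the solution operator of the finite element discretization of
`-Δu + c u = f` in `D`, `u = g` on `∂D`. -/
def IsSolutionOperator (M : Mesh) (c : Plane → ℝ) (S : Operator M) : Prop :=
  ∀ (f : Module.Dual ℝ (feSpaceZero M)) (g : feBdry M),
    (∀ y : bdry M, (S f g : Plane → ℝ) y = (g : bdry M → ℝ) y) ∧
    ∀ v : feSpaceZero M,
      dirichletForm M (S f g) v + reactionForm M c (S f g) v = f v

/-- The functional `f` on `V_0^h` is nonnegative: it is nonnegative at every nodal basis
function that belongs to `V_0^h`. -/
def NonnegFunctional (M : Mesh) (f : Module.Dual ℝ (feSpaceZero M)) : Prop :=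
  ∀ φ : feSpaceZero M, (∃ p ∈ vertices M, IsNodal M p φ) → 0 ≤ f φ

/-- Weak discrete maximum principle, version A: `min_D S(f,g) ≥ min_∂D g` for all `f ≥ 0`. -/
def WDMPA (M : Mesh) (S : Operator M) : Prop :=
  ∀ f, NonnegFunctional M f → ∀ g : feBdry M, ∀ x ∈ domain M,
    ∃ y : bdry M, (g : bdry M → ℝ) y ≤ (S f g : Plane → ℝ) x

/-- Strong discrete maximum principle, version A: moreover, `S(f,g)` is constant if it attains
its global minimum at an interior vertex. -/
def SDMPA (M : Mesh) (S : Operator M) : Prop :=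
  WDMPA M S ∧
  ∀ f, NonnegFunctional M f → ∀ g : feBdry M, ∀ q ∈ interiorVertices M,
    IsMinOn (S f g : Plane → ℝ) (domain M) q →
    ∃ r : ℝ, ∀ x ∈ domain M, (S f g : Plane → ℝ) x = r

/-- Weak discrete maximum principle, version B: `min_D S(f,g) ≥ - max_∂D g⁻` for all `f ≥ 0`,
where `g⁻ = - min(g, 0)`. -/
def WDMPB (M : Mesh) (S : Operator M) : Prop :=
  ∀ f, NonnegFunctional M f → ∀ g : feBdry M, ∀ x ∈ domain M,
    ∃ y : bdry M, - (- min ((g : bdry M → ℝ) y) 0) ≤ (S f g : Plane → ℝ) x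

/-- Strong discrete maximum principle, version B: moreover, `S(f,g)` is constant if it attains
a nonpositive global minimum at an interior vertex. -/
def SDMPB (M : Mesh) (S : Operator M) : Prop :=
  WDMPB M S ∧
  ∀ f, NonnegFunctional M f → ∀ g : feBdry M, ∀ q ∈ interiorVertices M,
    IsMinOn (S f g : Plane → ℝ) (domain M) q → (S f g : Plane → ℝ) q ≤ 0 →
    ∃ r : ℝ, ∀ x ∈ domain M, (S f g : Plane → ℝ) x = r

/-! ### Meshes of the rhombus -/

/-- The unit vector of direction `a`. -/
def dir (a : ℝ) : Plane := !₂[cos a, sin a]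

/-- The grid points of the partition into `n × n` congruent rhombuses of the rhombus `D(θ)` with
sides of length one, acute angle `θ`, centre at the origin and long diagonal on the
`x`-axis. The acute corners are the grid points `(0,0)` and `(n,n)`. -/
def gridPt (θ : ℝ) (n i j : ℕ) : Plane :=
  ((i : ℝ) / n - 1 / 2) • dir (-(θ / 2)) + ((j : ℝ) / n - 1 / 2) • dir (θ / 2)

/-- The mesh of `D(θ)` in which the small rhombus `(i,j)` is divided along its long diagonal if
`long i j`, and along its short diagonal otherwise. -/
def rhombusMesh (θ : ℝ) (n : ℕ) (long : ℕ → ℕ → Prop) : Mesh :=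
  {t | ∃ i j, i < n ∧ j < n ∧
    ((long i j ∧
        (t = {gridPt θ n i j, gridPt θ n (i + 1) (j + 1), gridPt θ n (i + 1) j} ∨
         t = {gridPt θ n i j, gridPt θ n (i + 1) (j + 1), gridPt θ n i (j + 1)})) ∨
     (¬ long i j ∧
        (t = {gridPt θ n (i + 1) j, gridPt θ n i (j + 1), gridPt θ n i j} ∨
         t = {gridPt θ n (i + 1) j, gridPt θ n i (j + 1), gridPt θ n (i + 1) (j + 1)})))}

/-- The mesh of the truncated domain: the triangles that contain one of the two acute corners
of `D(θ)` are removed. -/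
def truncatedMesh (θ : ℝ) (n : ℕ) (long : ℕ → ℕ → Prop) : Mesh :=
  {t ∈ rhombusMesh θ n long | gridPt θ n 0 0 ∉ t ∧ gridPt θ n n n ∉ t}

/-- The defect patch `G_l(θ)`: `l × l` small rhombuses divided along their long diagonals,
with a lining of one layer of small rhombuses divided along their short diagonals, and without
the two triangles at the acute corners. -/
def defectPatch (θ : ℝ) (l : ℕ) : Mesh :=
  truncatedMesh θ (l + 2) fun i j => (1 ≤ i ∧ i ≤ l) ∧ (1 ≤ j ∧ j ≤ l)

/-- The image of a mesh under `x ↦ s x + b`. -/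
def scaledMesh (s : ℝ) (b : Plane) (M : Mesh) : Mesh :=
  (fun t : Set Plane => (fun x => s • x + b) '' t) '' M

/-- The stiffness matrix associated with the interior nodes of `G_l(θ)`. -/
def patchStiffness (θ : ℝ) (l : ℕ) :
    Matrix (Fin (l + 1) × Fin (l + 1)) (Fin (l + 1) × Fin (l + 1)) ℝ :=
  fun p q => dirichletForm (defectPatch θ l)
    (nodal (defectPatch θ l) (gridPt θ (l + 2) (q.1 + 1) (q.2 + 1)))
    (nodal (defectPatch θ l) (gridPt θ (l + 2) (p.1 + 1) (p.2 + 1)))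

/-- `t` can serve as the angle `θ_l`: it lies in `(0, π/2)`, and for `t < θ ≤ π/2` the stiffness
matrix of `G_l(θ)` is invertible and all the entries of its inverse are positive. -/
def IsDefectAngle (l : ℕ) (t : ℝ) : Prop :=
  0 < t ∧ t < π / 2 ∧ ∀ θ : ℝ, t < θ → θ ≤ π / 2 →
    IsUnit (patchStiffness θ l).det ∧ ∀ p q, 0 < (patchStiffness θ l)⁻¹ p q

/-- All triangles of the mesh that have `p` as a vertex have only acute angles. -/
def AcuteStar (M : Mesh) (p : Plane) : Prop :=
  ∀ t ∈ M, p ∈ t → ∀ x y z : Plane, x ≠ y → y ≠ z → z ≠ x → t = {x, y, z} →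
    EuclideanGeometry.angle x y z < π / 2

/-- Every interior vertex of the mesh lies in the interior of a submesh that is a scaled copy of
`G_l(θ)` for some `1 ≤ l ≤ k`, or has an acute star. -/
def Admissible (k : ℕ) (θ : ℝ) (M : Mesh) : Prop :=
  ∀ p ∈ interiorVertices M,
    (∃ l, 1 ≤ l ∧ l ≤ k ∧ ∃ s : ℝ, 0 < s ∧ ∃ b : Plane,
      scaledMesh s b (defectPatch θ l) ⊆ M ∧
      p ∈ interior (domain (scaledMesh s b (defectPatch θ l)))) ∨
    AcuteStar M p

end DMP

end

/-!
Let the grid points be indexed by pairs `(i, j)`, so that each triangle has one side in each of the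
two grid directions. With `δ₁`, `δ₂` the increments of a finite element function along these two
sides, the Dirichlet energy of the function on the triangle is, up to a factor common to all
triangles, `δ₁² + δ₂² - 2 σ cos θ δ₁ δ₂`, where `σ = 1` if the small rhombus is divided along its
short diagonal and `σ = -1` otherwise (`inner_elemGrad`, `dirichletForm_eq`). Hence all off-diagonal
entries of the element matrix of a short triangle are negative, and only long triangles contribute
positive ones. The discrete problem becomes a linear system for nodal values; it is uniquely
solvable since the energy is definite on functions that vanish on the boundary
(`IsCoeff.existsUnique_solution`).

The heart of the matter is a strong minimum principle for nodal values (`strong_minimum`). Let `W`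
be a nonnegative supersolution that vanishes at an inner node `P`. If only short triangles meet at
`P`, then the row of `P` has negative entries at all neighbours, so `W` vanishes at the neighbours
(`zero_of_joined_shortStar`). If `P` is an inner node of a copy of `G_l(θ)`, then, since the lining
of the patch is short, the inner nodes of the patch are coupled to the other nodes by negative
entries only. Therefore the patch matrix `A` satisfies `A W ≥ 0`, and `A⁻¹ > 0` and `W P = 0` give
`W = 0` in the patch; then the couplings show that `W` vanishes at all neighbours of the patch too
(`zero_of_joined_patch`). The zeros spread along the grid to all nodes but the corners on the
`x`-axis, where nothing can be said in general; truncation removes exactly these two. Applied to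
`W = u - min u`, which is a supersolution without reaction term, or with one if `min u ≤ 0`, this
gives the strong principles on the truncated rhombus. On the full rhombus it shows that a minimum
at an inner node is also attained at a boundary node, which is the weak principle. The hypothesis
that every inner node has an acute star or lies inside a patch forces the rhombuses at the four
corners to be short (`Covered.corners`), so that truncation does not remove any neighbour of an
inner node.

Property (*) holds near `π / 2` because for `θ = π / 2` the patch matrix is the five-point
Laplacian, whose inverse is positive (`invPos_refStiff_zero`), and positivity of the inverse is an
open condition on the entries (`InvPos.exists_ball`). The same openness takes care of the reaction
term: it changes the entries of the element matrices by at most `C * area`, while the stiffness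
entries have the size `area * n ^ 2 / sin θ ^ 2`, so for large `n` both the signs in short triangles
and the positivity of the inverses of the finitely many patch matrices persist
(`HasPatch.abs_sub_le`, `exists_isFine`).

The geometric hypotheses are translated into index form by `shortStar_of_acuteStar` and
`exists_hasPatch`. That any nodal values belong to a finite element function rests on an explicit
formula for the nodal basis functions (`hatFun_eq_elemInterp`).
-/

noncomputable section

namespace DMP

/-! ### Combinatorics of the triangulations -/

/-- Index of a grid point. -/
abbrev Node := ℕ × ℕ

/-- Index of a triangle: the small rhombus `(i, j)` and one of its two halves. -/
abbrev Elem := ℕ × ℕ × Bool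

open Classical in
/-- The vertices of a triangle. Each triangle has one side in each of the two grid directions;
vertex `0` is the common point of these two sides, vertex `1` is the other end of the side with
constant second index, and vertex `2` the other end of the side with constant first index. -/
def vtx (long : ℕ → ℕ → Prop) (κ : Elem) : Fin 3 → Node :=
  if long κ.1 κ.2.1 then
    if κ.2.2 = true then ![(κ.1, κ.2.1 + 1), (κ.1 + 1, κ.2.1 + 1), (κ.1, κ.2.1)]
    else ![(κ.1 + 1, κ.2.1), (κ.1, κ.2.1), (κ.1 + 1, κ.2.1 + 1)]
  else
    if κ.2.2 = true then ![(κ.1 + 1, κ.2.1 + 1), (κ.1, κ.2.1 + 1), (κ.1 + 1, κ.2.1)]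
    else ![(κ.1, κ.2.1), (κ.1 + 1, κ.2.1), (κ.1, κ.2.1 + 1)]

lemma vtx_injective (long : ℕ → ℕ → Prop) (κ : Elem) : Function.Injective (vtx long κ) := by
  intro v w h
  unfold vtx at h
  split_ifs at h <;> fin_cases v <;> fin_cases w <;> simp_all

/-- The vertices of a triangle are corners of its small rhombus. -/
lemma vtx_bounds (long : ℕ → ℕ → Prop) (κ : Elem) (v : Fin 3) :
    κ.1 ≤ (vtx long κ v).1 ∧ (vtx long κ v).1 ≤ κ.1 + 1 ∧
    κ.2.1 ≤ (vtx long κ v).2 ∧ (vtx long κ v).2 ≤ κ.2.1 + 1 := by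
  unfold vtx
  split_ifs <;> fin_cases v <;> simp

open Classical in
/-- The triangles of the mesh with `n × n` small rhombuses; if `tr` holds, the two triangles at
the corners `(0, 0)` and `(n, n)` are left out. -/
def elems (n : ℕ) (tr : Bool) : Finset Elem :=
  (Finset.range n ×ˢ Finset.range n ×ˢ Finset.univ).filter
    fun κ => tr = true → κ ≠ (0, 0, false) ∧ κ ≠ (n - 1, n - 1, true)

lemma mem_elems {n : ℕ} {tr : Bool} {κ : Elem} :
    κ ∈ elems n tr ↔ κ.1 < n ∧ κ.2.1 < n ∧
      (tr = true → κ ≠ (0, 0, false) ∧ κ ≠ (n - 1, n - 1, true)) := by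
  simp [elems, and_assoc]

lemma card_elems_le (n : ℕ) (tr : Bool) : (elems n tr).card ≤ 2 * n ^ 2 := by
  refine (Finset.card_filter_le _ _).trans ?_
  simp [Finset.card_product]; nlinarith

/-- The nodes in the interior of the grid. -/
def IsInner (n : ℕ) (P : Node) : Prop := 1 ≤ P.1 ∧ P.1 < n ∧ 1 ≤ P.2 ∧ P.2 < n

/-- The two small rhombuses at the corners `(0, 0)` and `(n, n)` are divided along their short
diagonals. -/
def ShortCorners (n : ℕ) (long : ℕ → ℕ → Prop) : Prop := ¬ long 0 0 ∧ ¬ long (n - 1) (n - 1)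

/-- A triangle with an inner vertex is not one of the two triangles at the corners. -/
lemma mem_elems_of_inner {n : ℕ} {tr : Bool} {long : ℕ → ℕ → Prop} {κ : Elem}
    (hs : tr = true → ShortCorners n long) {v : Fin 3} (h : IsInner n (vtx long κ v)) :
    κ ∈ elems n tr := by
  have hb := vtx_bounds long κ v
  obtain ⟨h1, h2, h3, h4⟩ := h
  refine mem_elems.2 ⟨by omega, by omega, fun htr => ⟨?_, ?_⟩⟩
  · rintro rfl
    have := (hs htr).1
    revert h1 h2 h3 h4
    simp only [vtx, this, if_false]
    fin_cases v <;> simp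
  · rintro rfl
    have := (hs htr).2
    revert h1 h2 h3 h4
    simp only [vtx, this, if_false]
    fin_cases v <;> simp <;> omega

/-- Neighbouring grid points in direction one, at least one of them inner, are vertices of a
common triangle. -/
lemma exists_elem_horizontal {n : ℕ} {tr : Bool} {long : ℕ → ℕ → Prop}
    (hs : tr = true → ShortCorners n long) {i j : ℕ}
    (h : IsInner n (i, j) ∨ IsInner n (i + 1, j)) :
    ∃ κ ∈ elems n tr, (∃ v, vtx long κ v = (i, j)) ∧ ∃ v, vtx long κ v = (i + 1, j) := by
  have key : ∃ κ : Elem, (∃ v, vtx long κ v = (i, j)) ∧ ∃ v, vtx long κ v = (i + 1, j) := by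
    by_cases hl : long i j
    · exact ⟨(i, j, false), ⟨1, by simp [vtx, hl]⟩, ⟨0, by simp [vtx, hl]⟩⟩
    · exact ⟨(i, j, false), ⟨0, by simp [vtx, hl]⟩, ⟨1, by simp [vtx, hl]⟩⟩
  obtain ⟨κ, ⟨v, hv⟩, ⟨w, hw⟩⟩ := key
  refine ⟨κ, ?_, ⟨v, hv⟩, ⟨w, hw⟩⟩
  rcases h with h | h
  · exact mem_elems_of_inner hs (v := v) (hv ▸ h)
  · exact mem_elems_of_inner hs (v := w) (hw ▸ h)

lemma exists_elem_vertical {n : ℕ} {tr : Bool} {long : ℕ → ℕ → Prop}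
    (hs : tr = true → ShortCorners n long) {i j : ℕ}
    (h : IsInner n (i, j) ∨ IsInner n (i, j + 1)) :
    ∃ κ ∈ elems n tr, (∃ v, vtx long κ v = (i, j)) ∧ ∃ v, vtx long κ v = (i, j + 1) := by
  have key : ∃ κ : Elem, (∃ v, vtx long κ v = (i, j)) ∧ ∃ v, vtx long κ v = (i, j + 1) := by
    by_cases hl : long i j
    · exact ⟨(i, j, true), ⟨2, by simp [vtx, hl]⟩, ⟨0, by simp [vtx, hl]⟩⟩
    · exact ⟨(i, j, false), ⟨0, by simp [vtx, hl]⟩, ⟨2, by simp [vtx, hl]⟩⟩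
  obtain ⟨κ, ⟨v, hv⟩, ⟨w, hw⟩⟩ := key
  refine ⟨κ, ?_, ⟨v, hv⟩, ⟨w, hw⟩⟩
  rcases h with h | h
  · exact mem_elems_of_inner hs (v := v) (hv ▸ h)
  · exact mem_elems_of_inner hs (v := w) (hw ▸ h)

/-- The ends of a short diagonal used by the mesh are vertices of a common triangle. -/
lemma exists_elem_short {n : ℕ} {tr : Bool} {long : ℕ → ℕ → Prop}
    (hs : tr = true → ShortCorners n long) {i j : ℕ} (hl : ¬ long i j)
    (h : IsInner n (i + 1, j) ∨ IsInner n (i, j + 1)) :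
    ∃ κ ∈ elems n tr, (∃ v, vtx long κ v = (i + 1, j)) ∧ ∃ v, vtx long κ v = (i, j + 1) := by
  have h1 : vtx long (i, j, true) 2 = (i + 1, j) := by simp [vtx, hl]
  have h2 : vtx long (i, j, true) 1 = (i, j + 1) := by simp [vtx, hl]
  refine ⟨(i, j, true), ?_, ⟨2, h1⟩, ⟨1, h2⟩⟩
  rcases h with h | h
  · exact mem_elems_of_inner hs (v := 2) (h1 ▸ h)
  · exact mem_elems_of_inner hs (v := 1) (h2 ▸ h)

/-- Two nodes are joined if they are vertices of a common triangle. -/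
def Joined (n : ℕ) (tr : Bool) (long : ℕ → ℕ → Prop) (P Q : Node) : Prop :=
  ∃ κ ∈ elems n tr, (∃ v, vtx long κ v = P) ∧ ∃ v, vtx long κ v = Q

lemma Joined.symm {n : ℕ} {tr : Bool} {long : ℕ → ℕ → Prop} {P Q : Node}
    (h : Joined n tr long P Q) : Joined n tr long Q P := by
  obtain ⟨κ, hκ, h1, h2⟩ := h
  exact ⟨κ, hκ, h2, h1⟩

/-- Neighbouring grid points. -/
def GridAdj (P Q : Node) : Prop :=
  (P.1 + 1 = Q.1 ∧ P.2 = Q.2) ∨ (Q.1 + 1 = P.1 ∧ P.2 = Q.2) ∨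
  (P.1 = Q.1 ∧ P.2 + 1 = Q.2) ∨ (P.1 = Q.1 ∧ Q.2 + 1 = P.2)

lemma GridAdj.joined {n : ℕ} {tr : Bool} {long : ℕ → ℕ → Prop}
    (hs : tr = true → ShortCorners n long) {P Q : Node} (h : GridAdj P Q) (hP : IsInner n P) :
    Joined n tr long P Q := by
  obtain ⟨i, j⟩ := P
  obtain ⟨i', j'⟩ := Q
  rcases h with ⟨h1, h2⟩ | ⟨h1, h2⟩ | ⟨h1, h2⟩ | ⟨h1, h2⟩ <;> simp only at h1 h2 <;> subst h1 h2
  · exact exists_elem_horizontal hs (.inl hP)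
  · exact Joined.symm (exists_elem_horizontal hs (.inr hP))
  · exact exists_elem_vertical hs (.inl hP)
  · exact Joined.symm (exists_elem_vertical hs (.inr hP))

/-- A set of nodes that contains an inner node, and with each inner node all its neighbours in the
grid, contains all nodes except possibly the four corners. -/
lemma all_of_gridAdj {n : ℕ} {Z : Node → Prop}
    (hZ : ∀ P, IsInner n P → Z P → ∀ Q, GridAdj P Q → Z Q)
    {P₀ : Node} (hP₀ : IsInner n P₀) (h₀ : Z P₀) :
    (∀ P, IsInner n P → Z P) ∧
    (∀ i, 1 ≤ i → i < n → Z (i, 0) ∧ Z (i, n) ∧ Z (0, i) ∧ Z (n, i)) := by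
  have up1 : ∀ i j, IsInner n (i, j) → Z (i, j) → Z (i + 1, j) := fun i j h hz =>
    hZ _ h hz _ (.inl ⟨rfl, rfl⟩)
  have dn1 : ∀ i j, IsInner n (i + 1, j) → Z (i + 1, j) → Z (i, j) := fun i j h hz =>
    hZ _ h hz _ (.inr (.inl ⟨rfl, rfl⟩))
  have up2 : ∀ i j, IsInner n (i, j) → Z (i, j) → Z (i, j + 1) := fun i j h hz =>
    hZ _ h hz _ (.inr (.inr (.inl ⟨rfl, rfl⟩)))
  have dn2 : ∀ i j, IsInner n (i, j + 1) → Z (i, j + 1) → Z (i, j) := fun i j h hz =>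
    hZ _ h hz _ (.inr (.inr (.inr ⟨rfl, rfl⟩)))
  obtain ⟨i₀, j₀⟩ := P₀
  obtain ⟨a1, a2, a3, a4⟩ := hP₀
  simp only at a1 a2 a3 a4
  have row : ∀ j, 1 ≤ j → j < n → Z (i₀, j) := by
    have hup : ∀ d, j₀ + d < n → Z (i₀, j₀ + d) := by
      intro d
      induction d with
      | zero => intro _; exact h₀
      | succ d ih =>
        intro hd
        exact up2 _ _ ⟨a1, a2, by simp; omega, by simp; omega⟩ (ih (by omega))
    have hdn : ∀ d j, j + d = j₀ → 1 ≤ j → Z (i₀, j) := by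
      intro d
      induction d with
      | zero => intro j hj _; simpa using (by simpa using hj : j = j₀) ▸ h₀
      | succ d ih =>
        intro j hj hj1
        exact dn2 _ _ ⟨a1, a2, by simp, by simp; omega⟩ (ih (j + 1) (by omega) (by omega))
    intro j h1 h2
    rcases le_total j j₀ with h | h
    · exact hdn (j₀ - j) j (by omega) h1
    · have := hup (j - j₀) (by omega)
      rwa [Nat.add_sub_cancel' h] at this
  have all : ∀ i j, 1 ≤ i → i < n → 1 ≤ j → j < n → Z (i, j) := by
    intro i j hi1 hi2 hj1 hj2
    have hup : ∀ d, i₀ + d < n → Z (i₀ + d, j) := by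
      intro d
      induction d with
      | zero => intro _; exact row j hj1 hj2
      | succ d ih =>
        intro hd
        exact up1 _ _ ⟨by simp; omega, by simp; omega, hj1, hj2⟩ (ih (by omega))
    have hdn : ∀ d i, i + d = i₀ → 1 ≤ i → Z (i, j) := by
      intro d
      induction d with
      | zero => intro i hi _; simpa using (by simpa using hi : i = i₀) ▸ row j hj1 hj2
      | succ d ih =>
        intro i hi hi1
        exact dn1 _ _ ⟨by simp, by simp; omega, hj1, hj2⟩ (ih (i + 1) (by omega) (by omega))
    rcases le_total i i₀ with h | h
    · exact hdn (i₀ - i) i (by omega) hi1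
    · have := hup (i - i₀) (by omega)
      rwa [Nat.add_sub_cancel' h] at this
  refine ⟨fun P hP => all P.1 P.2 hP.1 hP.2.1 hP.2.2.1 hP.2.2.2, fun i h1 h2 => ⟨?_, ?_, ?_, ?_⟩⟩
  · exact dn2 _ _ ⟨h1, h2, by simp, by simp; omega⟩ (all _ _ h1 h2 (by omega) (by omega))
  · obtain ⟨m, rfl⟩ : ∃ m, n = m + 1 := ⟨n - 1, by omega⟩
    exact up2 _ _ ⟨h1, h2, by simp; omega, by simp⟩ (all _ _ h1 h2 (by omega) (by omega))
  · exact dn1 _ _ ⟨by simp, by simp; omega, h1, h2⟩ (all _ _ (by omega) (by omega) h1 h2)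
  · obtain ⟨m, rfl⟩ : ∃ m, n = m + 1 := ⟨n - 1, by omega⟩
    exact up1 _ _ ⟨by simp; omega, by simp, h1, h2⟩ (all _ _ (by omega) (by omega) h1 h2)

/-- If the small rhombuses at the corners `(n, 0)` and `(0, n)` are divided along their short
diagonals, then a set of nodes that contains all inner nodes and the nodes joined to them contains
these two corners as well. -/
lemma corners_of_joined {n : ℕ} {tr : Bool} {long : ℕ → ℕ → Prop}
    (hs : tr = true → ShortCorners n long) {Z : Node → Prop}
    (hZ : ∀ P, IsInner n P → Z P → ∀ Q, Joined n tr long P Q → Z Q)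
    (hn : 2 ≤ n) (h1 : ¬ long (n - 1) 0) (h2 : ¬ long 0 (n - 1))
    (hall : ∀ P, IsInner n P → Z P) : Z (n, 0) ∧ Z (0, n) := by
  obtain ⟨m, rfl⟩ : ∃ m, n = m + 1 := ⟨n - 1, by omega⟩
  simp only [Nat.add_sub_cancel] at h1 h2
  constructor
  · have hP : IsInner (m + 1) (m, 0 + 1) := ⟨by simp; omega, by simp, by simp, by simp; omega⟩
    exact hZ _ hP (hall _ hP) _ (Joined.symm (exists_elem_short hs h1 (.inr hP)))
  · have hP : IsInner (m + 1) (0 + 1, m) := ⟨by simp, by simp; omega, by simp; omega, by simp⟩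
    exact hZ _ hP (hall _ hP) _ (exists_elem_short hs h2 (.inl hP))

/-! ### Forms assembled from element matrices -/

/-- The bilinear form of a `3 × 3` element matrix. -/
def elemForm (k : Fin 3 → Fin 3 → ℝ) (x y : Fin 3 → ℝ) : ℝ := ∑ v, ∑ w, k v w * x v * y w

/-- The bilinear form on nodal values that is assembled from the element matrices `k`. -/
def form (K : Finset Elem) (long : ℕ → ℕ → Prop) (k : Elem → Fin 3 → Fin 3 → ℝ) :
    (Node → ℝ) →ₗ[ℝ] (Node → ℝ) →ₗ[ℝ] ℝ :=
  LinearMap.mk₂ ℝ (fun U W => ∑ κ ∈ K, elemForm (k κ) (U ∘ vtx long κ) (W ∘ vtx long κ))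
    (by intros; simp only [elemForm, ← Finset.sum_add_distrib]
        refine Finset.sum_congr rfl fun κ _ => Finset.sum_congr rfl fun v _ =>
          Finset.sum_congr rfl fun w _ => ?_
        simp; ring)
    (by intros; simp only [elemForm, Finset.smul_sum]
        refine Finset.sum_congr rfl fun κ _ => Finset.sum_congr rfl fun v _ =>
          Finset.sum_congr rfl fun w _ => ?_
        simp; ring)
    (by intros; simp only [elemForm, ← Finset.sum_add_distrib]
        refine Finset.sum_congr rfl fun κ _ => Finset.sum_congr rfl fun v _ =>
          Finset.sum_congr rfl fun w _ => ?_
        simp; ring)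
    (by intros; simp only [elemForm, Finset.smul_sum]
        refine Finset.sum_congr rfl fun κ _ => Finset.sum_congr rfl fun v _ =>
          Finset.sum_congr rfl fun w _ => ?_
        simp; ring)

lemma form_apply (K : Finset Elem) (long : ℕ → ℕ → Prop) (k : Elem → Fin 3 → Fin 3 → ℝ)
    (U W : Node → ℝ) :
    form K long k U W = ∑ κ ∈ K, elemForm (k κ) (U ∘ vtx long κ) (W ∘ vtx long κ) := rfl

/-- The nodal values of the nodal basis function at `P`. -/
def unit (P : Node) : Node → ℝ := Pi.single P 1

lemma unit_apply (P Q : Node) : unit P Q = if Q = P then 1 else 0 := by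
  simp [unit, Pi.single_apply]

lemma unit_self (P : Node) : unit P P = 1 := by simp [unit]

lemma unit_nonneg (P Q : Node) : 0 ≤ unit P Q := by
  rw [unit_apply]; split_ifs <;> norm_num

lemma unit_le_one (P Q : Node) : unit P Q ≤ 1 := by
  rw [unit_apply]; split_ifs <;> norm_num

/-- All nodes of the grid. -/
def nodes (n : ℕ) : Finset Node := Finset.range (n + 1) ×ˢ Finset.range (n + 1)

lemma mem_nodes {n : ℕ} {P : Node} : P ∈ nodes n ↔ P.1 ≤ n ∧ P.2 ≤ n := by
  simp [nodes]

lemma vtx_mem_nodes {n : ℕ} {tr : Bool} {long : ℕ → ℕ → Prop} {κ : Elem}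
    (hκ : κ ∈ elems n tr) (v : Fin 3) : vtx long κ v ∈ nodes n := by
  have := vtx_bounds long κ v
  obtain ⟨h1, h2, -⟩ := mem_elems.1 hκ
  exact mem_nodes.2 ⟨by omega, by omega⟩

/-- The form depends only on the values at the vertices of its triangles. -/
lemma form_congr {K : Finset Elem} {long : ℕ → ℕ → Prop} {k : Elem → Fin 3 → Fin 3 → ℝ}
    {U U' W W' : Node → ℝ} (hU : ∀ κ ∈ K, ∀ v, U (vtx long κ v) = U' (vtx long κ v))
    (hW : ∀ κ ∈ K, ∀ v, W (vtx long κ v) = W' (vtx long κ v)) :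
    form K long k U W = form K long k U' W' := by
  rw [form_apply, form_apply]
  refine Finset.sum_congr rfl fun κ hκ => ?_
  have h1 : U ∘ vtx long κ = U' ∘ vtx long κ := funext (hU κ hκ)
  have h2 : W ∘ vtx long κ = W' ∘ vtx long κ := funext (hW κ hκ)
  rw [h1, h2]

lemma form_eq_sum {n : ℕ} {tr : Bool} {long : ℕ → ℕ → Prop}
    {k : Elem → Fin 3 → Fin 3 → ℝ} (U W : Node → ℝ) :
    form (elems n tr) long k U W = ∑ Q ∈ nodes n, U Q * form (elems n tr) long k (unit Q) W := by
  have : form (elems n tr) long k U W =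
      form (elems n tr) long k (∑ Q ∈ nodes n, U Q • unit Q) W := by
    refine form_congr (fun κ hκ v => ?_) (fun _ _ _ => rfl)
    have hv := vtx_mem_nodes (long := long) hκ v
    simp [Finset.sum_apply, unit_apply, hv]
  rw [this]
  simp [map_sum, LinearMap.sum_apply]

/-- The entry of the assembled matrix at a pair `Q ≠ P` is nonpositive if the corresponding
entries of the element matrices are. -/
lemma form_unit_nonpos {K : Finset Elem} {long : ℕ → ℕ → Prop}
    {k : Elem → Fin 3 → Fin 3 → ℝ} {P Q : Node} (hPQ : Q ≠ P)
    (h : ∀ κ ∈ K, ∀ v w, v ≠ w → vtx long κ v = Q → vtx long κ w = P → k κ v w ≤ 0) :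
    form K long k (unit Q) (unit P) ≤ 0 ∧
    ∀ κ ∈ K, ∀ v w, vtx long κ v = Q → vtx long κ w = P → k κ v w < 0 →
      form K long k (unit Q) (unit P) < 0 := by
  have key : ∀ κ ∈ K, ∀ v w,
      k κ v w * (unit Q ∘ vtx long κ) v * (unit P ∘ vtx long κ) w ≤ 0 := by
    intro κ hκ v w
    simp only [Function.comp, unit_apply]
    split_ifs with h1 h2
    · have hvw : v ≠ w := by rintro rfl; exact hPQ (h1 ▸ h2)
      simpa using h κ hκ v w hvw h1 h2
    all_goals simp
  have key2 : ∀ κ ∈ K,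
      elemForm (k κ) (unit Q ∘ vtx long κ) (unit P ∘ vtx long κ) ≤ 0 := fun κ hκ =>
    Finset.sum_nonpos fun v _ => Finset.sum_nonpos fun w _ => key κ hκ v w
  refine ⟨Finset.sum_nonpos key2, ?_⟩
  intro κ hκ v w hv hw hlt
  rw [form_apply]
  refine (Finset.sum_lt_sum key2 ⟨κ, hκ, ?_⟩).trans_eq Finset.sum_const_zero
  refine (Finset.sum_lt_sum (fun v _ => Finset.sum_nonpos fun w _ => key κ hκ v w)
    ⟨v, Finset.mem_univ _, ?_⟩).trans_eq Finset.sum_const_zero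
  refine (Finset.sum_lt_sum (fun w _ => key κ hκ v w)
    ⟨w, Finset.mem_univ _, ?_⟩).trans_eq Finset.sum_const_zero
  simpa [unit_apply, hv, hw] using hlt

/-! ### Matrices with positive inverse -/

/-- A matrix is invertible with positive inverse; the condition is written as a system of strict
polynomial inequalities, so that it is visibly stable under small perturbations. -/
def InvPos {ι : Type*} [Fintype ι] [DecidableEq ι] (A : ι → ι → ℝ) : Prop :=
  ∀ p q, 0 < (Matrix.of A).det * (Matrix.of A).adjugate p q

lemma invPos_iff {ι : Type*} [Fintype ι] [DecidableEq ι] [Nonempty ι] (A : ι → ι → ℝ) :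
    InvPos A ↔ IsUnit (Matrix.of A).det ∧ ∀ p q, 0 < (Matrix.of A)⁻¹ p q := by
  unfold InvPos
  generalize (Matrix.of A : Matrix ι ι ℝ) = A
  constructor
  · intro h
    have hd : A.det ≠ 0 := by
      intro h0
      have := h (Classical.arbitrary ι) (Classical.arbitrary ι)
      simp [h0] at this
    refine ⟨isUnit_iff_ne_zero.2 hd, fun p q => ?_⟩
    rw [Matrix.inv_def, Matrix.smul_apply, Ring.inverse_eq_inv', smul_eq_mul]
    have h2 : A.det⁻¹ * A.adjugate p q = (A.det * A.adjugate p q) * (A.det⁻¹ ^ 2) := by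
      field_simp
    rw [h2]
    have := h p q
    positivity
  · rintro ⟨hd, h⟩ p q
    have hd := isUnit_iff_ne_zero.1 hd
    have := h p q
    rw [Matrix.inv_def, Matrix.smul_apply, Ring.inverse_eq_inv', smul_eq_mul] at this
    have h2 : A.det * A.adjugate p q = (A.det⁻¹ * A.adjugate p q) * (A.det ^ 2) := by
      field_simp
    rw [h2]
    positivity

lemma invPos_mul_iff {ι : Type*} [Fintype ι] [DecidableEq ι] (A : ι → ι → ℝ)
    {r : ℝ} (hr : 0 < r) : InvPos (fun p q => r * A p q) ↔ InvPos A := by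
  have h0 : (Matrix.of fun p q => r * A p q) = r • Matrix.of A := rfl
  unfold InvPos
  refine forall_congr' fun p => forall_congr' fun q => ?_
  rw [h0, Matrix.det_smul, Matrix.adjugate_smul, Matrix.smul_apply, smul_eq_mul,
    mul_mul_mul_comm]
  exact mul_pos_iff_of_pos_left (by positivity)

lemma InvPos.exists_ball {ι : Type*} [Fintype ι] [DecidableEq ι] {A : ι → ι → ℝ}
    (h : InvPos A) : ∃ ε > 0, ∀ B : ι → ι → ℝ, (∀ p q, |B p q - A p q| ≤ ε) → InvPos B := by
  have hopen : IsOpen {B : ι → ι → ℝ | InvPos B} := by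
    have : {B : ι → ι → ℝ | InvPos B} = ⋂ p, ⋂ q,
        {B : ι → ι → ℝ | 0 < (Matrix.of B).det * (Matrix.of B).adjugate p q} := by
      ext B; simp [InvPos]
    rw [this]
    refine isOpen_iInter_of_finite fun p => isOpen_iInter_of_finite fun q => ?_
    refine isOpen_lt continuous_const ?_
    have h0 : Continuous fun B : ι → ι → ℝ => (Matrix.of B : Matrix ι ι ℝ) := continuous_id
    exact (h0.matrix_det).mul ((h0.matrix_adjugate).matrix_elem p q)
  obtain ⟨ε, hε, hb⟩ := Metric.isOpen_iff.1 hopen A h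
  refine ⟨ε / 2, by positivity, fun B hB => hb ?_⟩
  rw [Metric.mem_ball]
  refine lt_of_le_of_lt ((dist_pi_le_iff (by positivity)).2 fun p =>
    (dist_pi_le_iff (by positivity)).2 fun q => ?_) (half_lt_self hε)
  rw [Real.dist_eq]
  exact hB p q

/-- If `A⁻¹ > 0` and `A x ≥ 0`, then `x` vanishes as soon as one of its entries does. -/
lemma InvPos.eq_zero {ι : Type*} [Fintype ι] [DecidableEq ι] {A : ι → ι → ℝ} (h : InvPos A)
    {x : ι → ℝ} (hx : ∀ p, 0 ≤ ∑ q, A p q * x q) {p₀ : ι} (h0 : x p₀ = 0) : x = 0 := by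
  have : Nonempty ι := ⟨p₀⟩
  obtain ⟨hd, hpos⟩ := (invPos_iff A).1 h
  set B : Matrix ι ι ℝ := Matrix.of A
  set r : ι → ℝ := B.mulVec x with hr
  have hxr : x = B⁻¹.mulVec r := by
    rw [hr, Matrix.mulVec_mulVec, Matrix.nonsing_inv_mul _ hd, Matrix.one_mulVec]
  have hr0 : ∀ p, 0 ≤ r p := hx
  -- `0 = x p₀ = (B⁻¹ r) p₀` is a sum of nonnegative terms with positive weights
  have hsum : ∑ q, B⁻¹ p₀ q * r q = 0 := by
    have := congrFun hxr p₀
    rw [h0] at this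
    exact this.symm
  have hz : r = 0 := by
    funext q
    have := (Finset.sum_eq_zero_iff_of_nonneg
      (fun q _ => mul_nonneg (hpos p₀ q).le (hr0 q))).1 hsum q (Finset.mem_univ _)
    exact (mul_eq_zero.1 this).resolve_left (hpos p₀ q).ne'
  rw [hxr, hz, Matrix.mulVec_zero]

/-! ### The discrete strong minimum principle -/

/-- The node `(p + 1, q + 1)` of the block at the position `o`. -/
def blockNode (l : ℕ) (o : Node) (p : Fin (l + 1) × Fin (l + 1)) : Node :=
  (o.1 + p.1 + 1, o.2 + p.2 + 1)

/-- The way in which the small rhombuses of `G_l(θ)` are divided. -/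
def patchLong (l : ℕ) (i j : ℕ) : Prop := (1 ≤ i ∧ i ≤ l) ∧ (1 ≤ j ∧ j ≤ l)

/-- The mesh contains a copy of `G_l` at the position `o`. -/
def HasPatch (n : ℕ) (long : ℕ → ℕ → Prop) (l : ℕ) (o : Node) : Prop :=
  o.1 + l + 2 ≤ n ∧ o.2 + l + 2 ≤ n ∧
    ∀ p q, p < l + 2 → q < l + 2 → (long (o.1 + p) (o.2 + q) ↔ patchLong l p q)

/-- The node `P` is an inner node of the copy of `G_l` at the position `o`. -/
def InBlock (l : ℕ) (o P : Node) : Prop :=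
  o.1 + 1 ≤ P.1 ∧ P.1 ≤ o.1 + l + 1 ∧ o.2 + 1 ≤ P.2 ∧ P.2 ≤ o.2 + l + 1

/-- The four small rhombuses around the inner node `P` are divided along their short diagonals. -/
def ShortStar (long : ℕ → ℕ → Prop) (P : Node) : Prop :=
  ∀ i j, i ≤ P.1 → P.1 ≤ i + 1 → j ≤ P.2 → P.2 ≤ j + 1 → ¬ long i j

lemma blockNode_injective (l : ℕ) (o : Node) : Function.Injective (blockNode l o) := by
  rintro ⟨p, q⟩ ⟨p', q'⟩ h
  simp only [blockNode, Prod.mk.injEq] at h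
  ext <;> simp <;> omega

lemma exists_blockNode {l : ℕ} {o P : Node} (h : InBlock l o P) : ∃ p, blockNode l o p = P := by
  obtain ⟨h1, h2, h3, h4⟩ := h
  refine ⟨(⟨P.1 - o.1 - 1, by omega⟩, ⟨P.2 - o.2 - 1, by omega⟩), ?_⟩
  simp only [blockNode]
  ext <;> simp <;> omega

lemma inBlock_blockNode (l : ℕ) (o : Node) (p : Fin (l + 1) × Fin (l + 1)) :
    InBlock l o (blockNode l o p) := by
  have := p.1.2; have := p.2.2
  refine ⟨?_, ?_, ?_, ?_⟩ <;> simp only [blockNode] <;> omega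

lemma InBlock.inner {n l : ℕ} {long : ℕ → ℕ → Prop} {o P : Node} (h : InBlock l o P)
    (hp : HasPatch n long l o) : IsInner n P := by
  obtain ⟨h1, h2, h3, h4⟩ := h
  obtain ⟨h5, h6, -⟩ := hp
  exact ⟨by omega, by omega, by omega, by omega⟩

/-- A triangle that joins an inner node of a patch with a node that is not an inner node of that
patch lies in the lining of the patch. -/
lemma HasPatch.not_long {n l : ℕ} {long : ℕ → ℕ → Prop} {o P Q : Node}
    (hp : HasPatch n long l o) (hP : InBlock l o P) (hQ : ¬ InBlock l o Q) {κ : Elem}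
    {v w : Fin 3} (hv : vtx long κ v = Q) (hw : vtx long κ w = P) : ¬ long κ.1 κ.2.1 := by
  have b1 := vtx_bounds long κ v
  have b2 := vtx_bounds long κ w
  rw [hv] at b1; rw [hw] at b2
  obtain ⟨h1, h2, h3, h4⟩ := hP
  have := hp.2.2 (κ.1 - o.1) (κ.2.1 - o.2) (by omega) (by omega)
  rw [Nat.add_sub_cancel' (by omega), Nat.add_sub_cancel' (by omega)] at this
  rw [this]
  rintro ⟨⟨c1, c2⟩, c3, c4⟩
  exact hQ ⟨by omega, by omega, by omega, by omega⟩

/-- A function that is nonnegative at the vertices of the mesh agrees there with a function that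
is nonnegative everywhere. -/
lemma exists_nonneg_extension {K : Finset Elem} {long : ℕ → ℕ → Prop} {W : Node → ℝ}
    (hW : ∀ κ ∈ K, ∀ v, 0 ≤ W (vtx long κ v)) :
    ∃ W' : Node → ℝ, (∀ κ ∈ K, ∀ v, W (vtx long κ v) = W' (vtx long κ v)) ∧
      (∀ Q, 0 ≤ W' Q) ∧ ∀ P, W P = 0 → W' P = 0 := by
  refine ⟨fun Q => |W Q|, fun κ hκ v => (abs_of_nonneg (hW κ hκ v)).symm,
    fun Q => abs_nonneg _, fun P h => by simp [h]⟩

/-- The step of the strong minimum principle at a node `P` such that all off-diagonal entries in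
the row of `P` are nonpositive. -/
lemma zero_of_form_neg {n : ℕ} {tr : Bool} {long : ℕ → ℕ → Prop}
    {k : Elem → Fin 3 → Fin 3 → ℝ} {P : Node}
    (hneg : ∀ Q, Q ≠ P → form (elems n tr) long k (unit Q) (unit P) ≤ 0)
    {W : Node → ℝ} (hW : ∀ κ ∈ elems n tr, ∀ v, 0 ≤ W (vtx long κ v)) (h0 : W P = 0)
    (hf : 0 ≤ form (elems n tr) long k W (unit P)) {Q : Node}
    (hQ : Joined n tr long P Q) (hlt : form (elems n tr) long k (unit Q) (unit P) < 0) :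
    W Q = 0 := by
  obtain ⟨W', hWW', hW0, hP0⟩ := exists_nonneg_extension hW
  replace hP0 := hP0 P h0
  rw [form_congr hWW' (fun _ _ _ => rfl), form_eq_sum] at hf
  have hterm : ∀ Q ∈ nodes n, W' Q * form (elems n tr) long k (unit Q) (unit P) ≤ 0 := by
    intro Q _
    by_cases hQ : Q = P
    · rw [hQ, hP0]; simp
    · exact mul_nonpos_of_nonneg_of_nonpos (hW0 Q) (hneg Q hQ)
  have hz := (Finset.sum_eq_zero_iff_of_nonpos hterm).1
    (le_antisymm (Finset.sum_nonpos hterm) hf)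
  obtain ⟨κ, hκ, -, v, hv⟩ := hQ
  have hQn : Q ∈ nodes n := hv ▸ vtx_mem_nodes hκ v
  have := (mul_eq_zero.1 (hz Q hQn)).resolve_right hlt.ne
  rw [← this, ← hv]
  exact hWW' κ hκ v

/-- The step of the strong minimum principle at a node whose star is acute. -/
lemma zero_of_joined_shortStar {n : ℕ} {tr : Bool} {long : ℕ → ℕ → Prop}
    {k : Elem → Fin 3 → Fin 3 → ℝ}
    (hk : ∀ κ ∈ elems n tr, ¬ long κ.1 κ.2.1 → ∀ v w, v ≠ w → k κ v w < 0)
    {W : Node → ℝ} (hW : ∀ κ ∈ elems n tr, ∀ v, 0 ≤ W (vtx long κ v)) {P : Node}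
    (hP : ShortStar long P) (h0 : W P = 0)
    (hf : 0 ≤ form (elems n tr) long k W (unit P)) :
    ∀ Q, Joined n tr long P Q → W Q = 0 := by
  have hκP : ∀ κ ∈ elems n tr, ∀ v w, v ≠ w → vtx long κ w = P → k κ v w < 0 := by
    intro κ hκ v w hvw hw
    refine hk κ hκ ?_ v w hvw
    have := vtx_bounds long κ w
    rw [hw] at this
    exact hP _ _ this.1 this.2.1 this.2.2.1 this.2.2.2
  have hneg : ∀ Q, Q ≠ P → _ := fun Q hQ => form_unit_nonpos (K := elems n tr) (long := long)
    (k := k) hQ fun κ hκ v w hvw _ hw => (hκP κ hκ v w hvw hw).le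
  intro Q hQ
  by_cases hQP : Q = P
  · rw [hQP, h0]
  obtain ⟨κ, hκ, ⟨w, hw⟩, v, hv⟩ := id hQ
  have hvw : v ≠ w := by rintro rfl; exact hQP (hv ▸ hw)
  exact zero_of_form_neg (fun Q hQ => (hneg Q hQ).1) hW h0 hf hQ
    ((hneg Q hQP).2 κ hκ v w hv hw (hκP κ hκ v w hvw hw))

/-- The step of the strong minimum principle at an inner node of a patch on which the local matrix
has a positive inverse. -/
lemma zero_of_joined_patch {n : ℕ} {tr : Bool} {long : ℕ → ℕ → Prop}
    {k : Elem → Fin 3 → Fin 3 → ℝ}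
    (hk : ∀ κ ∈ elems n tr, ¬ long κ.1 κ.2.1 → ∀ v w, v ≠ w → k κ v w < 0)
    {W : Node → ℝ} (hW : ∀ κ ∈ elems n tr, ∀ v, 0 ≤ W (vtx long κ v))
    (hf : ∀ P, IsInner n P → 0 ≤ form (elems n tr) long k W (unit P))
    {l : ℕ} {o : Node} (hp : HasPatch n long l o)
    (hinv : InvPos fun p q => form (elems n tr) long k (unit (blockNode l o q))
      (unit (blockNode l o p)))
    {P : Node} (hP : InBlock l o P) (h0 : W P = 0) :
    ∀ Q, Joined n tr long P Q → W Q = 0 := by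
  have hneg : ∀ P Q, InBlock l o P → ¬ InBlock l o Q →
      form (elems n tr) long k (unit Q) (unit P) ≤ 0 ∧
      (Joined n tr long P Q → form (elems n tr) long k (unit Q) (unit P) < 0) := by
    intro P Q hP hQ
    have hQP : Q ≠ P := fun h => hQ (h ▸ hP)
    have h1 := form_unit_nonpos (K := elems n tr) (long := long) (k := k) hQP
      fun κ hκ v w hvw hv hw => (hk κ hκ (hp.not_long hP hQ hv hw) v w hvw).le
    refine ⟨h1.1, ?_⟩
    rintro ⟨κ, hκ, ⟨w, hw⟩, v, hv⟩
    have hvw : v ≠ w := by rintro rfl; exact hQP (hv ▸ hw)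
    exact h1.2 κ hκ v w hv hw (hk κ hκ (hp.not_long hP hQ hv hw) v w hvw)
  -- grid points that are not vertices of the mesh carry arbitrary values of `W`
  obtain ⟨W', hWW', hW0, hP0⟩ := exists_nonneg_extension hW
  replace hP0 := hP0 P h0
  set F : Node → Node → ℝ := fun P Q => form (elems n tr) long k (unit Q) (unit P) with hF
  classical
  set I : Finset Node := Finset.univ.image (blockNode l o) with hI
  have hmemI : ∀ Q, Q ∈ I ↔ InBlock l o Q := by
    intro Q
    simp only [hI, Finset.mem_image, Finset.mem_univ, true_and]
    exact ⟨fun ⟨p, hp⟩ => hp ▸ inBlock_blockNode l o p, exists_blockNode⟩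
  have hIn : I ⊆ nodes n := by
    intro Q hQ
    obtain ⟨-, h2, -, h4⟩ := ((hmemI Q).1 hQ).inner hp
    exact mem_nodes.2 ⟨h2.le, h4.le⟩
  -- the row of the system at `P`, split into the unknowns inside and outside the patch
  have hsplit : ∀ P, form (elems n tr) long k W (unit P) =
      (∑ q, F P (blockNode l o q) * W' (blockNode l o q)) +
      ∑ Q ∈ nodes n \ I, W' Q * F P Q := by
    intro P
    rw [form_congr hWW' (fun _ _ _ => rfl), form_eq_sum, ← Finset.sum_sdiff hIn, add_comm]
    congr 1
    rw [hI, Finset.sum_image (fun a _ b _ h => blockNode_injective l o h)]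
    exact Finset.sum_congr rfl fun _ _ => mul_comm _ _
  have hout : ∀ p, ∀ Q ∈ nodes n \ I, W' Q * F (blockNode l o p) Q ≤ 0 := by
    intro p Q hQ
    have hQ' : ¬ InBlock l o Q := fun h => (Finset.mem_sdiff.1 hQ).2 ((hmemI Q).2 h)
    exact mul_nonpos_of_nonneg_of_nonpos (hW0 Q) (hneg _ _ (inBlock_blockNode l o p) hQ').1
  obtain ⟨p₀, hp₀⟩ := exists_blockNode hP
  have hx : (fun q => W' (blockNode l o q)) = 0 := by
    -- the outer unknowns enter with the good sign, so the inner ones satisfy `A x ≥ 0`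
    refine hinv.eq_zero (p₀ := p₀) (fun p => ?_) (by simp only [hp₀, hP0])
    have h1 := hf _ ((inBlock_blockNode l o p).inner hp)
    rw [hsplit] at h1
    have h2 := Finset.sum_nonpos (hout p)
    change 0 ≤ ∑ q, F (blockNode l o p) (blockNode l o q) * W' (blockNode l o q)
    linarith
  have hinz : ∀ q, W' (blockNode l o q) = 0 := fun q => congrFun hx q
  intro Q hQ
  obtain ⟨κ, hκ, hκP, v, hv⟩ := id hQ
  have hQn : Q ∈ nodes n := hv ▸ vtx_mem_nodes hκ v
  have hWQ : W Q = W' Q := by rw [← hv]; exact hWW' κ hκ v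
  rw [hWQ]
  by_cases hQb : InBlock l o Q
  · obtain ⟨q, rfl⟩ := exists_blockNode hQb
    exact hinz q
  · have h1 := hf _ (hP.inner hp)
    rw [hsplit P] at h1
    simp only [hinz, mul_zero, Finset.sum_const_zero, zero_add] at h1
    have hout' := hout p₀
    rw [hp₀] at hout'
    -- inside the patch nothing is left, so a sum of nonpositive terms is nonnegative
    have hz := (Finset.sum_eq_zero_iff_of_nonpos hout').1
      (le_antisymm (Finset.sum_nonpos hout') h1) Q
      (Finset.mem_sdiff.2 ⟨hQn, fun h => hQb ((hmemI Q).1 h)⟩)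
    exact (mul_eq_zero.1 hz).resolve_right ((hneg P Q hP hQb).2 hQ).ne

/-- Each inner node has an acute star or is an inner node of a patch. -/
def Covered (n : ℕ) (long : ℕ → ℕ → Prop) (k : ℕ) : Prop :=
  ∀ P, IsInner n P → ShortStar long P ∨
    ∃ l o, 1 ≤ l ∧ l ≤ k ∧ HasPatch n long l o ∧ InBlock l o P

/-- In a covered mesh the small rhombuses at the four corners are divided along their short
diagonals. -/
lemma Covered.corners {n k : ℕ} {long : ℕ → ℕ → Prop} (h : Covered n long k) (hn : 2 ≤ n) :
    ShortCorners n long ∧ ¬ long (n - 1) 0 ∧ ¬ long 0 (n - 1) := by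
  have key : ∀ i j i' j' : ℕ, IsInner n (i, j) → i' ≤ i → i ≤ i' + 1 → j' ≤ j → j ≤ j' + 1 →
      (i' = 0 ∨ i' = n - 1) → (j' = 0 ∨ j' = n - 1) → ¬ long i' j' := by
    intro i j i' j' hP h1 h2 h3 h4 h5 h6
    rcases h _ hP with hs | ⟨l, o, -, -, hp, hb⟩
    · exact hs _ _ h1 h2 h3 h4
    · obtain ⟨q1, q2, q3⟩ := hp
      obtain ⟨b1, b2, b3, b4⟩ := hb
      simp only at b1 b2 b3 b4
      have := q3 (i' - o.1) (j' - o.2) (by omega) (by omega)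
      rw [Nat.add_sub_cancel' (by omega), Nat.add_sub_cancel' (by omega)] at this
      rw [this]
      rintro ⟨⟨c1, c2⟩, c3, c4⟩
      omega
  have hI : ∀ i j, 1 ≤ i → i < n → 1 ≤ j → j < n → IsInner n (i, j) := fun _ _ a b c d =>
    ⟨a, b, c, d⟩
  refine ⟨⟨key 1 1 0 0 (hI _ _ ?_ ?_ ?_ ?_) ?_ ?_ ?_ ?_ ?_ ?_,
    key (n - 1) (n - 1) (n - 1) (n - 1) (hI _ _ ?_ ?_ ?_ ?_) ?_ ?_ ?_ ?_ ?_ ?_⟩,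
    key (n - 1) 1 (n - 1) 0 (hI _ _ ?_ ?_ ?_ ?_) ?_ ?_ ?_ ?_ ?_ ?_,
    key 1 (n - 1) 0 (n - 1) (hI _ _ ?_ ?_ ?_ ?_) ?_ ?_ ?_ ?_ ?_ ?_⟩ <;> omega

/-- The discrete strong minimum principle for nodal values: a nonnegative supersolution that
vanishes at an inner node vanishes at all nodes, except possibly at corners. -/
lemma strong_minimum {n k : ℕ} {tr : Bool} {long : ℕ → ℕ → Prop}
    {m : Elem → Fin 3 → Fin 3 → ℝ}
    (hm : ∀ κ ∈ elems n tr, ¬ long κ.1 κ.2.1 → ∀ v w, v ≠ w → m κ v w < 0)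
    (hs : tr = true → ShortCorners n long) (hcov : Covered n long k)
    (hinv : ∀ l o, 1 ≤ l → l ≤ k → HasPatch n long l o → InvPos fun p q =>
      form (elems n tr) long m (unit (blockNode l o q)) (unit (blockNode l o p)))
    {W : Node → ℝ} (hW : ∀ κ ∈ elems n tr, ∀ v, 0 ≤ W (vtx long κ v))
    (hf : ∀ P, IsInner n P → 0 ≤ form (elems n tr) long m W (unit P))
    {P₀ : Node} (hP₀ : IsInner n P₀) (h₀ : W P₀ = 0) :
    (∀ P, IsInner n P → W P = 0) ∧
    (∀ i, 1 ≤ i → i < n → W (i, 0) = 0 ∧ W (i, n) = 0 ∧ W (0, i) = 0 ∧ W (n, i) = 0) ∧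
    W (n, 0) = 0 ∧ W (0, n) = 0 := by
  have step : ∀ P, IsInner n P → W P = 0 → ∀ Q, Joined n tr long P Q → W Q = 0 := by
    intro P hP h0
    rcases hcov P hP with h | ⟨l, o, hl1, hl2, hp, hb⟩
    · exact zero_of_joined_shortStar hm hW h h0 (hf P hP)
    · exact zero_of_joined_patch hm hW hf hp (hinv l o hl1 hl2 hp) hb h0
  have hall := all_of_gridAdj (Z := fun P => W P = 0)
    (fun P hP h0 Q hQ => step P hP h0 Q (hQ.joined hs hP)) hP₀ h₀
  have hn : 2 ≤ n := by obtain ⟨h1, h2, -⟩ := hP₀; omega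
  obtain ⟨-, hc1, hc2⟩ := hcov.corners hn
  exact ⟨hall.1, hall.2, corners_of_joined hs step hn hc1 hc2 hall.1⟩

/-! ### Element matrices of the Laplacian -/

/-- The element stiffness matrix of a triangle, up to a factor that is the same for all triangles
of the mesh. With `δ₁`, `δ₂` the increments along the two sides in the grid directions, it is the
matrix of `δ₁² + δ₂² - 2 t δ₁ δ₂`. -/
def elemStiff (t : ℝ) : Fin 3 → Fin 3 → ℝ :=
  ![![2 - 2 * t, t - 1, t - 1], ![t - 1, 1, -t], ![t - 1, -t, 1]]

lemma elemForm_elemStiff (t : ℝ) (x y : Fin 3 → ℝ) :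
    elemForm (elemStiff t) x y = (x 1 - x 0) * (y 1 - y 0) + (x 2 - x 0) * (y 2 - y 0) -
      t * ((x 1 - x 0) * (y 2 - y 0) + (x 2 - x 0) * (y 1 - y 0)) := by
  simp [elemForm, elemStiff, Fin.sum_univ_three]; ring

open Classical in
/-- The sign of the element: the angle at vertex `0` is `θ` in the triangles of rhombuses divided
along the short diagonal, and `π - θ` in the others. -/
def elemSign (long : ℕ → ℕ → Prop) (κ : Elem) : ℝ := if long κ.1 κ.2.1 then -1 else 1

/-- The stiffness matrix of `G_l(θ)` up to a factor, as a function of `c = cos θ`. -/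
def refStiff (l : ℕ) (c : ℝ) (p q : Fin (l + 1) × Fin (l + 1)) : ℝ :=
  form (elems (l + 2) true) (patchLong l) (fun κ => elemStiff (elemSign (patchLong l) κ * c))
    (unit (blockNode l (0, 0) q)) (unit (blockNode l (0, 0) p))

lemma patchLong_shortCorners (l : ℕ) : ShortCorners (l + 2) (patchLong l) :=
  ⟨fun h => absurd h.1.1 (by omega), fun h => by have := h.1.2; omega⟩

lemma isInner_iff_inBlock {l : ℕ} {P : Node} : IsInner (l + 2) P ↔ InBlock l (0, 0) P := by
  simp only [IsInner, InBlock]; omega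

lemma form_const {K : Finset Elem} {long : ℕ → ℕ → Prop} {t : Elem → ℝ} (r : ℝ) (W : Node → ℝ) :
    form K long (fun κ => elemStiff (t κ)) (fun _ => r) W = 0 := by
  rw [form_apply]
  exact Finset.sum_eq_zero fun κ _ => by rw [elemForm_elemStiff]; simp

lemma HasPatch.shift_mem {n l : ℕ} {tr : Bool} {long : ℕ → ℕ → Prop} {o : Node}
    (hp : HasPatch n long l o) {κ : Elem} (hκ : κ ∈ elems (l + 2) true) :
    (o.1 + κ.1, o.2 + κ.2.1, κ.2.2) ∈ elems n tr := by
  obtain ⟨h1, h2, h3⟩ := mem_elems.1 hκ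
  obtain ⟨q1, q2, q3⟩ := hp
  refine mem_elems.2 ⟨by simp only; omega, by simp only; omega, fun _ => ?_⟩
  obtain ⟨h4, h5⟩ := h3 rfl
  obtain ⟨a, b, t⟩ := κ
  simp only [ne_eq, Prod.mk.injEq, not_and] at h4 h5 h1 h2 ⊢
  refine ⟨fun e1 e2 => h4 (by omega) (by omega), fun e1 e2 => h5 (by omega) (by omega)⟩

/-- The matrix of a copy of a patch in a mesh, written as a form on the patch itself. -/
lemma HasPatch.form_eq {n l : ℕ} {tr : Bool} {long : ℕ → ℕ → Prop} {o : Node}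
    (hp : HasPatch n long l o)
    (k : Elem → Fin 3 → Fin 3 → ℝ) (p q : Fin (l + 1) × Fin (l + 1)) :
    form (elems n tr) long k (unit (blockNode l o q)) (unit (blockNode l o p)) =
    form (elems (l + 2) true) (patchLong l) (fun κ => k (o.1 + κ.1, o.2 + κ.2.1, κ.2.2))
      (unit (blockNode l (0, 0) q)) (unit (blockNode l (0, 0) p)) := by
  classical
  set sh : Elem → Elem := fun κ => (o.1 + κ.1, o.2 + κ.2.1, κ.2.2) with hsh
  have hvtx : ∀ κ ∈ elems (l + 2) true, ∀ v, vtx long (sh κ) v =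
      (o.1 + (vtx (patchLong l) κ v).1, o.2 + (vtx (patchLong l) κ v).2) := by
    intro κ hκ v
    obtain ⟨h1, h2, -⟩ := mem_elems.1 hκ
    have := hp.2.2 κ.1 κ.2.1 h1 h2
    simp only [vtx, hsh, this]
    split_ifs <;> fin_cases v <;> simp [add_assoc]
  have hunit : ∀ κ ∈ elems (l + 2) true, ∀ r, unit (blockNode l o r) ∘ vtx long (sh κ) =
      unit (blockNode l (0, 0) r) ∘ vtx (patchLong l) κ := by
    intro κ hκ r
    funext v
    simp only [Function.comp, unit_apply, hvtx κ hκ v]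
    congr 1
    simp only [blockNode, Prod.ext_iff, eq_iff_iff]
    omega
  -- triangles of the mesh outside the patch do not contain inner nodes of the patch
  have hzero : ∀ κ ∈ elems n tr, κ ∉ (elems (l + 2) true).image sh → ∀ w,
      unit (blockNode l o p) (vtx long κ w) = 0 := by
    intro κ hκ hκ' w
    rw [unit_apply, if_neg]
    intro hw
    apply hκ'
    have hb := vtx_bounds long κ w
    have hB := inBlock_blockNode l o p
    rw [← hw] at hB
    obtain ⟨b1, b2, b3, b4⟩ := hB
    have h1 : o.1 ≤ κ.1 := by omega
    have h2 : o.2 ≤ κ.2.1 := by omega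
    refine Finset.mem_image.2 ⟨(κ.1 - o.1, κ.2.1 - o.2, κ.2.2), ?_, ?_⟩
    · have hsh' : sh (κ.1 - o.1, κ.2.1 - o.2, κ.2.2) = κ := by
        simp only [hsh, Nat.add_sub_cancel' h1, Nat.add_sub_cancel' h2]
      have e : vtx long (sh (κ.1 - o.1, κ.2.1 - o.2, κ.2.2)) w =
          (o.1 + (vtx (patchLong l) (κ.1 - o.1, κ.2.1 - o.2, κ.2.2) w).1,
            o.2 + (vtx (patchLong l) (κ.1 - o.1, κ.2.1 - o.2, κ.2.2) w).2) := by
        have := hp.2.2 (κ.1 - o.1) (κ.2.1 - o.2) (by omega) (by omega)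
        simp only [vtx, hsh, this]
        split_ifs <;> fin_cases w <;> simp [add_assoc]
      rw [hsh'] at e
      refine mem_elems_of_inner (v := w) (fun _ => patchLong_shortCorners l) ?_
      rw [e] at b1 b2 b3 b4
      simp only at b1 b2 b3 b4
      exact ⟨by omega, by omega, by omega, by omega⟩
    · simp only [hsh, Nat.add_sub_cancel' h1, Nat.add_sub_cancel' h2]
  have hsub : (elems (l + 2) true).image sh ⊆ elems n tr := by
    intro κ' hκ'
    obtain ⟨κ, hκ, rfl⟩ := Finset.mem_image.1 hκ'
    exact hp.shift_mem hκ
  rw [form_apply, form_apply, ← Finset.sum_subset hsub, Finset.sum_image]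
  · refine Finset.sum_congr rfl fun κ hκ => ?_
    rw [hunit κ hκ q, hunit κ hκ p]
  · intro a _ b _ h
    simp only [hsh, Prod.mk.injEq] at h
    obtain ⟨h1, h2, h3⟩ := h
    ext
    · omega
    · omega
    · rw [h3]
  · intro κ hκ hκ'
    refine Finset.sum_eq_zero fun v _ => Finset.sum_eq_zero fun w _ => ?_
    simp [hzero κ hκ hκ' w]

/-- The matrix of a patch in the presence of a reaction term is a small perturbation of
`refStiff`. -/
lemma HasPatch.abs_sub_le {n l : ℕ} {tr : Bool} {long : ℕ → ℕ → Prop} {o : Node}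
    (hp : HasPatch n long l o) {c η : ℝ}
    {μ : Elem → Fin 3 → Fin 3 → ℝ} (hη : 0 ≤ η) (hμ : ∀ κ ∈ elems n tr, ∀ v w, |μ κ v w| ≤ η)
    (p q : Fin (l + 1) × Fin (l + 1)) :
    |form (elems n tr) long (fun κ v w => elemStiff (elemSign long κ * c) v w + μ κ v w)
      (unit (blockNode l o q)) (unit (blockNode l o p)) - refStiff l c p q| ≤
      18 * (l + 2) ^ 2 * η := by
  rw [hp.form_eq, refStiff, form_apply, form_apply, ← Finset.sum_sub_distrib]
  -- each triangle contributes nine entries, and a patch has at most `2 * (l + 2) ^ 2` triangles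
  have hκ : ∀ κ ∈ elems (l + 2) true, |elemForm (fun v w =>
      elemStiff (elemSign long (o.1 + κ.1, o.2 + κ.2.1, κ.2.2) * c) v w +
        μ (o.1 + κ.1, o.2 + κ.2.1, κ.2.2) v w)
      (unit (blockNode l (0, 0) q) ∘ vtx (patchLong l) κ)
      (unit (blockNode l (0, 0) p) ∘ vtx (patchLong l) κ) -
      elemForm (elemStiff (elemSign (patchLong l) κ * c))
      (unit (blockNode l (0, 0) q) ∘ vtx (patchLong l) κ)
      (unit (blockNode l (0, 0) p) ∘ vtx (patchLong l) κ)| ≤ 9 * η := by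
    intro κ hκ
    obtain ⟨h1, h2, -⟩ := mem_elems.1 hκ
    have hsgn : elemSign long (o.1 + κ.1, o.2 + κ.2.1, κ.2.2) = elemSign (patchLong l) κ := by
      have := hp.2.2 κ.1 κ.2.1 h1 h2
      by_cases hl : patchLong l κ.1 κ.2.1 <;> simp [elemSign, this, hl]
    simp only [elemForm, hsgn, ← Finset.sum_sub_distrib]
    refine (Finset.abs_sum_le_sum_abs _ _).trans ?_
    refine (Finset.sum_le_card_nsmul _ _ (3 * η) fun v _ => ?_).trans_eq
      (by simp only [Finset.card_univ, Fintype.card_fin, nsmul_eq_mul]; push_cast; ring)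
    refine (Finset.abs_sum_le_sum_abs _ _).trans
      ((Finset.sum_le_card_nsmul _ _ η fun w _ => ?_).trans_eq
      (by simp only [Finset.card_univ, Fintype.card_fin, nsmul_eq_mul]; push_cast; ring))
    · simp only [Function.comp]
      rw [← sub_mul, ← sub_mul, add_sub_cancel_left, abs_mul, abs_mul,
        abs_of_nonneg (unit_nonneg _ _), abs_of_nonneg (unit_nonneg _ _)]
      refine (mul_le_of_le_one_right (mul_nonneg (abs_nonneg _) (unit_nonneg _ _))
        (unit_le_one _ _)).trans ?_
      exact (mul_le_of_le_one_right (abs_nonneg _) (unit_le_one _ _)).trans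
        (hμ _ (hp.shift_mem hκ) _ _)
  refine (Finset.abs_sum_le_sum_abs _ _).trans ((Finset.sum_le_card_nsmul _ _ _ hκ).trans ?_)
  have hcard : ((elems (l + 2) true).card : ℝ) ≤ 2 * (l + 2) ^ 2 := by
    exact_mod_cast card_elems_le (l + 2) true
  rw [nsmul_eq_mul]
  nlinarith

/-! ### The patches for `θ` close to `π / 2` -/

lemma elemStiff_zero_of_gridAdj {long : ℕ → ℕ → Prop} {κ : Elem} {v w : Fin 3}
    (h : GridAdj (vtx long κ w) (vtx long κ v)) : elemStiff 0 v w < 0 := by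
  unfold vtx at h
  unfold GridAdj at h
  split_ifs at h <;> fin_cases v <;> fin_cases w <;> simp [elemStiff] at h ⊢

/-- For the square mesh, a supersolution with zero boundary values is zero or positive at all
inner nodes. -/
lemma refStiff_zero_minimum {l : ℕ} {x : Fin (l + 1) × Fin (l + 1) → ℝ}
    (hx : ∀ p, 0 ≤ ∑ q, refStiff l 0 p q * x q) : x = 0 ∨ ∀ p, 0 < x p := by
  classical
  by_contra! hcon
  obtain ⟨hx0, p₁, hp₁⟩ := hcon
  obtain ⟨p₀, hp₀⟩ := Finite.exists_min x
  have hm : x p₀ ≤ 0 := (hp₀ p₁).trans hp₁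
  set U : Node → ℝ := ∑ p, x p • unit (blockNode l (0, 0) p) with hU
  have hUb : ∀ p, U (blockNode l (0, 0) p) = x p := by
    intro p
    simp [hU, Finset.sum_apply, unit_apply, (blockNode_injective l (0, 0)).eq_iff]
  have hUo : ∀ P, ¬ InBlock l (0, 0) P → U P = 0 := by
    intro P hP
    simp only [hU, Finset.sum_apply]
    refine Finset.sum_eq_zero fun p _ => ?_
    have : P ≠ blockNode l (0, 0) p := fun h => hP (h ▸ inBlock_blockNode l (0, 0) p)
    simp [unit_apply, this]
  set W : Node → ℝ := U - fun _ => x p₀ with hW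
  set k : Elem → Fin 3 → Fin 3 → ℝ := fun κ => elemStiff (elemSign (patchLong l) κ * 0) with hk
  have hk0 : ∀ κ, k κ = elemStiff 0 := fun κ => by simp [hk]
  have hWnn : ∀ P, 0 ≤ W P := by
    intro P
    simp only [hW, Pi.sub_apply]
    by_cases hP : InBlock l (0, 0) P
    · obtain ⟨p, rfl⟩ := exists_blockNode hP
      rw [hUb]; linarith [hp₀ p]
    · rw [hUo P hP]; linarith
  have hf : ∀ P, IsInner (l + 2) P →
      0 ≤ form (elems (l + 2) true) (patchLong l) k W (unit P) := by
    intro P hP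
    obtain ⟨p, rfl⟩ := exists_blockNode (isInner_iff_inBlock.1 hP)
    have h1 : form (elems (l + 2) true) (patchLong l) k W (unit (blockNode l (0, 0) p)) =
        ∑ q, refStiff l 0 p q * x q := by
      rw [hW, map_sub, LinearMap.sub_apply, hk, form_const, sub_zero, hU, map_sum,
        LinearMap.sum_apply]
      refine Finset.sum_congr rfl fun q _ => ?_
      rw [map_smul, LinearMap.smul_apply, smul_eq_mul, mul_comm]
      rfl
    rw [h1]; exact hx p
  have hoff : ∀ v w : Fin 3, v ≠ w → elemStiff 0 v w ≤ 0 := by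
    intro v w hvw
    fin_cases v <;> fin_cases w <;> simp [elemStiff] at hvw ⊢
  have hstep : ∀ P, IsInner (l + 2) P → W P = 0 → ∀ Q, GridAdj P Q → W Q = 0 := by
    intro P hP h0 Q hPQ
    have hneg : ∀ Q, Q ≠ P → _ := fun Q hQ => form_unit_nonpos (K := elems (l + 2) true)
      (long := patchLong l) (k := k) hQ fun κ _ v w hvw _ _ => by rw [hk0]; exact hoff v w hvw
    have hQP : Q ≠ P := by rintro rfl; unfold GridAdj at hPQ; omega
    have hJ := hPQ.joined (tr := true) (fun _ => patchLong_shortCorners l) hP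
    obtain ⟨κ, hκ, ⟨w, hw⟩, v, hv⟩ := id hJ
    refine zero_of_form_neg (fun Q hQ => (hneg Q hQ).1) (fun κ _ v => hWnn _) h0 (hf P hP) hJ
      ((hneg Q hQP).2 κ hκ v w hv hw ?_)
    rw [hk0]
    refine elemStiff_zero_of_gridAdj (long := patchLong l) (κ := κ) ?_
    rwa [hv, hw]
  have hall := all_of_gridAdj (Z := fun P => W P = 0) hstep
    (isInner_iff_inBlock.2 (inBlock_blockNode l (0, 0) p₀)) (by simp [hW, hUb])
  have hb := (hall.2 1 le_rfl (by omega)).1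
  have hm0 : x p₀ = 0 := by
    have : ¬ InBlock l (0, 0) (1, 0) := fun h => by have := h.2.2.1; omega
    simp only [hW, Pi.sub_apply, hUo _ this] at hb
    linarith
  refine hx0 (funext fun p => ?_)
  have := hall.1 _ (isInner_iff_inBlock.2 (inBlock_blockNode l (0, 0) p))
  simp only [hW, Pi.sub_apply, hUb, hm0] at this
  simpa using this

lemma invPos_refStiff_zero (l : ℕ) : InvPos (refStiff l 0) := by
  set A : Matrix (Fin (l + 1) × Fin (l + 1)) (Fin (l + 1) × Fin (l + 1)) ℝ :=
    Matrix.of (refStiff l 0) with hA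
  have key : ∀ x, (∀ p, 0 ≤ A.mulVec x p) → x = 0 ∨ ∀ p, 0 < x p := fun x hx =>
    refStiff_zero_minimum hx
  have hdet : A.det ≠ 0 := by
    intro h0
    obtain ⟨x, hx, hAx⟩ := Matrix.exists_mulVec_eq_zero_iff.2 h0
    rcases key x (fun p => by simp [hAx]) with h | h
    · exact hx h
    · rcases key (-x) (fun p => by simp [Matrix.mulVec_neg, hAx]) with h' | h'
      · exact hx (neg_eq_zero.1 h')
      · have h1 := h (0, 0)
        have h2 := h' (0, 0)
        simp only [Pi.neg_apply] at h2
        linarith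
  refine (invPos_iff _).2 ⟨isUnit_iff_ne_zero.2 hdet, fun p q => ?_⟩
  have hcol : A.mulVec (fun p => A⁻¹ p q) = Pi.single q 1 := by
    have : (fun p => A⁻¹ p q) = A⁻¹.mulVec (Pi.single q 1) := by
      funext p; simp
    rw [this, Matrix.mulVec_mulVec, Matrix.mul_nonsing_inv _ (isUnit_iff_ne_zero.2 hdet),
      Matrix.one_mulVec]
  rcases key (fun p => A⁻¹ p q) (fun p => by
    rw [hcol, Pi.single_apply]; split_ifs <;> norm_num) with h | h
  · rw [h, Matrix.mulVec_zero] at hcol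
    have := congrFun hcol q
    simp at this
  · exact h p

lemma continuous_refStiff (l : ℕ) (p q : Fin (l + 1) × Fin (l + 1)) :
    Continuous fun c => refStiff l c p q := by
  simp only [refStiff, form_apply, elemForm_elemStiff]
  fun_prop

/-- The matrices `refStiff l (cos θ)` have positive inverses for `θ` close to `π / 2`. -/
lemma exists_angle_invPos (l : ℕ) : ∃ t : ℝ, 0 < t ∧ t < π / 2 ∧
    ∀ θ : ℝ, t < θ → θ ≤ π / 2 → InvPos (refStiff l (cos θ)) := by
  obtain ⟨ε, hε, hball⟩ := (invPos_refStiff_zero l).exists_ball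
  have hcont : ∀ p q, ∀ᶠ θ in nhds (π / 2), |refStiff l (cos θ) p q - refStiff l 0 p q| ≤ ε := by
    intro p q
    have h1 : Continuous fun θ : ℝ => |refStiff l (cos θ) p q - refStiff l 0 p q| :=
      (((continuous_refStiff l p q).comp continuous_cos).sub continuous_const).abs
    have h2 := h1.tendsto (π / 2)
    simp only [cos_pi_div_two, sub_self, abs_zero] at h2
    exact (h2.eventually (gt_mem_nhds hε)).mono fun _ h => h.le
  have hev : ∀ᶠ θ in nhds (π / 2), ∀ p q, |refStiff l (cos θ) p q - refStiff l 0 p q| ≤ ε :=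
    Filter.eventually_all.2 fun p => Filter.eventually_all.2 fun q => hcont p q
  obtain ⟨δ, hδ, hδ'⟩ := Metric.eventually_nhds_iff.1 hev
  have hpi := pi_pos
  refine ⟨max (π / 4) (π / 2 - δ), lt_max_of_lt_left (by positivity),
    max_lt (by linarith) (by linarith), fun θ h1 h2 => hball _ fun p q => hδ' ?_ p q⟩
  have := (le_max_right _ _).trans_lt h1
  rw [Real.dist_eq, abs_lt]
  constructor <;> linarith

/-! ### Grid coordinates -/

/-- The gradient of the first grid coordinate. -/
def gradX (θ : ℝ) (n : ℕ) : Plane := !₂[n / (2 * cos (θ / 2)), -(n / (2 * sin (θ / 2)))]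

/-- The gradient of the second grid coordinate. -/
def gradY (θ : ℝ) (n : ℕ) : Plane := !₂[n / (2 * cos (θ / 2)), n / (2 * sin (θ / 2))]

/-- The first grid coordinate of a point; the grid point `(i, j)` has grid coordinates `i`, `j`. -/
def cx (θ : ℝ) (n : ℕ) (p : Plane) : ℝ := inner ℝ (gradX θ n) p + n / 2

/-- The second grid coordinate of a point. -/
def cy (θ : ℝ) (n : ℕ) (p : Plane) : ℝ := inner ℝ (gradY θ n) p + n / 2

/-- The point with given grid coordinates. -/
def pt (θ : ℝ) (n : ℕ) (x y : ℝ) : Plane :=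
  (x / n - 1 / 2) • dir (-(θ / 2)) + (y / n - 1 / 2) • dir (θ / 2)

/-- The grid point with a given index. -/
def nodePt (θ : ℝ) (n : ℕ) (P : Node) : Plane := gridPt θ n P.1 P.2

lemma nodePt_eq_pt (θ : ℝ) (n : ℕ) (P : Node) : nodePt θ n P = pt θ n P.1 P.2 := rfl

/-- The angle of the rhombus is in the admissible range. -/
abbrev IsAngle (θ : ℝ) : Prop := 0 < θ ∧ θ ≤ π / 2

lemma IsAngle.sin_half_pos {θ : ℝ} (h : IsAngle θ) : 0 < sin (θ / 2) :=
  sin_pos_of_pos_of_lt_pi (by linarith [h.1]) (by linarith [h.2, pi_pos])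

lemma IsAngle.cos_half_pos {θ : ℝ} (h : IsAngle θ) : 0 < cos (θ / 2) :=
  cos_pos_of_mem_Ioo ⟨by linarith [h.1, pi_pos], by linarith [h.2, pi_pos]⟩

lemma IsAngle.sin_pos {θ : ℝ} (h : IsAngle θ) : 0 < sin θ :=
  sin_pos_of_pos_of_lt_pi h.1 (by linarith [h.2, pi_pos])

lemma inner_gradX_dir {θ : ℝ} (n : ℕ) (h : IsAngle θ) :
    inner ℝ (gradX θ n) (dir (-(θ / 2))) = n ∧ inner ℝ (gradX θ n) (dir (θ / 2)) = 0 := by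
  have h1 := h.sin_half_pos.ne'
  have h2 := h.cos_half_pos.ne'
  constructor <;> simp [gradX, dir, PiLp.inner_apply, Fin.sum_univ_two] <;> field_simp <;> ring

lemma inner_gradY_dir {θ : ℝ} (n : ℕ) (h : IsAngle θ) :
    inner ℝ (gradY θ n) (dir (-(θ / 2))) = 0 ∧ inner ℝ (gradY θ n) (dir (θ / 2)) = n := by
  have h1 := h.sin_half_pos.ne'
  have h2 := h.cos_half_pos.ne'
  constructor <;> simp [gradY, dir, PiLp.inner_apply, Fin.sum_univ_two] <;> field_simp <;> ring

lemma inner_grad {θ : ℝ} (n : ℕ) (h : IsAngle θ) :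
    inner ℝ (gradX θ n) (gradX θ n) = (n : ℝ) ^ 2 / sin θ ^ 2 ∧
    inner ℝ (gradY θ n) (gradY θ n) = (n : ℝ) ^ 2 / sin θ ^ 2 ∧
    inner ℝ (gradX θ n) (gradY θ n) = - cos θ * ((n : ℝ) ^ 2 / sin θ ^ 2) := by
  have h1 := h.sin_half_pos.ne'
  have h2 := h.cos_half_pos.ne'
  have hs : sin θ = 2 * sin (θ / 2) * cos (θ / 2) := by
    rw [← sin_two_mul]; congr 1; ring
  have hc : cos θ = cos (θ / 2) ^ 2 - sin (θ / 2) ^ 2 := by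
    rw [← cos_two_mul']; congr 1; ring
  have h3 := sin_sq_add_cos_sq (θ / 2)
  rw [hs, hc]
  refine ⟨?_, ?_, ?_⟩ <;>
    simp [gradX, gradY, PiLp.inner_apply, Fin.sum_univ_two, -inner_self_eq_norm_sq_to_K] <;>
    field_simp <;> first | linear_combination (n : ℝ) ^ 2 * h3 | ring

lemma cx_pt {θ : ℝ} {n : ℕ} (h : IsAngle θ) (hn : 1 ≤ n) (x y : ℝ) : cx θ n (pt θ n x y) = x := by
  have hn' : (n : ℝ) ≠ 0 := by positivity
  rw [cx, pt, inner_add_right, inner_smul_right, inner_smul_right, (inner_gradX_dir n h).1,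
    (inner_gradX_dir n h).2]
  field_simp; ring

lemma cy_pt {θ : ℝ} {n : ℕ} (h : IsAngle θ) (hn : 1 ≤ n) (x y : ℝ) : cy θ n (pt θ n x y) = y := by
  have hn' : (n : ℝ) ≠ 0 := by positivity
  rw [cy, pt, inner_add_right, inner_smul_right, inner_smul_right, (inner_gradY_dir n h).1,
    (inner_gradY_dir n h).2]
  field_simp; ring

lemma pt_cx_cy {θ : ℝ} {n : ℕ} (h : IsAngle θ) (hn : 1 ≤ n) (p : Plane) :
    pt θ n (cx θ n p) (cy θ n p) = p := by
  have hn' : (n : ℝ) ≠ 0 := by positivity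
  have h1 := h.sin_half_pos.ne'
  have h2 := h.cos_half_pos.ne'
  ext i
  fin_cases i <;>
    simp [pt, cx, cy, gradX, gradY, dir, PiLp.inner_apply, Fin.sum_univ_two] <;>
    field_simp <;> ring

lemma cx_nodePt {θ : ℝ} {n : ℕ} (h : IsAngle θ) (hn : 1 ≤ n) (P : Node) :
    cx θ n (nodePt θ n P) = P.1 := cx_pt h hn _ _

lemma cy_nodePt {θ : ℝ} {n : ℕ} (h : IsAngle θ) (hn : 1 ≤ n) (P : Node) :
    cy θ n (nodePt θ n P) = P.2 := cy_pt h hn _ _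

lemma nodePt_injective {θ : ℝ} {n : ℕ} (h : IsAngle θ) (hn : 1 ≤ n) :
    Function.Injective (nodePt θ n) := by
  intro P Q hPQ
  have h1 := congrArg (cx θ n) hPQ
  have h2 := congrArg (cy θ n) hPQ
  rw [cx_nodePt h hn, cx_nodePt h hn] at h1
  rw [cy_nodePt h hn, cy_nodePt h hn] at h2
  exact Prod.ext (by exact_mod_cast h1) (by exact_mod_cast h2)

/-! ### Triangles -/

/-- The vertices of a triangle of the mesh. -/
def tri (θ : ℝ) (n : ℕ) (long : ℕ → ℕ → Prop) (κ : Elem) : Set Plane :=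
  Set.range fun v => nodePt θ n (vtx long κ v)

/-- The direction, in the first grid coordinate, of the side from vertex `0` to vertex `1`. -/
def sideX (long : ℕ → ℕ → Prop) (κ : Elem) : ℝ := (vtx long κ 1).1 - (vtx long κ 0).1

/-- The direction, in the second grid coordinate, of the side from vertex `0` to vertex `2`. -/
def sideY (long : ℕ → ℕ → Prop) (κ : Elem) : ℝ := (vtx long κ 2).2 - (vtx long κ 0).2

lemma side_facts (long : ℕ → ℕ → Prop) (κ : Elem) :
    sideX long κ ^ 2 = 1 ∧ sideY long κ ^ 2 = 1 ∧ sideX long κ * sideY long κ = elemSign long κ ∧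
    (vtx long κ 1).2 = (vtx long κ 0).2 ∧ (vtx long κ 2).1 = (vtx long κ 0).1 := by
  unfold sideX sideY elemSign vtx
  split_ifs <;> simp

/-- The barycentric coordinates with respect to the vertices of a triangle. -/
def bary (θ : ℝ) (n : ℕ) (long : ℕ → ℕ → Prop) (κ : Elem) : Fin 3 → Plane → ℝ :=
  ![fun p => 1 - sideX long κ * (cx θ n p - (vtx long κ 0).1) -
      sideY long κ * (cy θ n p - (vtx long κ 0).2),
    fun p => sideX long κ * (cx θ n p - (vtx long κ 0).1),
    fun p => sideY long κ * (cy θ n p - (vtx long κ 0).2)]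

/-- The gradients of the barycentric coordinates. -/
def baryGrad (θ : ℝ) (n : ℕ) (long : ℕ → ℕ → Prop) (κ : Elem) : Fin 3 → Plane :=
  ![-(sideX long κ • gradX θ n) - sideY long κ • gradY θ n, sideX long κ • gradX θ n,
    sideY long κ • gradY θ n]

lemma bary_eq (θ : ℝ) (n : ℕ) (long : ℕ → ℕ → Prop) (κ : Elem) (v : Fin 3) (p : Plane) :
    bary θ n long κ v p = inner ℝ (baryGrad θ n long κ v) p + bary θ n long κ v 0 := by
  fin_cases v <;>
    simp [bary, baryGrad, cx, cy, inner_sub_left, inner_neg_left, inner_smul_left] <;> ring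

lemma continuous_bary (θ : ℝ) (n : ℕ) (long : ℕ → ℕ → Prop) (κ : Elem) (v : Fin 3) :
    Continuous (bary θ n long κ v) := by
  have : bary θ n long κ v = fun p => inner ℝ (baryGrad θ n long κ v) p + bary θ n long κ v 0 :=
    funext fun p => bary_eq _ _ _ _ _ _
  rw [this]
  fun_prop

lemma sum_bary (θ : ℝ) (n : ℕ) (long : ℕ → ℕ → Prop) (κ : Elem) (p : Plane) :
    ∑ v, bary θ n long κ v p = 1 := by
  simp only [Fin.sum_univ_three, bary, Matrix.cons_val_zero, Matrix.cons_val_one, Matrix.cons_val]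
  ring

lemma sum_bary_mul_fst {θ : ℝ} {n : ℕ} (long : ℕ → ℕ → Prop) (κ : Elem) (p : Plane) :
    ∑ v, bary θ n long κ v p * (vtx long κ v).1 = cx θ n p := by
  obtain ⟨h1, -, -, -, h5⟩ := side_facts long κ
  have : ((vtx long κ 1).1 : ℝ) = (vtx long κ 0).1 + sideX long κ := by rw [sideX]; ring
  simp only [Fin.sum_univ_three, bary, h5, this, Matrix.cons_val_zero, Matrix.cons_val_one,
    Matrix.cons_val]
  linear_combination (cx θ n p - (vtx long κ 0).1) * h1

lemma sum_bary_mul_snd {θ : ℝ} {n : ℕ} (long : ℕ → ℕ → Prop) (κ : Elem) (p : Plane) :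
    ∑ v, bary θ n long κ v p * (vtx long κ v).2 = cy θ n p := by
  obtain ⟨-, h1, -, h5, -⟩ := side_facts long κ
  have : ((vtx long κ 2).2 : ℝ) = (vtx long κ 0).2 + sideY long κ := by rw [sideY]; ring
  simp only [Fin.sum_univ_three, bary, h5, this, Matrix.cons_val_zero, Matrix.cons_val_one,
    Matrix.cons_val]
  linear_combination (cy θ n p - (vtx long κ 0).2) * h1

lemma sum_bary_smul {θ : ℝ} {n : ℕ} (h : IsAngle θ) (hn : 1 ≤ n) (long : ℕ → ℕ → Prop) (κ : Elem)
    (p : Plane) : ∑ v, bary θ n long κ v p • nodePt θ n (vtx long κ v) = p := by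
  conv_rhs => rw [← pt_cx_cy h hn p, ← sum_bary_mul_fst long κ p, ← sum_bary_mul_snd long κ p]
  have h1 := sum_bary θ n long κ p
  simp only [nodePt_eq_pt, pt, Fin.sum_univ_three] at h1 ⊢
  have h2 : bary θ n long κ 0 p = 1 - bary θ n long κ 1 p - bary θ n long κ 2 p := by linarith
  rw [h2]
  module

lemma bary_nodePt {θ : ℝ} {n : ℕ} (h : IsAngle θ) (hn : 1 ≤ n) (long : ℕ → ℕ → Prop) (κ : Elem)
    (v w : Fin 3) : bary θ n long κ v (nodePt θ n (vtx long κ w)) = if v = w then 1 else 0 := by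
  obtain ⟨h1, h2, -, h4, h5⟩ := side_facts long κ
  have h6 : ((vtx long κ 1).1 : ℝ) = (vtx long κ 0).1 + sideX long κ := by rw [sideX]; ring
  have h7 : ((vtx long κ 2).2 : ℝ) = (vtx long κ 0).2 + sideY long κ := by rw [sideY]; ring
  fin_cases v <;> fin_cases w <;>
    simp [bary, cx_nodePt h hn, cy_nodePt h hn, h4, h5, h6, h7] <;> nlinarith

/-- The closed triangle in barycentric coordinates. -/
lemma mem_hull_iff {θ : ℝ} {n : ℕ} (h : IsAngle θ) (hn : 1 ≤ n) {long : ℕ → ℕ → Prop} {κ : Elem}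
    {p : Plane} : p ∈ convexHull ℝ (tri θ n long κ) ↔ ∀ v, 0 ≤ bary θ n long κ v p := by
  constructor
  · intro hp
    have hsub : convexHull ℝ (tri θ n long κ) ⊆ {p | ∀ v, 0 ≤ bary θ n long κ v p} := by
      refine convexHull_min ?_ ?_
      · rintro _ ⟨w, rfl⟩ v
        simp only [bary_nodePt h hn]
        split_ifs <;> norm_num
      · intro x hx y hy a b ha hb hab v
        have hx := hx v
        have hy := hy v
        have : bary θ n long κ v (a • x + b • y) =
            a * bary θ n long κ v x + b * bary θ n long κ v y := by
          rw [bary_eq _ _ _ _ _ (a • x + b • y), bary_eq _ _ _ _ _ x, bary_eq _ _ _ _ _ y,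
            inner_add_right, inner_smul_right, inner_smul_right]
          linear_combination -(bary θ n long κ v 0) * hab
        rw [this]
        positivity
    exact hsub hp
  · intro hp
    rw [← sum_bary_smul h hn long κ p]
    exact (convex_convexHull ℝ _).sum_mem (fun v _ => hp v) (sum_bary θ n long κ p)
      fun v _ => subset_convexHull ℝ _ ⟨v, rfl⟩

/-- An affine inequality that holds at the vertices of a triangle holds on the triangle; if
moreover it is an equality at a point, then it is an equality at all vertices with positive weight.
-/
lemma hull_ineq {θ : ℝ} {n : ℕ} (h : IsAngle θ) (hn : 1 ≤ n) {long : ℕ → ℕ → Prop} {κ : Elem}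
    {p : Plane} (hp : p ∈ convexHull ℝ (tri θ n long κ)) {a b c : ℝ}
    (hv : ∀ v, 0 ≤ a * (vtx long κ v).1 + b * (vtx long κ v).2 + c) :
    0 ≤ a * cx θ n p + b * cy θ n p + c ∧
    (a * cx θ n p + b * cy θ n p + c = 0 → ∀ v, bary θ n long κ v p = 0 ∨
      a * (vtx long κ v).1 + b * (vtx long κ v).2 + c = 0) := by
  have hb := (mem_hull_iff h hn).1 hp
  have key : a * cx θ n p + b * cy θ n p + c =
      ∑ v, bary θ n long κ v p * (a * (vtx long κ v).1 + b * (vtx long κ v).2 + c) := by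
    rw [← sum_bary_mul_fst long κ p, ← sum_bary_mul_snd long κ p]
    conv_lhs => rw [← mul_one c, ← sum_bary θ n long κ p]
    simp only [Finset.mul_sum, ← Finset.sum_add_distrib]
    exact Finset.sum_congr rfl fun _ _ => by ring
  have hterm : ∀ v ∈ Finset.univ, 0 ≤ bary θ n long κ v p *
      (a * (vtx long κ v).1 + b * (vtx long κ v).2 + c) := fun v _ => mul_nonneg (hb v) (hv v)
  rw [key]
  refine ⟨Finset.sum_nonneg hterm, fun h0 v => ?_⟩
  exact mul_eq_zero.1 ((Finset.sum_eq_zero_iff_of_nonneg hterm).1 h0 v (Finset.mem_univ _))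

/-- A point of a triangle lies in the small rhombus of that triangle. -/
lemma hull_bounds {θ : ℝ} {n : ℕ} (h : IsAngle θ) (hn : 1 ≤ n) {long : ℕ → ℕ → Prop} {κ : Elem}
    {p : Plane} (hp : p ∈ convexHull ℝ (tri θ n long κ)) :
    (κ.1 : ℝ) ≤ cx θ n p ∧ cx θ n p ≤ κ.1 + 1 ∧ (κ.2.1 : ℝ) ≤ cy θ n p ∧ cy θ n p ≤ κ.2.1 + 1 := by
  have hb := vtx_bounds long κ
  have hb' : ∀ v, (κ.1 : ℝ) ≤ (vtx long κ v).1 ∧ ((vtx long κ v).1 : ℝ) ≤ κ.1 + 1 ∧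
      (κ.2.1 : ℝ) ≤ (vtx long κ v).2 ∧ ((vtx long κ v).2 : ℝ) ≤ κ.2.1 + 1 := by
    intro v
    exact_mod_cast hb v
  have h1 := (hull_ineq h hn hp (a := 1) (b := 0) (c := -κ.1) fun v => by
    linarith [(hb' v).1]).1
  have h2 := (hull_ineq h hn hp (a := -1) (b := 0) (c := κ.1 + 1) fun v => by
    linarith [(hb' v).2.1]).1
  have h3 := (hull_ineq h hn hp (a := 0) (b := 1) (c := -κ.2.1) fun v => by
    linarith [(hb' v).2.2.1]).1
  have h4 := (hull_ineq h hn hp (a := 0) (b := -1) (c := κ.2.1 + 1) fun v => by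
    linarith [(hb' v).2.2.2]).1
  refine ⟨?_, ?_, ?_, ?_⟩ <;> linarith

/-! ### The meshes and their domains -/

/-- The mesh of the rhombus (`tr = false`) or of the truncated rhombus (`tr = true`). -/
def gridMesh (θ : ℝ) (n : ℕ) (long : ℕ → ℕ → Prop) (tr : Bool) : Mesh :=
  tri θ n long '' (elems n tr : Set Elem)

/-- The data of a nondegenerate mesh: the truncated mesh is considered only if `n ≥ 2` and the
corner rhombuses are divided along their short diagonals. -/
structure IsGrid (θ : ℝ) (n : ℕ) (long : ℕ → ℕ → Prop) (tr : Bool) : Prop where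
  angle : IsAngle θ
  pos : 1 ≤ n
  two_le : tr = true → 2 ≤ n
  short : tr = true → ShortCorners n long

lemma rhombusMesh_eq (θ : ℝ) (n : ℕ) (long : ℕ → ℕ → Prop) :
    rhombusMesh θ n long = gridMesh θ n long false := by
  have hr : ∀ f : Fin 3 → Plane, Set.range f = {f 0, f 1, f 2} := by
    intro f; ext x; simp [Fin.exists_fin_succ, eq_comm]
  ext t
  simp only [rhombusMesh, gridMesh, Set.mem_ofPred_eq, Set.mem_image, Finset.mem_coe, mem_elems,
    tri, hr]
  constructor
  · rintro ⟨i, j, hi, hj, ⟨hl, rfl | rfl⟩ | ⟨hl, rfl | rfl⟩⟩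
    · refine ⟨(i, j, false), ⟨hi, hj, by simp⟩, ?_⟩
      ext x; simp [vtx, hl, nodePt]; tauto
    · refine ⟨(i, j, true), ⟨hi, hj, by simp⟩, ?_⟩
      ext x; simp [vtx, hl, nodePt]; tauto
    · refine ⟨(i, j, false), ⟨hi, hj, by simp⟩, ?_⟩
      ext x; simp [vtx, hl, nodePt]; tauto
    · refine ⟨(i, j, true), ⟨hi, hj, by simp⟩, ?_⟩
      ext x; simp [vtx, hl, nodePt]; tauto
  · rintro ⟨⟨i, j, t⟩, ⟨hi, hj, -⟩, rfl⟩
    refine ⟨i, j, hi, hj, ?_⟩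
    by_cases hl : long i j
    · refine .inl ⟨hl, ?_⟩
      cases t
      · left; ext x; simp [vtx, hl, nodePt]; tauto
      · right; ext x; simp [vtx, hl, nodePt]; tauto
    · refine .inr ⟨hl, ?_⟩
      cases t
      · left; ext x; simp [vtx, hl, nodePt]; tauto
      · right; ext x; simp [vtx, hl, nodePt]; tauto

/-- The two corners are not vertices of the truncated mesh. -/
lemma vtx_ne_corner {n : ℕ} {long : ℕ → ℕ → Prop} (hn : 2 ≤ n) (hs : ShortCorners n long)
    {κ : Elem} (hκ : κ ∈ elems n true) (v : Fin 3) :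
    1 ≤ (vtx long κ v).1 + (vtx long κ v).2 ∧ (vtx long κ v).1 + (vtx long κ v).2 + 1 ≤ 2 * n := by
  obtain ⟨h1, h2, h3⟩ := mem_elems.1 hκ
  obtain ⟨h3, h4⟩ := h3 rfl
  have hb := vtx_bounds long κ v
  obtain ⟨a, b, t⟩ := κ
  simp only at h1 h2 hb
  constructor
  · by_cases hab : a = 0 ∧ b = 0
    · obtain ⟨rfl, rfl⟩ := hab
      cases t
      · simp at h3
      · simp only [vtx, hs.1, if_false]
        fin_cases v <;> simp
    · omega
  · by_cases hab : a = n - 1 ∧ b = n - 1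
    · obtain ⟨rfl, rfl⟩ := hab
      cases t
      · simp only [vtx, hs.2, if_false]
        fin_cases v <;> simp <;> omega
      · simp at h4
    · omega

lemma truncatedMesh_eq {θ : ℝ} {n : ℕ} {long : ℕ → ℕ → Prop} (hg : IsGrid θ n long true) :
    truncatedMesh θ n long = gridMesh θ n long true := by
  have hs := hg.short rfl
  have hn := hg.two_le rfl
  have h0 : gridPt θ n 0 0 = nodePt θ n (0, 0) := rfl
  have h1 : gridPt θ n n n = nodePt θ n (n, n) := rfl
  have hmem : ∀ P κ, nodePt θ n P ∈ tri θ n long κ ↔ ∃ v, vtx long κ v = P := by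
    intro P κ
    simp only [tri, Set.mem_range, (nodePt_injective hg.angle hg.pos).eq_iff]
  ext t
  simp only [truncatedMesh, Set.mem_ofPred_eq, rhombusMesh_eq, gridMesh, Set.mem_image,
    Finset.mem_coe, h0, h1]
  constructor
  · rintro ⟨⟨κ, hκ, rfl⟩, hk0, hk1⟩
    refine ⟨κ, ?_, rfl⟩
    rw [hmem] at hk0 hk1
    obtain ⟨a, b, -⟩ := mem_elems.1 hκ
    refine mem_elems.2 ⟨a, b, fun _ => ⟨?_, ?_⟩⟩
    · rintro rfl
      exact hk0 ⟨0, by simp [vtx, hs.1]⟩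
    · rintro rfl
      refine hk1 ⟨0, ?_⟩
      simp [vtx, hs.2]; omega
  · rintro ⟨κ, hκ, rfl⟩
    obtain ⟨a, b, -⟩ := mem_elems.1 hκ
    refine ⟨⟨κ, mem_elems.2 ⟨a, b, by simp⟩, rfl⟩, ?_, ?_⟩
    · rw [hmem]
      rintro ⟨v, hv⟩
      have := vtx_ne_corner hn hs hκ v
      rw [hv] at this; simp at this
    · rw [hmem]
      rintro ⟨v, hv⟩
      have := vtx_ne_corner hn hs hκ v
      rw [hv] at this; simp only at this; omega

/-- The closed rhombus or truncated rhombus in grid coordinates. -/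
def region (θ : ℝ) (n : ℕ) (tr : Bool) : Set Plane :=
  {p | 0 ≤ cx θ n p ∧ cx θ n p ≤ n ∧ 0 ≤ cy θ n p ∧ cy θ n p ≤ n ∧
    (tr = true → 1 ≤ cx θ n p + cy θ n p ∧ cx θ n p + cy θ n p + 1 ≤ 2 * n)}

/-- The open rhombus or truncated rhombus in grid coordinates. -/
def openRegion (θ : ℝ) (n : ℕ) (tr : Bool) : Set Plane :=
  {p | 0 < cx θ n p ∧ cx θ n p < n ∧ 0 < cy θ n p ∧ cy θ n p < n ∧
    (tr = true → 1 < cx θ n p + cy θ n p ∧ cx θ n p + cy θ n p + 1 < 2 * n)}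

lemma exists_cell {n : ℕ} (hn : 1 ≤ n) {x : ℝ} (h0 : 0 ≤ x) (h1 : x ≤ n) :
    ∃ a : ℕ, a < n ∧ (a : ℝ) ≤ x ∧ x ≤ a + 1 := by
  rcases h1.lt_or_eq with h | h
  · exact ⟨⌊x⌋₊, (Nat.floor_lt h0).2 h, Nat.floor_le h0, (Nat.lt_floor_add_one x).le⟩
  · refine ⟨n - 1, by omega, ?_, ?_⟩ <;> rw [h, Nat.cast_sub hn] <;> simp

lemma domain_gridMesh_eq_iUnion (θ : ℝ) (n : ℕ) (long : ℕ → ℕ → Prop) (tr : Bool) :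
    domain (gridMesh θ n long tr) = ⋃ κ ∈ elems n tr, convexHull ℝ (tri θ n long κ) := by
  rw [domain, gridMesh, Set.biUnion_image]
  rfl

lemma domain_gridMesh {θ : ℝ} {n : ℕ} {long : ℕ → ℕ → Prop} {tr : Bool}
    (hg : IsGrid θ n long tr) : domain (gridMesh θ n long tr) = region θ n tr := by
  have hθ := hg.angle
  have hn := hg.pos
  rw [domain_gridMesh_eq_iUnion]
  ext p
  simp only [Set.mem_iUnion, exists_prop]
  constructor
  · rintro ⟨κ, hκ, hp⟩
    obtain ⟨h1, h2, -⟩ := mem_elems.1 hκ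
    have h1' : (κ.1 : ℝ) + 1 ≤ n := by exact_mod_cast h1
    have h2' : (κ.2.1 : ℝ) + 1 ≤ n := by exact_mod_cast h2
    obtain ⟨b1, b2, b3, b4⟩ := hull_bounds hθ hn hp
    have c1 : (0 : ℝ) ≤ κ.1 := by positivity
    have c2 : (0 : ℝ) ≤ κ.2.1 := by positivity
    refine ⟨by linarith, by linarith, by linarith, by linarith, fun htr => ?_⟩
    subst htr
    have hc := vtx_ne_corner (hg.two_le rfl) (hg.short rfl) hκ
    have hc' : ∀ v, (1 : ℝ) ≤ (vtx long κ v).1 + (vtx long κ v).2 ∧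
        ((vtx long κ v).1 : ℝ) + (vtx long κ v).2 + 1 ≤ 2 * n := fun v => by
      exact_mod_cast hc v
    have e1 := (hull_ineq hθ hn hp (a := 1) (b := 1) (c := -1) fun v => by
      linarith [(hc' v).1]).1
    have e2 := (hull_ineq hθ hn hp (a := -1) (b := -1) (c := 2 * n - 1) fun v => by
      linarith [(hc' v).2]).1
    constructor <;> linarith
  · rintro ⟨h1, h2, h3, h4, h5⟩
    obtain ⟨a, ha, ha1, ha2⟩ := exists_cell hn h1 h2
    obtain ⟨b, hb, hb1, hb2⟩ := exists_cell hn h3 h4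
    by_cases hl : long a b
    · have hne : ∀ t, (a, b, t) ∈ elems n tr := by
        intro t
        refine mem_elems.2 ⟨ha, hb, fun htr => ⟨fun he => ?_, fun he => ?_⟩⟩
        · simp only [Prod.mk.injEq] at he
          rw [he.1, he.2.1] at hl
          exact (hg.short htr).1 hl
        · simp only [Prod.mk.injEq] at he
          rw [he.1, he.2.1] at hl
          exact (hg.short htr).2 hl
      rcases le_total (cx θ n p - a) (cy θ n p - b) with h | h
      · refine ⟨(a, b, true), hne _, (mem_hull_iff hθ hn).2 fun v => ?_⟩
        fin_cases v <;> simp [bary, vtx, hl, sideX, sideY] <;> linarith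
      · refine ⟨(a, b, false), hne _, (mem_hull_iff hθ hn).2 fun v => ?_⟩
        fin_cases v <;> simp [bary, vtx, hl, sideX, sideY] <;> linarith
    · have hlow : cx θ n p - a + (cy θ n p - b) ≤ 1 →
          p ∈ convexHull ℝ (tri θ n long (a, b, false)) := by
        intro h
        refine (mem_hull_iff hθ hn).2 fun v => ?_
        fin_cases v <;> simp [bary, vtx, hl, sideX, sideY] <;> linarith
      have hup : 1 ≤ cx θ n p - a + (cy θ n p - b) →
          p ∈ convexHull ℝ (tri θ n long (a, b, true)) := by
        intro h
        refine (mem_hull_iff hθ hn).2 fun v => ?_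
        fin_cases v <;> simp [bary, vtx, hl, sideX, sideY] <;> linarith
      by_cases hc : tr = true ∧ a = 0 ∧ b = 0
      · obtain ⟨rfl, rfl, rfl⟩ := hc
        have := hg.two_le rfl
        refine ⟨_, mem_elems.2 ⟨ha, hb, fun _ => ⟨by simp, ?_⟩⟩, hup ?_⟩
        · simp only [ne_eq, Prod.mk.injEq, not_and]; omega
        · have := (h5 rfl).1
          push_cast; linarith
      by_cases hc' : tr = true ∧ a = n - 1 ∧ b = n - 1
      · obtain ⟨rfl, rfl, rfl⟩ := hc'
        have := hg.two_le rfl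
        refine ⟨_, mem_elems.2 ⟨ha, hb, fun _ => ⟨?_, by simp⟩⟩, hlow ?_⟩
        · simp only [ne_eq, Prod.mk.injEq, not_and]; omega
        · have := (h5 rfl).2
          rw [Nat.cast_sub hn]; push_cast; linarith
      have hne : ∀ t, (a, b, t) ∈ elems n tr := by
        intro t
        refine mem_elems.2 ⟨ha, hb, fun htr => ⟨fun he => ?_, fun he => ?_⟩⟩
        · simp only [Prod.mk.injEq] at he
          exact hc ⟨htr, he.1, he.2.1⟩
        · simp only [Prod.mk.injEq] at he
          exact hc' ⟨htr, he.1, he.2.1⟩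
      rcases le_total (cx θ n p - a + (cy θ n p - b)) 1 with h | h
      · exact ⟨_, hne _, hlow h⟩
      · exact ⟨_, hne _, hup h⟩

/-- At an interior point of a set on which a nonconstant affine function is nonnegative, this
function is positive. -/
lemma pos_of_mem_interior {S : Set Plane} {g : Plane} (hg : g ≠ 0) {c : ℝ}
    (hS : ∀ p ∈ S, 0 ≤ inner ℝ g p + c) {p : Plane} (hp : p ∈ interior S) :
    0 < inner ℝ g p + c := by
  have h1 : Filter.Tendsto (fun t : ℝ => p - t • g) (nhdsWithin 0 (Set.Ioi 0)) (nhds p) := by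
    have : Continuous fun t : ℝ => p - t • g := by fun_prop
    have h2 := this.tendsto 0
    simp only [zero_smul, sub_zero] at h2
    exact h2.mono_left nhdsWithin_le_nhds
  obtain ⟨t, ht, ht0⟩ := ((h1.eventually (mem_interior_iff_mem_nhds.1 hp)).and
    self_mem_nhdsWithin).exists
  have h3 := hS _ ht
  rw [inner_sub_right, inner_smul_right] at h3
  have h4 : 0 < inner ℝ g g := real_inner_self_pos.2 hg
  have : 0 < t * inner ℝ g g := mul_pos ht0 h4
  linarith

lemma gradX_ne_zero {θ : ℝ} {n : ℕ} (h : IsAngle θ) (hn : 1 ≤ n) : gradX θ n ≠ 0 := by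
  intro h0
  have := (inner_gradX_dir n h).1
  rw [h0, inner_zero_left] at this
  have hn' : (0 : ℝ) < n := by positivity
  linarith

lemma gradY_ne_zero {θ : ℝ} {n : ℕ} (h : IsAngle θ) (hn : 1 ≤ n) : gradY θ n ≠ 0 := by
  intro h0
  have := (inner_gradY_dir n h).2
  rw [h0, inner_zero_left] at this
  have hn' : (0 : ℝ) < n := by positivity
  linarith

lemma gradXY_ne_zero {θ : ℝ} {n : ℕ} (h : IsAngle θ) (hn : 1 ≤ n) : gradX θ n + gradY θ n ≠ 0 := by
  intro h0
  have := (inner_gradX_dir n h).1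
  have h2 := (inner_gradY_dir n h).1
  rw [← add_zero (inner ℝ (gradX θ n) _), ← h2, ← inner_add_left, h0, inner_zero_left] at this
  have hn' : (0 : ℝ) < n := by positivity
  linarith

lemma continuous_cx (θ : ℝ) (n : ℕ) : Continuous (cx θ n) := by unfold cx; fun_prop

lemma continuous_cy (θ : ℝ) (n : ℕ) : Continuous (cy θ n) := by unfold cy; fun_prop

lemma isOpen_openRegion (θ : ℝ) (n : ℕ) (tr : Bool) : IsOpen (openRegion θ n tr) := by
  have h1 := continuous_cx θ n
  have h2 := continuous_cy θ n
  have hs := h1.add h2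
  unfold openRegion
  refine (isOpen_lt continuous_const h1).inter ((isOpen_lt h1 continuous_const).inter
    ((isOpen_lt continuous_const h2).inter ((isOpen_lt h2 continuous_const).inter ?_)))
  cases tr
  · change IsOpen {p : Plane | false = true → _}
    simp
  · simp only [true_implies]
    exact (isOpen_lt continuous_const hs).inter (isOpen_lt (hs.add continuous_const)
      continuous_const)

lemma interior_region {θ : ℝ} {n : ℕ} (h : IsAngle θ) (hn : 1 ≤ n) (tr : Bool) :
    interior (region θ n tr) = openRegion θ n tr := by
  refine Set.Subset.antisymm ?_ (interior_maximal ?_ (isOpen_openRegion θ n tr))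
  · intro p hp
    have e1 := pos_of_mem_interior (gradX_ne_zero h hn) (c := n / 2) (fun p hp => hp.1) hp
    have e2 := pos_of_mem_interior (neg_ne_zero.2 (gradX_ne_zero h hn)) (c := n / 2)
      (fun p hp => by
        have := hp.2.1
        rw [cx] at this; rw [inner_neg_left]; linarith) hp
    have e3 := pos_of_mem_interior (gradY_ne_zero h hn) (c := n / 2) (fun p hp => hp.2.2.1) hp
    have e4 := pos_of_mem_interior (neg_ne_zero.2 (gradY_ne_zero h hn)) (c := n / 2)
      (fun p hp => by
        have := hp.2.2.2.1
        rw [cy] at this; rw [inner_neg_left]; linarith) hp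
    rw [inner_neg_left] at e2 e4
    refine ⟨e1, by rw [cx]; linarith, e3, by rw [cy]; linarith, fun htr => ?_⟩
    have e5 := pos_of_mem_interior (gradXY_ne_zero h hn) (c := n - 1)
      (fun p hp => by
        have := (hp.2.2.2.2 htr).1
        rw [cx, cy] at this; rw [inner_add_left]; linarith) hp
    have e6 := pos_of_mem_interior (neg_ne_zero.2 (gradXY_ne_zero h hn)) (c := n - 1)
      (fun p hp => by
        have := (hp.2.2.2.2 htr).2
        rw [cx, cy] at this; rw [inner_neg_left, inner_add_left]; linarith) hp
    rw [inner_add_left] at e5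
    rw [inner_neg_left, inner_add_left] at e6
    rw [cx, cy]
    constructor <;> linarith
  · rintro p ⟨h1, h2, h3, h4, h5⟩
    exact ⟨h1.le, h2.le, h3.le, h4.le, fun htr => ⟨(h5 htr).1.le, (h5 htr).2.le⟩⟩

lemma isClosed_region (θ : ℝ) (n : ℕ) (tr : Bool) : IsClosed (region θ n tr) := by
  have h1 := continuous_cx θ n
  have h2 := continuous_cy θ n
  have hs := h1.add h2
  unfold region
  refine (isClosed_le continuous_const h1).inter ((isClosed_le h1 continuous_const).inter
    ((isClosed_le continuous_const h2).inter ((isClosed_le h2 continuous_const).inter ?_)))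
  cases tr
  · change IsClosed {p : Plane | false = true → _}
    simp
  · simp only [true_implies]
    exact (isClosed_le continuous_const hs).inter (isClosed_le (hs.add continuous_const)
      continuous_const)

lemma mem_bdry_iff {θ : ℝ} {n : ℕ} {long : ℕ → ℕ → Prop} {tr : Bool}
    (hg : IsGrid θ n long tr) {p : Plane} :
    p ∈ bdry (gridMesh θ n long tr) ↔ p ∈ region θ n tr ∧ p ∉ openRegion θ n tr := by
  rw [bdry, domain_gridMesh hg, frontier, interior_region hg.angle hg.pos,
    (isClosed_region θ n tr).closure_eq, Set.mem_sdiff]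

/-- A node of the mesh is a vertex of one of its triangles. -/
def IsNode (n : ℕ) (tr : Bool) (long : ℕ → ℕ → Prop) (P : Node) : Prop :=
  ∃ κ ∈ elems n tr, ∃ v, vtx long κ v = P

lemma isNode_vtx {n : ℕ} {tr : Bool} {long : ℕ → ℕ → Prop} {κ : Elem} (hκ : κ ∈ elems n tr)
    (v : Fin 3) : IsNode n tr long (vtx long κ v) := ⟨κ, hκ, v, rfl⟩

lemma mem_vertices_iff {θ : ℝ} {n : ℕ} {long : ℕ → ℕ → Prop} {tr : Bool} {p : Plane} :
    p ∈ vertices (gridMesh θ n long tr) ↔ ∃ P, IsNode n tr long P ∧ nodePt θ n P = p := by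
  constructor
  · rintro ⟨t, ⟨κ, hκ, rfl⟩, v, rfl⟩
    exact ⟨_, ⟨κ, hκ, v, rfl⟩, rfl⟩
  · rintro ⟨_, ⟨κ, hκ, v, rfl⟩, rfl⟩
    exact ⟨_, ⟨κ, hκ, rfl⟩, v, rfl⟩

lemma IsNode.mem_region {θ : ℝ} {n : ℕ} {long : ℕ → ℕ → Prop} {tr : Bool}
    (hg : IsGrid θ n long tr) {P : Node} (hP : IsNode n tr long P) :
    nodePt θ n P ∈ region θ n tr := by
  obtain ⟨κ, hκ, v, rfl⟩ := hP
  rw [← domain_gridMesh hg, domain_gridMesh_eq_iUnion]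
  exact Set.mem_biUnion hκ (subset_convexHull ℝ _ ⟨v, rfl⟩)

lemma nodePt_mem_openRegion {θ : ℝ} {n : ℕ} {long : ℕ → ℕ → Prop} {tr : Bool}
    (hg : IsGrid θ n long tr) {P : Node} :
    nodePt θ n P ∈ openRegion θ n tr ↔ IsInner n P := by
  simp only [openRegion, Set.mem_ofPred_eq, cx_nodePt hg.angle hg.pos, cy_nodePt hg.angle hg.pos,
    IsInner]
  norm_cast
  constructor
  · rintro ⟨h1, h2, h3, h4, -⟩
    exact ⟨h1, h2, h3, h4⟩
  · rintro ⟨h1, h2, h3, h4⟩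
    exact ⟨h1, h2, h3, h4, fun _ => ⟨by omega, by omega⟩⟩

lemma IsInner.isNode {n : ℕ} {long : ℕ → ℕ → Prop} {tr : Bool}
    (hs : tr = true → ShortCorners n long) {P : Node} (hP : IsInner n P) : IsNode n tr long P := by
  obtain ⟨κ, hκ, h, -⟩ := exists_elem_horizontal hs (.inl (show IsInner n (P.1, P.2) from hP))
  exact ⟨κ, hκ, h⟩

lemma mem_interiorVertices_iff {θ : ℝ} {n : ℕ} {long : ℕ → ℕ → Prop} {tr : Bool}
    (hg : IsGrid θ n long tr) {p : Plane} :
    p ∈ interiorVertices (gridMesh θ n long tr) ↔ ∃ P, IsInner n P ∧ nodePt θ n P = p := by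
  rw [interiorVertices, domain_gridMesh hg, interior_region hg.angle hg.pos, Set.mem_inter_iff,
    mem_vertices_iff]
  constructor
  · rintro ⟨⟨P, -, rfl⟩, h⟩
    exact ⟨P, (nodePt_mem_openRegion hg).1 h, rfl⟩
  · rintro ⟨P, hP, rfl⟩
    exact ⟨⟨P, hP.isNode hg.short, rfl⟩, (nodePt_mem_openRegion hg).2 hP⟩

lemma nodePt_mem_bdry_iff {θ : ℝ} {n : ℕ} {long : ℕ → ℕ → Prop} {tr : Bool}
    (hg : IsGrid θ n long tr) {P : Node} (hP : IsNode n tr long P) :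
    nodePt θ n P ∈ bdry (gridMesh θ n long tr) ↔ ¬ IsInner n P := by
  rw [mem_bdry_iff hg, nodePt_mem_openRegion hg]
  exact and_iff_right (hP.mem_region hg)

/-- At a boundary point of the domain, only boundary nodes have positive weights. -/
lemma bary_eq_zero_or_not_inner {θ : ℝ} {n : ℕ} {long : ℕ → ℕ → Prop} {tr : Bool}
    (hg : IsGrid θ n long tr) {p : Plane} (hp : p ∈ bdry (gridMesh θ n long tr)) {κ : Elem}
    (hκ : κ ∈ elems n tr) (hpκ : p ∈ convexHull ℝ (tri θ n long κ)) (v : Fin 3) :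
    bary θ n long κ v p = 0 ∨ ¬ IsInner n (vtx long κ v) := by
  obtain ⟨⟨h1, h2, h3, h4, h5⟩, h6⟩ := (mem_bdry_iff hg).1 hp
  have hb : ∀ w, ((vtx long κ w).1 : ℝ) ≤ n ∧ ((vtx long κ w).2 : ℝ) ≤ n := fun w => by
    exact_mod_cast mem_nodes.1 (vtx_mem_nodes (long := long) hκ w)
  have hc : ∀ w, (0 : ℝ) ≤ (vtx long κ w).1 ∧ (0 : ℝ) ≤ (vtx long κ w).2 := fun w =>
    ⟨by positivity, by positivity⟩
  have key : ∀ a b c : ℝ, (∀ w, 0 ≤ a * (vtx long κ w).1 + b * (vtx long κ w).2 + c) →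
      a * cx θ n p + b * cy θ n p + c = 0 →
      (IsInner n (vtx long κ v) → a * (vtx long κ v).1 + b * (vtx long κ v).2 + c ≠ 0) →
      bary θ n long κ v p = 0 ∨ ¬ IsInner n (vtx long κ v) := by
    intro a b c hw h0 hne
    rcases (hull_ineq hg.angle hg.pos hpκ hw).2 h0 v with h | h
    · exact .inl h
    · exact .inr fun hi => hne hi h
  have hi : IsInner n (vtx long κ v) → (1 : ℝ) ≤ (vtx long κ v).1 ∧
      ((vtx long κ v).1 : ℝ) + 1 ≤ n ∧ (1 : ℝ) ≤ (vtx long κ v).2 ∧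
      ((vtx long κ v).2 : ℝ) + 1 ≤ n := by
    rintro ⟨i1, i2, i3, i4⟩
    exact ⟨by exact_mod_cast i1, by exact_mod_cast i2, by exact_mod_cast i3, by exact_mod_cast i4⟩
  rcases h1.eq_or_lt with e1 | l1
  · exact key 1 0 0 (fun w => by linarith [(hc w).1]) (by linarith)
      fun h => by have := (hi h).1; intro h; linarith
  rcases h2.eq_or_lt with e2 | l2
  · exact key (-1) 0 n (fun w => by linarith [(hb w).1]) (by linarith)
      fun h => by have := (hi h).2.1; intro h; linarith
  rcases h3.eq_or_lt with e3 | l3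
  · exact key 0 1 0 (fun w => by linarith [(hc w).2]) (by linarith)
      fun h => by have := (hi h).2.2.1; intro h; linarith
  rcases h4.eq_or_lt with e4 | l4
  · exact key 0 (-1) n (fun w => by linarith [(hb w).2]) (by linarith)
      fun h => by have := (hi h).2.2.2; intro h; linarith
  cases tr with
  | false => exact absurd ⟨l1, l2, l3, l4, by simp⟩ h6
  | true =>
    have hcor : ∀ w, (1 : ℝ) ≤ (vtx long κ w).1 + (vtx long κ w).2 ∧
        ((vtx long κ w).1 : ℝ) + (vtx long κ w).2 + 1 ≤ 2 * n := fun w => by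
      exact_mod_cast vtx_ne_corner (hg.two_le rfl) (hg.short rfl) hκ w
    rcases (h5 rfl).1.eq_or_lt with e5 | l5
    · exact key 1 1 (-1) (fun w => by linarith [(hcor w).1]) (by linarith)
        fun h => by have := (hi h).1; have := (hi h).2.2.1; intro h; linarith
    rcases (h5 rfl).2.eq_or_lt with e6 | l6
    · exact key (-1) (-1) (2 * n - 1) (fun w => by linarith [(hcor w).2]) (by linarith)
        fun h => by have := (hi h).2.1; have := (hi h).2.2.2; intro h; linarith
    exact absurd ⟨l1, l2, l3, l4, fun _ => ⟨l5, l6⟩⟩ h6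

/-! ### Interpolation of nodal values -/

/-- The affine function on a triangle with given values at its vertices. -/
def elemInterp (θ : ℝ) (n : ℕ) (long : ℕ → ℕ → Prop) (κ : Elem) (U : Node → ℝ) (p : Plane) : ℝ :=
  ∑ v, bary θ n long κ v p * U (vtx long κ v)

/-- The gradient of `elemInterp`. -/
def elemGrad (θ : ℝ) (n : ℕ) (long : ℕ → ℕ → Prop) (κ : Elem) (U : Node → ℝ) : Plane :=
  ∑ v, U (vtx long κ v) • baryGrad θ n long κ v

lemma elemInterp_eq (θ : ℝ) (n : ℕ) (long : ℕ → ℕ → Prop) (κ : Elem) (U : Node → ℝ) (p : Plane) :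
    elemInterp θ n long κ U p =
      inner ℝ (elemGrad θ n long κ U) p + elemInterp θ n long κ U 0 := by
  simp only [elemInterp, elemGrad, sum_inner, inner_smul_left, ← Finset.sum_add_distrib]
  refine Finset.sum_congr rfl fun v _ => ?_
  rw [bary_eq _ _ _ _ _ p]
  simp; ring

/-- The piecewise linear hat function for the mesh with all diagonals short. -/
def hexHat (x y : ℝ) : ℝ := max 0 (min (min (1 - |x|) (1 - |y|)) (1 - |x + y|))

/-- The pyramid over the unit square: the difference of the hat functions for the two ways of
dividing a small rhombus is plus or minus this function. -/
def bubble (x y : ℝ) : ℝ := max 0 (min (min x (1 - x)) (min y (1 - y)))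

/-- The nodal basis function at the grid point `P`. -/
def hatFun (θ : ℝ) (n : ℕ) (long : ℕ → ℕ → Prop) (P : Node) (p : Plane) : ℝ :=
  open Classical in
  hexHat (cx θ n p - P.1) (cy θ n p - P.2) +
  ∑ r ∈ Finset.range n ×ˢ Finset.range n, (if long r.1 r.2 then
    (unit P (r.1, r.2) + unit P (r.1 + 1, r.2 + 1) - unit P (r.1 + 1, r.2) -
      unit P (r.1, r.2 + 1)) * bubble (cx θ n p - r.1) (cy θ n p - r.2) else 0)

lemma continuous_hatFun (θ : ℝ) (n : ℕ) (long : ℕ → ℕ → Prop) (P : Node) :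
    Continuous (hatFun θ n long P) := by
  have h1 := continuous_cx θ n
  have h2 := continuous_cy θ n
  unfold hatFun hexHat bubble
  refine Continuous.add (by fun_prop) (continuous_finsetSum _ fun r _ => ?_)
  split_ifs
  · fun_prop
  · exact continuous_const

section
variable {x y : ℝ}

lemma hexHat_far (h : 1 ≤ |x| ∨ 1 ≤ |y|) : hexHat x y = 0 := by
  unfold hexHat
  rw [max_eq_left]
  rcases h with h | h
  · exact (min_le_left _ _).trans ((min_le_left _ _).trans (by linarith))
  · exact (min_le_left _ _).trans ((min_le_right _ _).trans (by linarith))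

lemma bubble_far (h : x ≤ 0 ∨ 1 ≤ x ∨ y ≤ 0 ∨ 1 ≤ y) : bubble x y = 0 := by
  unfold bubble
  rw [max_eq_left]
  simp only [min_le_iff]
  rcases h with h | h | h | h
  · exact .inl (.inl h)
  · exact .inl (.inr (by linarith))
  · exact .inr (.inl h)
  · exact .inr (.inr (by linarith))

lemma bubble_near (hx0 : 0 ≤ x) (hx1 : x ≤ 1) (hy0 : 0 ≤ y) (hy1 : y ≤ 1) :
    bubble x y = min (min x (1 - x)) (min y (1 - y)) := by
  unfold bubble
  rw [max_eq_right]
  simp only [le_min_iff]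
  refine ⟨⟨?_, ?_⟩, ?_, ?_⟩ <;> linarith

lemma hexHat_near (hx0 : 0 ≤ x) (hx1 : x ≤ 1) (hy0 : 0 ≤ y) (hy1 : y ≤ 1) :
    hexHat x y = max 0 (1 - x - y) ∧ hexHat (x - 1) y = min x (1 - y) ∧
    hexHat x (y - 1) = min (1 - x) y ∧ hexHat (x - 1) (y - 1) = max 0 (x + y - 1) := by
  unfold hexHat
  rw [abs_of_nonneg hx0, abs_of_nonneg hy0, abs_of_nonpos (show x - 1 ≤ 0 by linarith),
    abs_of_nonpos (show y - 1 ≤ 0 by linarith), abs_of_nonneg (show 0 ≤ x + y by linarith),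
    abs_of_nonpos (show x - 1 + (y - 1) ≤ 0 by linarith)]
  refine ⟨?_, ?_, ?_, ?_⟩
  · congr 1
    rw [min_eq_right]
    · ring
    · simp only [le_min_iff]; constructor <;> linarith
  · rcases le_total 0 (x - 1 + y) with h | h
    · rw [abs_of_nonneg h]; simp only [max_def, min_def]; split_ifs <;> linarith
    · rw [abs_of_nonpos h]; simp only [max_def, min_def]; split_ifs <;> linarith
  · rcases le_total 0 (x + (y - 1)) with h | h
    · rw [abs_of_nonneg h]; simp only [max_def, min_def]; split_ifs <;> linarith
    · rw [abs_of_nonpos h]; simp only [max_def, min_def]; split_ifs <;> linarith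
  · congr 1
    rw [min_eq_right]
    · ring
    · simp only [le_min_iff]; constructor <;> linarith

end

/-- On each triangle the function `hatFun` is the affine function with the right nodal values. -/
lemma hatFun_eq_elemInterp {θ : ℝ} {n : ℕ} (h : IsAngle θ) (hn : 1 ≤ n) {long : ℕ → ℕ → Prop}
    {tr : Bool} {κ : Elem} (hκ : κ ∈ elems n tr) {p : Plane}
    (hp : p ∈ convexHull ℝ (tri θ n long κ)) (P : Node) :
    hatFun θ n long P p = elemInterp θ n long κ (unit P) p := by
  classical
  obtain ⟨ha, hb, -⟩ := mem_elems.1 hκ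
  obtain ⟨h1, h2, h3, h4⟩ := hull_bounds h hn hp
  have hbary := (mem_hull_iff h hn).1 hp
  obtain ⟨a, b, t⟩ := κ
  simp only at ha hb h1 h2 h3 h4
  -- only the bubble of the small rhombus that contains `p` contributes
  rw [hatFun, Finset.sum_eq_single (a, b)]
  rotate_left
  · rintro ⟨a', b'⟩ - hne
    split_ifs
    · rw [bubble_far, mul_zero]
      simp only
      rcases lt_trichotomy a' a with hlt | heq | hgt
      · have : (a' : ℝ) + 1 ≤ a := by exact_mod_cast hlt
        right; left; linarith
      · rcases lt_trichotomy b' b with hlt' | heq' | hgt'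
        · have : (b' : ℝ) + 1 ≤ b := by exact_mod_cast hlt'
          right; right; right; linarith
        · exact absurd (by rw [heq, heq']) hne
        · have : (b : ℝ) + 1 ≤ b' := by exact_mod_cast hgt'
          right; right; left; linarith
      · have : (a : ℝ) + 1 ≤ a' := by exact_mod_cast hgt
        left; linarith
    · rfl
  · intro hmem
    exact absurd (Finset.mem_product.2 ⟨Finset.mem_range.2 ha, Finset.mem_range.2 hb⟩) hmem
  obtain ⟨x, hx⟩ : ∃ x, cx θ n p = a + x := ⟨cx θ n p - a, by ring⟩
  obtain ⟨y, hy⟩ : ∃ y, cy θ n p = b + y := ⟨cy θ n p - b, by ring⟩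
  have hx0 : 0 ≤ x := by linarith
  have hx1 : x ≤ 1 := by linarith
  have hy0 : 0 ≤ y := by linarith
  have hy1 : y ≤ 1 := by linarith
  obtain ⟨P1, P2⟩ := P
  by_cases hP : (P1 = a ∨ P1 = a + 1) ∧ (P2 = b ∨ P2 = b + 1)
  · have hb0 := hbary 0
    have hb1 := hbary 1
    have hb2 := hbary 2
    obtain ⟨e1, e2, e3, e4⟩ := hexHat_near hx0 hx1 hy0 hy1
    have e5 := bubble_near hx0 hx1 hy0 hy1
    have s1 : ∀ z w : ℝ, z + w - (z + 1) = w - 1 := fun z w => by ring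
    simp only [elemInterp, Fin.sum_univ_three]
    by_cases hl : long a b <;> cases t <;>
      simp [vtx, hl, bary, sideX, sideY, hx, hy] at hb0 hb1 hb2 <;>
      obtain ⟨rfl | rfl, rfl | rfl⟩ := hP <;>
      simp [vtx, hl, bary, sideX, sideY, unit_apply, hx, hy, s1, e1, e2, e3, e4, e5] <;>
      (try simp only [max_def, min_def]) <;> (try split_ifs) <;> linarith
  · have hfar : P1 + 1 ≤ a ∨ a + 2 ≤ P1 ∨ P2 + 1 ≤ b ∨ b + 2 ≤ P2 := by omega
    have hu : ∀ c d : ℕ, a ≤ c → c ≤ a + 1 → b ≤ d → d ≤ b + 1 → unit (P1, P2) (c, d) = 0 := by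
      intro c d c1 c2 d1 d2
      rw [unit_apply, if_neg]
      simp only [Prod.mk.injEq, not_and]
      omega
    have hI : elemInterp θ n long (a, b, t) (unit (P1, P2)) p = 0 := by
      refine Finset.sum_eq_zero fun v _ => ?_
      obtain ⟨b1, b2, b3, b4⟩ := vtx_bounds long (a, b, t) v
      rw [← Prod.mk.eta (p := vtx long (a, b, t) v), hu _ _ b1 b2 b3 b4, mul_zero]
    rw [hI, hexHat_far, hu a b, hu (a + 1) (b + 1), hu (a + 1) b, hu a (b + 1)]
    · simp
    any_goals omega
    simp only [hx, hy]
    rcases hfar with hf | hf | hf | hf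
    · have : (P1 : ℝ) + 1 ≤ a := by exact_mod_cast hf
      left; exact le_abs.2 (.inl (by linarith))
    · have : (a : ℝ) + 2 ≤ P1 := by exact_mod_cast hf
      left; exact le_abs.2 (.inr (by linarith))
    · have : (P2 : ℝ) + 1 ≤ b := by exact_mod_cast hf
      right; exact le_abs.2 (.inl (by linarith))
    · have : (b : ℝ) + 2 ≤ P2 := by exact_mod_cast hf
      right; exact le_abs.2 (.inr (by linarith))

/-- The nodal values of a function. -/
def nodalValues (θ : ℝ) (n : ℕ) : (Plane → ℝ) →ₗ[ℝ] (Node → ℝ) := LinearMap.funLeft ℝ ℝ (nodePt θ n)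

lemma nodalValues_apply (θ : ℝ) (n : ℕ) (u : Plane → ℝ) (P : Node) :
    nodalValues θ n u P = u (nodePt θ n P) := rfl

/-- A finite element function is on each triangle the interpolant of its nodal values. -/
lemma eq_elemInterp {θ : ℝ} {n : ℕ} (h : IsAngle θ) (hn : 1 ≤ n) {long : ℕ → ℕ → Prop}
    {tr : Bool} {u : Plane → ℝ} (hu : u ∈ feSpace (gridMesh θ n long tr)) {κ : Elem}
    (hκ : κ ∈ elems n tr) {p : Plane} (hp : p ∈ convexHull ℝ (tri θ n long κ)) :
    u p = elemInterp θ n long κ (nodalValues θ n u) p := by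
  obtain ⟨g, hg⟩ := hu.2.1 _ ⟨κ, hκ, rfl⟩
  have hgv : ∀ v, u (nodePt θ n (vtx long κ v)) = g (nodePt θ n (vtx long κ v)) := fun v =>
    hg (subset_convexHull ℝ _ ⟨v, rfl⟩)
  have hdec : ∀ x, g x = g.linear x + g 0 := fun x => by
    have := congrFun g.decomp x
    simpa using this
  rw [hg hp]
  conv_lhs => rw [← sum_bary_smul h hn long κ p]
  simp only [elemInterp, nodalValues_apply, hgv]
  rw [hdec, map_sum]
  simp only [map_smul, smul_eq_mul]
  conv_lhs => rw [← one_mul (g 0), ← sum_bary θ n long κ p, Finset.sum_mul,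
    ← Finset.sum_add_distrib]
  exact Finset.sum_congr rfl fun v _ => by rw [hdec (nodePt θ n (vtx long κ v))]; ring

lemma exists_mem_elem {θ : ℝ} {n : ℕ} {long : ℕ → ℕ → Prop} {tr : Bool} {p : Plane}
    (hp : p ∈ domain (gridMesh θ n long tr)) :
    ∃ κ ∈ elems n tr, p ∈ convexHull ℝ (tri θ n long κ) := by
  rw [domain_gridMesh_eq_iUnion] at hp
  simpa only [Set.mem_iUnion, exists_prop] using hp

lemma hull_subset_domain {θ : ℝ} {n : ℕ} {long : ℕ → ℕ → Prop} {tr : Bool} {κ : Elem}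
    (hκ : κ ∈ elems n tr) :
    convexHull ℝ (tri θ n long κ) ⊆ domain (gridMesh θ n long tr) := by
  rw [domain_gridMesh_eq_iUnion]
  exact Set.subset_biUnion_of_mem (u := fun κ => convexHull ℝ (tri θ n long κ)) hκ

/-- Nodal values can be prescribed arbitrarily. -/
lemma exists_feSpace {θ : ℝ} {n : ℕ} (h : IsAngle θ) (hn : 1 ≤ n) (long : ℕ → ℕ → Prop)
    (tr : Bool) (U : Node → ℝ) :
    ∃ u ∈ feSpace (gridMesh θ n long tr), ∀ P, IsNode n tr long P → u (nodePt θ n P) = U P := by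
  classical
  set F : Plane → ℝ := fun p => ∑ P ∈ nodes n, U P * hatFun θ n long P p with hF
  have hFc : Continuous F := continuous_finsetSum _ fun P _ =>
    continuous_const.mul (continuous_hatFun θ n long P)
  have hFκ : ∀ κ ∈ elems n tr, ∀ p ∈ convexHull ℝ (tri θ n long κ),
      F p = elemInterp θ n long κ U p := by
    intro κ hκ p hp
    simp only [hF, hatFun_eq_elemInterp h hn hκ hp, elemInterp, Finset.mul_sum]
    rw [Finset.sum_comm]
    refine Finset.sum_congr rfl fun v _ => ?_
    rw [Finset.sum_eq_single (vtx long κ v)]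
    · rw [unit_self]; ring
    · intro Q _ hQ
      rw [unit_apply, if_neg (Ne.symm hQ)]; simp
    · intro hv
      exact absurd (vtx_mem_nodes hκ v) hv
  -- members of `feSpace` vanish outside the domain by convention
  set u : Plane → ℝ := (domain (gridMesh θ n long tr)).indicator F with hu
  have huF : ∀ p ∈ domain (gridMesh θ n long tr), u p = F p := fun p hp =>
    Set.indicator_of_mem hp F
  refine ⟨u, ⟨hFc.continuousOn.congr huF, ?_, fun x hx => Set.indicator_of_notMem hx F⟩, ?_⟩
  · rintro _ ⟨κ, hκ, rfl⟩
    refine ⟨(innerSL ℝ (elemGrad θ n long κ U)).toLinearMap.toAffineMap +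
      AffineMap.const ℝ Plane (elemInterp θ n long κ U 0), fun p hp => ?_⟩
    rw [huF p (hull_subset_domain hκ hp), hFκ κ hκ p hp, elemInterp_eq]
    simp
  · rintro _ ⟨κ, hκ, v, rfl⟩
    have hv : nodePt θ n (vtx long κ v) ∈ convexHull ℝ (tri θ n long κ) :=
      subset_convexHull ℝ _ ⟨v, rfl⟩
    rw [huF _ (hull_subset_domain hκ hv), hFκ κ hκ _ hv]
    simp [elemInterp, bary_nodePt h hn]

lemma feSpace_ext {θ : ℝ} {n : ℕ} (h : IsAngle θ) (hn : 1 ≤ n) {long : ℕ → ℕ → Prop}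
    {tr : Bool} {u v : Plane → ℝ} (hu : u ∈ feSpace (gridMesh θ n long tr))
    (hv : v ∈ feSpace (gridMesh θ n long tr))
    (huv : ∀ P, IsNode n tr long P → u (nodePt θ n P) = v (nodePt θ n P)) : u = v := by
  funext p
  by_cases hp : p ∈ domain (gridMesh θ n long tr)
  · obtain ⟨κ, hκ, hpκ⟩ := exists_mem_elem hp
    rw [eq_elemInterp h hn hu hκ hpκ, eq_elemInterp h hn hv hκ hpκ]
    exact Finset.sum_congr rfl fun v _ => by
      rw [nodalValues_apply, nodalValues_apply, huv _ (isNode_vtx hκ v)]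
  · rw [hu.2.2 p hp, hv.2.2 p hp]

/-- A finite element function attains its minimum at a node. -/
lemma le_of_le_nodes {θ : ℝ} {n : ℕ} (h : IsAngle θ) (hn : 1 ≤ n) {long : ℕ → ℕ → Prop}
    {tr : Bool} {u : Plane → ℝ} (hu : u ∈ feSpace (gridMesh θ n long tr)) {m : ℝ}
    (hm : ∀ P, IsNode n tr long P → m ≤ u (nodePt θ n P)) {p : Plane}
    (hp : p ∈ domain (gridMesh θ n long tr)) : m ≤ u p := by
  obtain ⟨κ, hκ, hpκ⟩ := exists_mem_elem hp
  have hb := (mem_hull_iff h hn).1 hpκ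
  rw [eq_elemInterp h hn hu hκ hpκ, elemInterp, ← one_mul m, ← sum_bary θ n long κ p,
    Finset.sum_mul]
  exact Finset.sum_le_sum fun v _ =>
    mul_le_mul_of_nonneg_left (hm _ (isNode_vtx hκ v)) (hb v)

lemma eq_of_eq_nodes {θ : ℝ} {n : ℕ} (h : IsAngle θ) (hn : 1 ≤ n) {long : ℕ → ℕ → Prop}
    {tr : Bool} {u : Plane → ℝ} (hu : u ∈ feSpace (gridMesh θ n long tr)) {m : ℝ}
    (hm : ∀ P, IsNode n tr long P → u (nodePt θ n P) = m) {p : Plane}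
    (hp : p ∈ domain (gridMesh θ n long tr)) : u p = m := by
  obtain ⟨κ, hκ, hpκ⟩ := exists_mem_elem hp
  rw [eq_elemInterp h hn hu hκ hpκ, elemInterp, ← one_mul m, ← sum_bary θ n long κ p,
    Finset.sum_mul]
  exact Finset.sum_congr rfl fun v _ => by rw [nodalValues_apply, hm _ (isNode_vtx hκ v)]

/-- Membership in `V_0^h` in terms of nodal values. -/
lemma mem_feSpaceZero_iff {θ : ℝ} {n : ℕ} {long : ℕ → ℕ → Prop} {tr : Bool}
    (hg : IsGrid θ n long tr) {u : Plane → ℝ} (hu : u ∈ feSpace (gridMesh θ n long tr)) :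
    u ∈ feSpaceZero (gridMesh θ n long tr) ↔
      ∀ P, IsNode n tr long P → ¬ IsInner n P → u (nodePt θ n P) = 0 := by
  constructor
  · intro h P hP hi
    exact h.2 _ ((nodePt_mem_bdry_iff hg hP).2 hi)
  · intro h
    refine ⟨hu, fun p hp => ?_⟩
    have hpd : p ∈ domain (gridMesh θ n long tr) := by
      rw [domain_gridMesh hg]; exact ((mem_bdry_iff hg).1 hp).1
    obtain ⟨κ, hκ, hpκ⟩ := exists_mem_elem hpd
    rw [eq_elemInterp hg.angle hg.pos hu hκ hpκ]
    refine Finset.sum_eq_zero fun v _ => ?_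
    rcases bary_eq_zero_or_not_inner hg hp hκ hpκ v with h0 | hi
    · rw [h0, zero_mul]
    · rw [nodalValues_apply, h _ (isNode_vtx hκ v) hi, mul_zero]

lemma isNodal_iff {θ : ℝ} {n : ℕ} {long : ℕ → ℕ → Prop} {tr : Bool}
    (hg : IsGrid θ n long tr) {P : Node} (hP : IsNode n tr long P) {φ : Plane → ℝ} :
    IsNodal (gridMesh θ n long tr) (nodePt θ n P) φ ↔ φ ∈ feSpace (gridMesh θ n long tr) ∧
      ∀ Q, IsNode n tr long Q → φ (nodePt θ n Q) = unit P Q := by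
  constructor
  · rintro ⟨h1, h2, h3⟩
    refine ⟨h1, fun Q hQ => ?_⟩
    rw [unit_apply]
    split_ifs with h
    · rw [h, h2]
    · exact h3 _ (mem_vertices_iff.2 ⟨Q, hQ, rfl⟩)
        fun h' => h (nodePt_injective hg.angle hg.pos h')
  · rintro ⟨h1, h2⟩
    refine ⟨h1, by rw [h2 P hP, unit_self], fun q hq hne => ?_⟩
    obtain ⟨Q, hQ, rfl⟩ := mem_vertices_iff.1 hq
    rw [h2 Q hQ, unit_apply, if_neg]
    rintro rfl
    exact hne rfl

/-! ### Open triangles and their area -/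

/-- The open triangle. -/
def openTri (θ : ℝ) (n : ℕ) (long : ℕ → ℕ → Prop) (κ : Elem) : Set Plane :=
  {p | ∀ v, 0 < bary θ n long κ v p}

lemma isOpen_openTri (θ : ℝ) (n : ℕ) (long : ℕ → ℕ → Prop) (κ : Elem) :
    IsOpen (openTri θ n long κ) := by
  have : openTri θ n long κ = ⋂ v, {p | 0 < bary θ n long κ v p} := by
    ext p; simp [openTri]
  rw [this]
  exact isOpen_iInter_of_finite fun v =>
    isOpen_lt continuous_const (continuous_bary θ n long κ v)

lemma openTri_subset_hull {θ : ℝ} {n : ℕ} (h : IsAngle θ) (hn : 1 ≤ n) (long : ℕ → ℕ → Prop)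
    (κ : Elem) : openTri θ n long κ ⊆ convexHull ℝ (tri θ n long κ) := fun _ hp =>
  (mem_hull_iff h hn).2 fun v => (hp v).le

lemma openTri_bounds {θ : ℝ} {n : ℕ} {long : ℕ → ℕ → Prop} {κ : Elem} {p : Plane}
    (hp : p ∈ openTri θ n long κ) :
    (κ.1 : ℝ) < cx θ n p ∧ cx θ n p < κ.1 + 1 ∧ (κ.2.1 : ℝ) < cy θ n p ∧ cy θ n p < κ.2.1 + 1 := by
  have h0 := hp 0
  have h1 := hp 1
  have h2 := hp 2
  obtain ⟨a, b, t⟩ := κ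
  by_cases hl : long a b <;> cases t <;>
    simp [bary, vtx, hl, sideX, sideY] at h0 h1 h2 ⊢ <;>
    refine ⟨?_, ?_, ?_, ?_⟩ <;> linarith

lemma disjoint_openTri {θ : ℝ} {n : ℕ} {long : ℕ → ℕ → Prop} {κ κ' : Elem} (hne : κ ≠ κ') :
    Disjoint (openTri θ n long κ) (openTri θ n long κ') := by
  rw [Set.disjoint_left]
  intro p hp hp'
  obtain ⟨a1, a2, a3, a4⟩ := openTri_bounds hp
  obtain ⟨b1, b2, b3, b4⟩ := openTri_bounds hp'
  have e1 : κ.1 = κ'.1 := by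
    have h1 : (κ.1 : ℝ) < κ'.1 + 1 := by linarith
    have h2 : (κ'.1 : ℝ) < κ.1 + 1 := by linarith
    norm_cast at h1 h2; omega
  have e2 : κ.2.1 = κ'.2.1 := by
    have h1 : (κ.2.1 : ℝ) < κ'.2.1 + 1 := by linarith
    have h2 : (κ'.2.1 : ℝ) < κ.2.1 + 1 := by linarith
    norm_cast at h1 h2; omega
  obtain ⟨a, b, t⟩ := κ
  obtain ⟨a', b', t'⟩ := κ'
  simp only at e1 e2
  subst e1 e2
  have h0 := hp 0
  have h0' := hp' 0
  by_cases hl : long a b <;> cases t <;> cases t' <;>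
    simp [bary, vtx, hl, sideX, sideY] at h0 h0' hne <;> linarith

lemma baryGrad_ne_zero {θ : ℝ} {n : ℕ} (h : IsAngle θ) (hn : 1 ≤ n) (long : ℕ → ℕ → Prop)
    (κ : Elem) (v : Fin 3) : baryGrad θ n long κ v ≠ 0 := by
  intro h0
  obtain ⟨w, hw⟩ := exists_ne v
  have h1 := bary_eq θ n long κ v (nodePt θ n (vtx long κ v))
  have h2 := bary_eq θ n long κ v (nodePt θ n (vtx long κ w))
  rw [h0, inner_zero_left, bary_nodePt h hn] at h1 h2
  rw [if_pos rfl] at h1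
  rw [if_neg hw.symm] at h2
  linarith

/-- A closed triangle differs from the open one by a null set. -/
lemma hull_ae_eq {θ : ℝ} {n : ℕ} (h : IsAngle θ) (hn : 1 ≤ n) (long : ℕ → ℕ → Prop)
    (κ : Elem) : (convexHull ℝ (tri θ n long κ) : Set Plane) =ᵐ[volume] openTri θ n long κ := by
  refine Filter.EventuallyLE.antisymm ?_ (openTri_subset_hull h hn long κ).eventuallyLE
  rw [ae_le_set]
  refine measure_mono_null ?_ ((convex_convexHull ℝ (tri θ n long κ)).addHaar_frontier volume)
  rintro p ⟨hp, hp'⟩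
  refine ⟨subset_closure hp, fun hi => hp' fun v => ?_⟩
  rw [bary_eq]
  exact pos_of_mem_interior (baryGrad_ne_zero h hn long κ v)
    (fun q hq => by rw [← bary_eq]; exact (mem_hull_iff h hn).1 hq v) hi

lemma domain_ae_eq {θ : ℝ} {n : ℕ} (h : IsAngle θ) (hn : 1 ≤ n) (long : ℕ → ℕ → Prop)
    (tr : Bool) : (domain (gridMesh θ n long tr) : Set Plane) =ᵐ[volume]
      (⋃ κ ∈ elems n tr, openTri θ n long κ : Set Plane) := by
  rw [domain_gridMesh_eq_iUnion]
  exact Filter.EventuallyEq.countable_bUnion (Finset.countable_toSet _)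
    fun κ _ => hull_ae_eq h hn long κ

/-- An integral over the domain is the sum of the integrals over the open triangles. -/
lemma setIntegral_domain {θ : ℝ} {n : ℕ} (h : IsAngle θ) (hn : 1 ≤ n) (long : ℕ → ℕ → Prop)
    (tr : Bool) {F : Plane → ℝ} (hF : ∀ κ ∈ elems n tr, IntegrableOn F (openTri θ n long κ)) :
    ∫ x in domain (gridMesh θ n long tr), F x =
      ∑ κ ∈ elems n tr, ∫ x in openTri θ n long κ, F x := by
  rw [setIntegral_congr_set (domain_ae_eq h hn long tr)]
  exact integral_biUnion_finset _ (fun κ _ => (isOpen_openTri θ n long κ).measurableSet)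
    (fun κ _ κ' _ hne => disjoint_openTri hne) hF

/-- The reference triangle. -/
def refTri (θ : ℝ) (n : ℕ) : Set Plane :=
  {p | 0 < cx θ n p ∧ 0 < cy θ n p ∧ cx θ n p + cy θ n p < 1}

/-- The affine map that takes a triangle to the reference triangle preserves areas, since its
linear part is an involution. -/
lemma volume_openTri {θ : ℝ} {n : ℕ} (h : IsAngle θ) (hn : 1 ≤ n) (long : ℕ → ℕ → Prop)
    (κ : Elem) : volume (openTri θ n long κ) = volume (refTri θ n) := by
  obtain ⟨s1, s2, -⟩ := side_facts long κ
  have hn' : (n : ℝ) ≠ 0 := by positivity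
  obtain ⟨i1, i2⟩ := inner_gradX_dir n h
  obtain ⟨j1, j2⟩ := inner_gradY_dir n h
  set L : Plane →ₗ[ℝ] Plane :=
    ((innerSL ℝ (gradX θ n)).smulRight ((sideX long κ / n) • dir (-(θ / 2))) +
     (innerSL ℝ (gradY θ n)).smulRight ((sideY long κ / n) • dir (θ / 2))).toLinearMap with hL
  have hLp : ∀ p, L p = (inner ℝ (gradX θ n) p * (sideX long κ / n)) • dir (-(θ / 2)) +
      (inner ℝ (gradY θ n) p * (sideY long κ / n)) • dir (θ / 2) := by
    intro p; simp [hL, smul_smul]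
  have hLL : L ∘ₗ L = LinearMap.id := by
    ext1 p
    have hp := pt_cx_cy h hn p
    rw [LinearMap.comp_apply, LinearMap.id_apply]
    conv_rhs => rw [← hp]
    have e1 : inner ℝ (gradX θ n) (L p) = sideX long κ * inner ℝ (gradX θ n) p := by
      rw [hLp, inner_add_right, inner_smul_right, inner_smul_right, i1, i2]
      field_simp; ring
    have e2 : inner ℝ (gradY θ n) (L p) = sideY long κ * inner ℝ (gradY θ n) p := by
      rw [hLp, inner_add_right, inner_smul_right, inner_smul_right, j1, j2]
      field_simp; ring
    rw [hLp, e1, e2, pt, cx, cy]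
    congr 2
    · field_simp
      linear_combination (2 * inner ℝ (gradX θ n) p) * s1
    · field_simp
      linear_combination (2 * inner ℝ (gradY θ n) p) * s2
  have hdet : L.det ^ 2 = 1 := by
    have := congrArg LinearMap.det hLL
    rw [LinearMap.det_comp, LinearMap.det_id] at this
    rw [sq, this]
  have hdet0 : L.det ≠ 0 := by
    intro h0; rw [h0] at hdet; norm_num at hdet
  have habs : |(L.det)⁻¹| = 1 := by
    rcases (sq_eq_sq_iff_eq_or_eq_neg.1 (hdet.trans (one_pow 2).symm)) with h1 | h1 <;> simp [h1]
  set q : Plane := pt θ n (bary θ n long κ 1 0) (bary θ n long κ 2 0) with hq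
  have hset : openTri θ n long κ = L ⁻¹' ((fun x => x + q) ⁻¹' refTri θ n) := by
    ext p
    have hΨ : L p + q = pt θ n (bary θ n long κ 1 p) (bary θ n long κ 2 p) := by
      rw [hLp, hq, bary_eq θ n long κ 1 p, bary_eq θ n long κ 2 p]
      simp only [pt, baryGrad, Matrix.cons_val_one, Matrix.cons_val, inner_smul_left]
      simp only [conj_trivial]
      module
    have hsum := sum_bary θ n long κ p
    rw [Fin.sum_univ_three] at hsum
    change _ ↔ L p + q ∈ refTri θ n
    rw [hΨ, openTri, refTri, Set.mem_ofPred_eq, Set.mem_ofPred_eq, cx_pt h hn, cy_pt h hn]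
    simp only [Fin.forall_fin_succ, Fin.succ_zero_eq_one, Fin.succ_one_eq_two, IsEmpty.forall_iff,
      and_true]
    constructor
    · rintro ⟨h0, h1, h2⟩
      exact ⟨h1, h2, by linarith⟩
    · rintro ⟨h1, h2, h0⟩
      exact ⟨by linarith, h1, h2⟩
  rw [hset, Measure.addHaar_preimage_linearMap volume hdet0, measure_preimage_add_right, habs]
  simp

/-- The common area of the triangles. -/
def area (θ : ℝ) (n : ℕ) : ℝ := (volume (refTri θ n)).toReal

lemma volume_refTri_lt_top {θ : ℝ} {n : ℕ} (h : IsAngle θ) (hn : 1 ≤ n) :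
    volume (refTri θ n) < ⊤ := by
  rw [← volume_openTri h hn (fun _ _ => False) (0, 0, false)]
  refine (measure_mono (openTri_subset_hull h hn _ _)).trans_lt ?_
  exact ((Set.finite_range _).isCompact_convexHull ℝ).measure_lt_top

lemma area_pos {θ : ℝ} {n : ℕ} (h : IsAngle θ) (hn : 1 ≤ n) : 0 < area θ n := by
  refine ENNReal.toReal_pos (IsOpen.measure_pos volume ?_ ?_).ne' (volume_refTri_lt_top h hn).ne
  · have h1 := continuous_cx θ n
    have h2 := continuous_cy θ n
    exact (isOpen_lt continuous_const h1).inter ((isOpen_lt continuous_const h2).inter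
      (isOpen_lt (h1.add h2) continuous_const))
  · refine ⟨pt θ n (1 / 3) (1 / 3), ?_⟩
    rw [refTri, Set.mem_ofPred_eq, cx_pt h hn, cy_pt h hn]
    norm_num

lemma volume_real_openTri {θ : ℝ} {n : ℕ} (h : IsAngle θ) (hn : 1 ≤ n) (long : ℕ → ℕ → Prop)
    (κ : Elem) : volume.real (openTri θ n long κ) = area θ n := by
  rw [measureReal_def, volume_openTri h hn]; rfl

/-! ### The Dirichlet form -/

/-- The common factor in the element stiffness matrices. -/
def stiffFactor (θ : ℝ) (n : ℕ) : ℝ := area θ n * ((n : ℝ) ^ 2 / sin θ ^ 2)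

lemma stiffFactor_pos {θ : ℝ} {n : ℕ} (h : IsAngle θ) (hn : 1 ≤ n) : 0 < stiffFactor θ n := by
  have := area_pos h hn
  have := h.sin_pos
  have hn' : (0 : ℝ) < n := by positivity
  unfold stiffFactor
  positivity

lemma inner_elemGrad {θ : ℝ} {n : ℕ} (h : IsAngle θ) (long : ℕ → ℕ → Prop)
    (κ : Elem) (U W : Node → ℝ) :
    inner ℝ (elemGrad θ n long κ U) (elemGrad θ n long κ W) = (n : ℝ) ^ 2 / sin θ ^ 2 *
      elemForm (elemStiff (elemSign long κ * cos θ)) (U ∘ vtx long κ) (W ∘ vtx long κ) := by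
  obtain ⟨s1, s2, s3, -⟩ := side_facts long κ
  obtain ⟨g1, g2, g3⟩ := inner_grad n h
  have hG : ∀ V : Node → ℝ, elemGrad θ n long κ V =
      (sideX long κ * (V (vtx long κ 1) - V (vtx long κ 0))) • gradX θ n +
      (sideY long κ * (V (vtx long κ 2) - V (vtx long κ 0))) • gradY θ n := by
    intro V
    simp only [elemGrad, Fin.sum_univ_three, baryGrad, Matrix.cons_val_zero, Matrix.cons_val_one,
      Matrix.cons_val]
    module
  have g4 : inner ℝ (gradY θ n) (gradX θ n) = - cos θ * ((n : ℝ) ^ 2 / sin θ ^ 2) := by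
    rw [real_inner_comm, g3]
  rw [hG U, hG W, elemForm_elemStiff, ← s3]
  simp only [inner_add_left, inner_add_right, inner_smul_left, inner_smul_right, g1, g2, g3, g4,
    conj_trivial, Function.comp]
  set N := (n : ℝ) ^ 2 / sin θ ^ 2
  linear_combination
    (N * (U (vtx long κ 1) - U (vtx long κ 0)) * (W (vtx long κ 1) - W (vtx long κ 0))) * s1 +
    (N * (U (vtx long κ 2) - U (vtx long κ 0)) * (W (vtx long κ 2) - W (vtx long κ 0))) * s2

lemma gradient_eq_elemGrad {θ : ℝ} {n : ℕ} (h : IsAngle θ) (hn : 1 ≤ n) {long : ℕ → ℕ → Prop}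
    {tr : Bool} {u : Plane → ℝ} (hu : u ∈ feSpace (gridMesh θ n long tr)) {κ : Elem}
    (hκ : κ ∈ elems n tr) {p : Plane} (hp : p ∈ openTri θ n long κ) :
    gradient u p = elemGrad θ n long κ (nodalValues θ n u) := by
  set G := elemGrad θ n long κ (nodalValues θ n u)
  set r := elemInterp θ n long κ (nodalValues θ n u) 0
  have h1 : HasGradientAt (fun q : Plane => inner ℝ G q + r) G p := by
    rw [hasGradientAt_iff_hasFDerivAt]
    exact ((innerSL ℝ G).hasFDerivAt (x := p)).add_const r
  refine (h1.congr_of_eventuallyEq ?_).gradient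
  filter_upwards [(isOpen_openTri θ n long κ).mem_nhds hp] with q hq
  rw [eq_elemInterp h hn hu hκ (openTri_subset_hull h hn long κ hq), elemInterp_eq]

lemma dirichletForm_eq {θ : ℝ} {n : ℕ} (h : IsAngle θ) (hn : 1 ≤ n) {long : ℕ → ℕ → Prop}
    {tr : Bool} {u w : Plane → ℝ} (hu : u ∈ feSpace (gridMesh θ n long tr))
    (hw : w ∈ feSpace (gridMesh θ n long tr)) :
    dirichletForm (gridMesh θ n long tr) u w = stiffFactor θ n *
      form (elems n tr) long (fun κ => elemStiff (elemSign long κ * cos θ)) (nodalValues θ n u)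
        (nodalValues θ n w) := by
  have hconst : ∀ κ ∈ elems n tr, ∀ p ∈ openTri θ n long κ,
      inner ℝ (gradient u p) (gradient w p) = inner ℝ (elemGrad θ n long κ (nodalValues θ n u))
        (elemGrad θ n long κ (nodalValues θ n w)) := by
    intro κ hκ p hp
    rw [gradient_eq_elemGrad h hn hu hκ hp, gradient_eq_elemGrad h hn hw hκ hp]
  have hfin : ∀ κ, volume (openTri θ n long κ) ≠ ⊤ := fun κ => by
    rw [volume_openTri h hn]; exact (volume_refTri_lt_top h hn).ne
  rw [dirichletForm, setIntegral_domain h hn, form_apply, Finset.mul_sum]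
  · refine Finset.sum_congr rfl fun κ hκ => ?_
    rw [setIntegral_congr_fun (isOpen_openTri θ n long κ).measurableSet (hconst κ hκ),
      setIntegral_const, volume_real_openTri h hn, inner_elemGrad h, smul_eq_mul, stiffFactor]
    ring
  · intro κ hκ
    exact (integrableOn_const (hfin κ)).congr_fun (fun p hp => (hconst κ hκ p hp).symm)
      (isOpen_openTri θ n long κ).measurableSet

/-! ### The reaction form -/

/-- The coefficient of the reaction term is measurable with values between `0` and `C`. -/
structure IsCoeff (M : Mesh) (c : Plane → ℝ) (C : ℝ) : Prop where
  meas : AEMeasurable c (volume.restrict (domain M))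
  bound : ∀ᵐ x ∂(volume.restrict (domain M)), 0 ≤ c x ∧ c x ≤ C

/-- The element matrix of the reaction term. -/
def moment (θ : ℝ) (n : ℕ) (long : ℕ → ℕ → Prop) (c : Plane → ℝ) (κ : Elem) (v w : Fin 3) : ℝ :=
  ∫ x in openTri θ n long κ, c x * bary θ n long κ v x * bary θ n long κ w x

lemma bary_le_one {θ : ℝ} {n : ℕ} {long : ℕ → ℕ → Prop} {κ : Elem} {p : Plane}
    (hp : p ∈ openTri θ n long κ) (v : Fin 3) : bary θ n long κ v p ≤ 1 := by
  rw [← sum_bary θ n long κ p]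
  exact Finset.single_le_sum (f := fun v => bary θ n long κ v p) (fun v _ => (hp v).le)
    (Finset.mem_univ v)

section
variable {θ : ℝ} {n : ℕ} {long : ℕ → ℕ → Prop} {tr : Bool} {c : Plane → ℝ} {C : ℝ}

lemma IsCoeff.restrict_le (h : IsAngle θ) (hn : 1 ≤ n) {κ : Elem} (hκ : κ ∈ elems n tr) :
    (volume.restrict (openTri θ n long κ) : Measure Plane) ≤
      volume.restrict (domain (gridMesh θ n long tr)) :=
  Measure.restrict_mono ((openTri_subset_hull h hn long κ).trans (hull_subset_domain hκ)) le_rfl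

lemma IsCoeff.ae_bound (hc : IsCoeff (gridMesh θ n long tr) c C) (h : IsAngle θ) (hn : 1 ≤ n)
    {κ : Elem} (hκ : κ ∈ elems n tr) (v w : Fin 3) :
    ∀ᵐ x ∂(volume.restrict (openTri θ n long κ)),
      ‖c x * bary θ n long κ v x * bary θ n long κ w x‖ ≤ C := by
  filter_upwards [ae_mono (IsCoeff.restrict_le h hn hκ) hc.bound,
    ae_restrict_mem (isOpen_openTri θ n long κ).measurableSet] with x hx hxκ
  have h1 := (hxκ v).le
  have h2 := (hxκ w).le
  rw [Real.norm_eq_abs, abs_of_nonneg (mul_nonneg (mul_nonneg hx.1 h1) h2)]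
  refine (mul_le_of_le_one_right (mul_nonneg hx.1 h1) (bary_le_one hxκ w)).trans ?_
  exact (mul_le_of_le_one_right hx.1 (bary_le_one hxκ v)).trans hx.2

lemma IsCoeff.integrableOn (hc : IsCoeff (gridMesh θ n long tr) c C) (h : IsAngle θ) (hn : 1 ≤ n)
    {κ : Elem} (hκ : κ ∈ elems n tr) (v w : Fin 3) :
    IntegrableOn (fun x => c x * bary θ n long κ v x * bary θ n long κ w x)
      (openTri θ n long κ) := by
  have hfin : volume (openTri θ n long κ) < ⊤ := by
    rw [volume_openTri h hn]; exact volume_refTri_lt_top h hn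
  have hm : AEMeasurable c (volume.restrict (openTri θ n long κ)) :=
    hc.meas.mono_measure (IsCoeff.restrict_le h hn hκ)
  refine IntegrableOn.of_bound hfin ?_ C ?_
  · exact ((hm.mul (continuous_bary θ n long κ v).measurable.aemeasurable).mul
      (continuous_bary θ n long κ w).measurable.aemeasurable).aestronglyMeasurable
  · exact hc.ae_bound h hn hκ v w

lemma IsCoeff.abs_moment_le (hc : IsCoeff (gridMesh θ n long tr) c C) (h : IsAngle θ) (hn : 1 ≤ n)
    {κ : Elem} (hκ : κ ∈ elems n tr) (v w : Fin 3) :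
    |moment θ n long c κ v w| ≤ C * area θ n := by
  rw [← volume_real_openTri h hn long κ]
  rw [← Real.norm_eq_abs]
  refine norm_setIntegral_le_of_norm_le_const_ae ?_ (hc.ae_bound h hn hκ v w)
  rw [volume_openTri h hn]; exact volume_refTri_lt_top h hn

lemma IsCoeff.elemForm_moment (hc : IsCoeff (gridMesh θ n long tr) c C) (h : IsAngle θ)
    (hn : 1 ≤ n) {κ : Elem} (hκ : κ ∈ elems n tr) (U W : Node → ℝ) :
    IntegrableOn (fun x => c x * elemInterp θ n long κ U x * elemInterp θ n long κ W x)
      (openTri θ n long κ) ∧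
    elemForm (moment θ n long c κ) (U ∘ vtx long κ) (W ∘ vtx long κ) =
      ∫ x in openTri θ n long κ, c x * elemInterp θ n long κ U x * elemInterp θ n long κ W x := by
  have hexp : ∀ x, c x * elemInterp θ n long κ U x * elemInterp θ n long κ W x =
      ∑ v, ∑ w, c x * bary θ n long κ v x * bary θ n long κ w x *
        (U (vtx long κ v) * W (vtx long κ w)) := by
    intro x
    simp only [elemInterp, Finset.mul_sum, Finset.sum_mul]
    rw [Finset.sum_comm]
    refine Finset.sum_congr rfl fun v _ => Finset.sum_congr rfl fun w _ => by ring
  have hint : ∀ v w, IntegrableOn (fun x => c x * bary θ n long κ v x * bary θ n long κ w x *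
      (U (vtx long κ v) * W (vtx long κ w))) (openTri θ n long κ) := fun v w =>
    (hc.integrableOn h hn hκ v w).mul_const _
  simp only [hexp]
  refine ⟨integrable_finsetSum _ fun v _ => integrable_finsetSum _ fun w _ => hint v w, ?_⟩
  rw [integral_finsetSum _ fun v _ => integrable_finsetSum _ fun w _ => hint v w]
  refine Finset.sum_congr rfl fun v _ => ?_
  rw [integral_finsetSum _ fun w _ => hint v w]
  refine Finset.sum_congr rfl fun w _ => ?_
  rw [integral_mul_const, moment]
  simp only [Function.comp]
  ring

lemma IsCoeff.reactionForm_eq (hc : IsCoeff (gridMesh θ n long tr) c C) (h : IsAngle θ)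
    (hn : 1 ≤ n) {u w : Plane → ℝ} (hu : u ∈ feSpace (gridMesh θ n long tr))
    (hw : w ∈ feSpace (gridMesh θ n long tr)) :
    reactionForm (gridMesh θ n long tr) c u w =
      form (elems n tr) long (moment θ n long c) (nodalValues θ n u) (nodalValues θ n w) := by
  have hloc : ∀ κ ∈ elems n tr, Set.EqOn (fun x => c x * u x * w x)
      (fun x => c x * elemInterp θ n long κ (nodalValues θ n u) x *
        elemInterp θ n long κ (nodalValues θ n w) x) (openTri θ n long κ) := by
    intro κ hκ x hx
    have hx' := openTri_subset_hull h hn long κ hx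
    simp only
    rw [eq_elemInterp h hn hu hκ hx', eq_elemInterp h hn hw hκ hx']
  rw [reactionForm, setIntegral_domain h hn, form_apply]
  · refine Finset.sum_congr rfl fun κ hκ => ?_
    rw [(hc.elemForm_moment h hn hκ _ _).2]
    exact setIntegral_congr_fun (isOpen_openTri θ n long κ).measurableSet (hloc κ hκ)
  · intro κ hκ
    exact (hc.elemForm_moment h hn hκ _ _).1.congr_fun (hloc κ hκ).symm
      (isOpen_openTri θ n long κ).measurableSet

/-- The element matrices of the discrete problem. -/
def elemMatrix (θ : ℝ) (n : ℕ) (long : ℕ → ℕ → Prop) (c : Plane → ℝ) (κ : Elem)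
    (v w : Fin 3) : ℝ :=
  stiffFactor θ n * elemStiff (elemSign long κ * cos θ) v w + moment θ n long c κ v w

lemma elemForm_elemMatrix (c : Plane → ℝ) (κ : Elem) (x y : Fin 3 → ℝ) :
    elemForm (elemMatrix θ n long c κ) x y =
      stiffFactor θ n * elemForm (elemStiff (elemSign long κ * cos θ)) x y +
        elemForm (moment θ n long c κ) x y := by
  simp only [elemForm, elemMatrix, Finset.mul_sum, ← Finset.sum_add_distrib]
  exact Finset.sum_congr rfl fun v _ => Finset.sum_congr rfl fun w _ => by ring

lemma form_elemMatrix (K : Finset Elem) (c : Plane → ℝ) (U W : Node → ℝ) :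
    form K long (elemMatrix θ n long c) U W =
      stiffFactor θ n * form K long (fun κ => elemStiff (elemSign long κ * cos θ)) U W +
        form K long (moment θ n long c) U W := by
  simp only [form_apply, Finset.mul_sum, ← Finset.sum_add_distrib, elemForm_elemMatrix]

/-- The bilinear form of the discrete problem in terms of nodal values. -/
lemma IsCoeff.forms_eq (hc : IsCoeff (gridMesh θ n long tr) c C) (h : IsAngle θ)
    (hn : 1 ≤ n) {u w : Plane → ℝ} (hu : u ∈ feSpace (gridMesh θ n long tr))
    (hw : w ∈ feSpace (gridMesh θ n long tr)) :
    dirichletForm (gridMesh θ n long tr) u w + reactionForm (gridMesh θ n long tr) c u w =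
      form (elems n tr) long (elemMatrix θ n long c) (nodalValues θ n u) (nodalValues θ n w) := by
  rw [dirichletForm_eq h hn hu hw, hc.reactionForm_eq h hn hu hw, form_elemMatrix]

lemma IsCoeff.elemForm_moment_self_nonneg (hc : IsCoeff (gridMesh θ n long tr) c C)
    (h : IsAngle θ) (hn : 1 ≤ n) {κ : Elem} (hκ : κ ∈ elems n tr) (U : Node → ℝ) :
    0 ≤ elemForm (moment θ n long c κ) (U ∘ vtx long κ) (U ∘ vtx long κ) := by
  rw [(hc.elemForm_moment h hn hκ _ _).2]
  refine integral_nonneg_of_ae ?_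
  filter_upwards [ae_mono (IsCoeff.restrict_le h hn hκ) hc.bound] with x hx
  have := mul_nonneg hx.1 (mul_self_nonneg (elemInterp θ n long κ U x))
  simp only [Pi.zero_apply]
  linarith

/-- The reaction form is nonnegative on pairs of nonnegative nodal values. -/
lemma IsCoeff.form_moment_nonneg (hc : IsCoeff (gridMesh θ n long tr) c C)
    (h : IsAngle θ) (hn : 1 ≤ n) {U W : Node → ℝ} (hU : ∀ P, 0 ≤ U P) (hW : ∀ P, 0 ≤ W P) :
    0 ≤ form (elems n tr) long (moment θ n long c) U W := by
  rw [form_apply]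
  refine Finset.sum_nonneg fun κ hκ => Finset.sum_nonneg fun v _ => Finset.sum_nonneg fun w _ => ?_
  refine mul_nonneg (mul_nonneg ?_ (hU _)) (hW _)
  refine integral_nonneg_of_ae ?_
  filter_upwards [ae_mono (IsCoeff.restrict_le h hn hκ) hc.bound,
    ae_restrict_mem (isOpen_openTri θ n long κ).measurableSet] with x hx hxκ
  exact mul_nonneg (mul_nonneg hx.1 (hxκ v).le) (hxκ w).le

end

/-! ### Acute stars and patches in terms of indices -/

lemma inner_dir (θ : ℝ) : inner ℝ (dir (-(θ / 2))) (dir (θ / 2)) = cos θ := by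
  have hc : cos θ = cos (θ / 2) ^ 2 - sin (θ / 2) ^ 2 := by
    rw [← cos_two_mul']; congr 1; ring
  rw [hc]
  simp [dir, PiLp.inner_apply, Fin.sum_univ_two]
  ring

/-- A node with an acute star belongs only to rhombuses that are divided along their short
diagonals. -/
lemma shortStar_of_acuteStar {θ : ℝ} {n : ℕ} {long : ℕ → ℕ → Prop} (h : IsAngle θ)
    (hθ : θ < π / 2) (hn : 1 ≤ n) {P : Node} (hP : IsInner n P)
    (hA : AcuteStar (gridMesh θ n long false) (nodePt θ n P)) : ShortStar long P := by
  intro i j h1 h2 h3 h4 hl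
  obtain ⟨t, v, hv⟩ : ∃ t v, vtx long (i, j, t) v = P := by
    by_cases hc : P.1 = i ∧ P.2 = j + 1
    · exact ⟨true, 0, by simp [vtx, hl, Prod.ext_iff, hc]⟩
    · have h5 : (P.1 = i ∧ P.2 = j) ∨ (P.1 = i + 1 ∧ P.2 = j) ∨ (P.1 = i + 1 ∧ P.2 = j + 1) := by
        omega
      rcases h5 with h5 | h5 | h5
      · exact ⟨false, 1, by simp [vtx, hl, Prod.ext_iff, h5]⟩
      · exact ⟨false, 0, by simp [vtx, hl, Prod.ext_iff, h5]⟩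
      · exact ⟨false, 2, by simp [vtx, hl, Prod.ext_iff, h5]⟩
  set κ : Elem := (i, j, t) with hκ
  have hmem : κ ∈ elems n false :=
    mem_elems_of_inner (long := long) (v := v) (by simp) (hv ▸ hP)
  have hinj : ∀ a b : Fin 3, a ≠ b →
      nodePt θ n (vtx long κ a) ≠ nodePt θ n (vtx long κ b) := fun a b hab he =>
    hab (vtx_injective long κ (nodePt_injective h hn he))
  have hang := hA _ ⟨κ, hmem, rfl⟩ ⟨v, by simp only [hv]⟩ _ _ _ (hinj 1 0 (by decide))
    (hinj 0 2 (by decide)) (hinj 2 1 (by decide))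
    (by ext x; simp [tri, Fin.exists_fin_succ, eq_comm]; tauto)
  have hn' : (n : ℝ) ≠ 0 := by positivity
  obtain ⟨-, -, s3, s4, s5⟩ := side_facts long κ
  have e1 : nodePt θ n (vtx long κ 1) - nodePt θ n (vtx long κ 0) =
      (sideX long κ / n) • dir (-(θ / 2)) := by
    simp only [nodePt_eq_pt, pt, s4, sideX]; module
  have e2 : nodePt θ n (vtx long κ 2) - nodePt θ n (vtx long κ 0) =
      (sideY long κ / n) • dir (θ / 2) := by
    simp only [nodePt_eq_pt, pt, s5, sideY]; module
  -- in a long rhombus the angle at vertex `0` is `π - θ`, which is obtuse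
  have hinner : inner ℝ (nodePt θ n (vtx long κ 1) - nodePt θ n (vtx long κ 0))
      (nodePt θ n (vtx long κ 2) - nodePt θ n (vtx long κ 0)) < 0 := by
    have hs : sideX long κ * sideY long κ = -1 := by rw [s3]; simp [elemSign, hκ, hl]
    have hc : 0 < cos θ := cos_pos_of_mem_Ioo ⟨by linarith [h.1, pi_pos], hθ⟩
    rw [e1, e2, inner_smul_left, inner_smul_right, inner_dir, conj_trivial]
    have : sideX long κ / n * (sideY long κ / n * cos θ) = -(cos θ / n ^ 2) := by
      field_simp
      linear_combination hs
    rw [this]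
    have : (0 : ℝ) < n := by positivity
    exact neg_neg_of_pos (by positivity)
  rw [EuclideanGeometry.angle, vsub_eq_sub, vsub_eq_sub] at hang
  have hnn := InnerProductGeometry.angle_nonneg
    (nodePt θ n (vtx long κ 1) - nodePt θ n (vtx long κ 0))
    (nodePt θ n (vtx long κ 2) - nodePt θ n (vtx long κ 0))
  have hcos := cos_pos_of_mem_Ioo ⟨by linarith [pi_pos], hang⟩
  rw [← InnerProductGeometry.cos_angle_mul_norm_mul_norm] at hinner
  exact absurd hinner (not_lt.2 (by positivity))

lemma defectPatch_isGrid {θ : ℝ} (h : IsAngle θ) (l : ℕ) : IsGrid θ (l + 2) (patchLong l) true :=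
  ⟨h, by omega, fun _ => by omega, fun _ => patchLong_shortCorners l⟩

lemma defectPatch_eq {θ : ℝ} (h : IsAngle θ) (l : ℕ) :
    defectPatch θ l = gridMesh θ (l + 2) (patchLong l) true :=
  truncatedMesh_eq (defectPatch_isGrid h l)

/-- If the vertices of a triangle are a translate of the vertices of another one, then the small
rhombuses correspond and are divided in the same way. -/
lemma elem_of_vtx {long long' : ℕ → ℕ → Prop} {κ κ' : Elem} {o : Node}
    (h : ∀ v', ∃ v, vtx long κ v = (o.1 + (vtx long' κ' v').1, o.2 + (vtx long' κ' v').2)) :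
    κ.1 = o.1 + κ'.1 ∧ κ.2.1 = o.2 + κ'.2.1 ∧ (long κ.1 κ.2.1 ↔ long' κ'.1 κ'.2.1) := by
  have hb : ∀ v', κ.1 ≤ o.1 + (vtx long' κ' v').1 ∧ o.1 + (vtx long' κ' v').1 ≤ κ.1 + 1 ∧
      κ.2.1 ≤ o.2 + (vtx long' κ' v').2 ∧ o.2 + (vtx long' κ' v').2 ≤ κ.2.1 + 1 := by
    intro v'
    obtain ⟨v, hv⟩ := h v'
    have := vtx_bounds long κ v
    rwa [hv] at this
  obtain ⟨a', b', t'⟩ := κ'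
  obtain ⟨a, b, t⟩ := κ
  have hab : a = o.1 + a' ∧ b = o.2 + b' := by
    have h0 := hb 0
    have h1 := hb 1
    have h2 := hb 2
    by_cases hl : long' a' b' <;> cases t' <;> simp [vtx, hl] at h0 h1 h2 <;> omega
  obtain ⟨rfl, rfl⟩ := hab
  refine ⟨rfl, rfl, ?_⟩
  have h0 := h 0
  have h1 := h 1
  have h2 := h 2
  by_cases hl : long' a' b' <;> by_cases hl' : long (o.1 + a') (o.2 + b') <;> cases t <;>
    cases t' <;> simp [vtx, hl, hl', Fin.exists_fin_succ] at h0 h1 h2 ⊢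

/-- A submesh of the mesh that is a scaled copy of `G_l(θ)` consists of the rhombuses of a block of
the grid. -/
lemma exists_hasPatch {θ : ℝ} {n l : ℕ} {long : ℕ → ℕ → Prop} (h : IsAngle θ) (hn : 1 ≤ n)
    {s : ℝ} (hs : 0 < s) {b : Plane}
    (hsub : scaledMesh s b (defectPatch θ l) ⊆ gridMesh θ n long false) :
    ∃ o, HasPatch n long l o ∧ ∀ P, nodePt θ n P ∈
      interior (domain (scaledMesh s b (defectPatch θ l))) → InBlock l o P := by
  rw [defectPatch_eq h] at hsub ⊢
  set f : Plane → Plane := fun x => s • x + b with hf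
  have hn0 : (0 : ℝ) < n := by positivity
  set σ : ℝ := s * n / (l + 2 : ℕ) with hσ
  have hσ0 : 0 < σ := by positivity
  obtain ⟨i1, i2⟩ := inner_gradX_dir n h
  obtain ⟨j1, j2⟩ := inner_gradY_dir n h
  obtain ⟨x₀, hx₀⟩ : ∃ x₀, ∀ P : Node, cx θ n (f (nodePt θ (l + 2) P)) = x₀ + σ * P.1 := by
    refine ⟨inner ℝ (gradX θ n) b + n / 2 - s * n / 2, fun P => ?_⟩
    rw [cx, hf, nodePt_eq_pt, pt]
    simp only [inner_add_right, inner_smul_right, i1, i2, hσ]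
    ring
  obtain ⟨y₀, hy₀⟩ : ∃ y₀, ∀ P : Node, cy θ n (f (nodePt θ (l + 2) P)) = y₀ + σ * P.2 := by
    refine ⟨inner ℝ (gradY θ n) b + n / 2 - s * n / 2, fun P => ?_⟩
    rw [cy, hf, nodePt_eq_pt, pt]
    simp only [inner_add_right, inner_smul_right, j1, j2, hσ]
    ring
  -- each triangle of the patch is a triangle of the mesh, with some way of numbering its vertices
  have hκ : ∀ κ' ∈ elems (l + 2) true, ∃ κ ∈ elems n false,
      tri θ n long κ = f '' tri θ (l + 2) (patchLong l) κ' := by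
    intro κ' hκ'
    exact hsub ⟨_, ⟨κ', hκ', rfl⟩, rfl⟩
  have hv : ∀ κ' κ, tri θ n long κ = f '' tri θ (l + 2) (patchLong l) κ' → ∀ v', ∃ v,
      nodePt θ n (vtx long κ v) = f (nodePt θ (l + 2) (vtx (patchLong l) κ' v')) := by
    intro κ' κ he v'
    have : f (nodePt θ (l + 2) (vtx (patchLong l) κ' v')) ∈ tri θ n long κ := by
      rw [he]; exact ⟨_, ⟨v', rfl⟩, rfl⟩
    exact this
  -- the short diagonal at the corner of the patch is mapped to a side of a triangle of the mesh,
  -- along which the first index increases; it can increase only by one, so the patch has the scale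
  -- of the mesh
  obtain ⟨o, hσ1, hxo, hyo⟩ : ∃ o : Node, σ = 1 ∧ x₀ = o.1 ∧ y₀ = o.2 := by
    have hm : ((0, 0, true) : Elem) ∈ elems (l + 2) true :=
      mem_elems.2 ⟨by simp, by simp, by simp⟩
    obtain ⟨κ, -, he⟩ := hκ _ hm
    obtain ⟨v, h1⟩ := hv _ _ he 1
    obtain ⟨w, h2⟩ := hv _ _ he 2
    have bv := vtx_bounds long κ v
    have bw := vtx_bounds long κ w
    have e1 : vtx (patchLong l) (0, 0, true) 1 = (0, 1) := by
      simp [vtx, (patchLong_shortCorners l).1]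
    have e2 : vtx (patchLong l) (0, 0, true) 2 = (1, 0) := by
      simp [vtx, (patchLong_shortCorners l).1]
    rw [e1] at h1
    rw [e2] at h2
    have c1 := congrArg (cx θ n) h1
    have c2 := congrArg (cx θ n) h2
    have d1 := congrArg (cy θ n) h1
    have d2 := congrArg (cy θ n) h2
    rw [hx₀, cx_nodePt h hn] at c1 c2
    rw [hy₀, cy_nodePt h hn] at d1 d2
    simp only [Nat.cast_zero, mul_zero, add_zero, Nat.cast_one, mul_one] at c1 c2 d1 d2
    have lt1 : (vtx long κ v).1 < (vtx long κ w).1 := by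
      have : ((vtx long κ v).1 : ℝ) < (vtx long κ w).1 := by rw [c1, c2]; linarith
      exact_mod_cast this
    have e3 : (vtx long κ w).1 = (vtx long κ v).1 + 1 := by omega
    have e4 : ((vtx long κ w).1 : ℝ) = (vtx long κ v).1 + 1 := by exact_mod_cast e3
    exact ⟨((vtx long κ v).1, (vtx long κ w).2), by linarith, c1.symm, d2.symm⟩
  have hfP : ∀ P : Node, f (nodePt θ (l + 2) P) = nodePt θ n (o.1 + P.1, o.2 + P.2) := by
    intro P
    rw [← pt_cx_cy h hn (f _), hx₀, hy₀, hσ1, hxo, hyo, nodePt_eq_pt]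
    push_cast
    simp only [one_mul]
  have hcorr : ∀ κ' κ, tri θ n long κ = f '' tri θ (l + 2) (patchLong l) κ' →
      κ.1 = o.1 + κ'.1 ∧ κ.2.1 = o.2 + κ'.2.1 ∧
      (long κ.1 κ.2.1 ↔ patchLong l κ'.1 κ'.2.1) := by
    intro κ' κ he
    refine elem_of_vtx fun v' => ?_
    obtain ⟨v, hv'⟩ := hv _ _ he v'
    rw [hfP] at hv'
    exact ⟨v, nodePt_injective h hn hv'⟩
  have hblock : ∀ p q, p < l + 2 → q < l + 2 → o.1 + p < n ∧ o.2 + q < n ∧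
      (long (o.1 + p) (o.2 + q) ↔ patchLong l p q) := by
    intro p q hp hq
    obtain ⟨t, ht⟩ : ∃ t, ((p, q, t) : Elem) ∈ elems (l + 2) true := by
      by_cases hpq : p = 0 ∧ q = 0
      · exact ⟨true, mem_elems.2 ⟨hp, hq, fun _ => ⟨by simp, by simp; omega⟩⟩⟩
      · refine ⟨false, mem_elems.2 ⟨hp, hq, fun _ => ⟨?_, by simp⟩⟩⟩
        simp only [ne_eq, Prod.mk.injEq, and_true]
        exact hpq
    obtain ⟨κ, hκn, he⟩ := hκ _ ht
    obtain ⟨r1, r2, r3⟩ := hcorr _ _ he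
    obtain ⟨m1, m2, -⟩ := mem_elems.1 hκn
    simp only at r1 r2 r3
    rw [r1, r2] at r3
    exact ⟨by omega, by omega, r3⟩
  refine ⟨o, ⟨?_, ?_, fun p q hp hq => (hblock p q hp hq).2.2⟩, ?_⟩
  · have := (hblock (l + 1) 0 (by omega) (by omega)).1; omega
  · have := (hblock 0 (l + 1) (by omega) (by omega)).2.1; omega
  · intro P hP
    have hdom : ∀ p ∈ domain (scaledMesh s b (gridMesh θ (l + 2) (patchLong l) true)),
        (o.1 : ℝ) ≤ cx θ n p ∧ cx θ n p ≤ o.1 + (l + 2) ∧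
        (o.2 : ℝ) ≤ cy θ n p ∧ cy θ n p ≤ o.2 + (l + 2) := by
      intro p hp
      obtain ⟨_, ⟨_, ⟨κ', hκ', rfl⟩, rfl⟩, hp⟩ := Set.mem_iUnion₂.1 hp
      obtain ⟨κ, -, he⟩ := hκ κ' hκ'
      obtain ⟨r1, r2, -⟩ := hcorr _ _ he
      obtain ⟨m1, m2, -⟩ := mem_elems.1 hκ'
      have hp' : p ∈ convexHull ℝ (tri θ n long κ) := by rw [he]; exact hp
      obtain ⟨b1, b2, b3, b4⟩ := hull_bounds h hn hp'
      have q1 : (o.1 : ℝ) ≤ κ.1 := by exact_mod_cast (by omega : o.1 ≤ κ.1)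
      have q2 : (κ.1 : ℝ) + 1 ≤ o.1 + (l + 2) := by
        exact_mod_cast (by omega : κ.1 + 1 ≤ o.1 + (l + 2))
      have q3 : (o.2 : ℝ) ≤ κ.2.1 := by exact_mod_cast (by omega : o.2 ≤ κ.2.1)
      have q4 : (κ.2.1 : ℝ) + 1 ≤ o.2 + (l + 2) := by
        exact_mod_cast (by omega : κ.2.1 + 1 ≤ o.2 + (l + 2))
      exact ⟨by linarith, by linarith, by linarith, by linarith⟩
    have t1 := pos_of_mem_interior (gradX_ne_zero h hn) (c := n / 2 - o.1)
      (fun p hp => by have := (hdom p hp).1; rw [cx] at this; linarith) hP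
    have t2 := pos_of_mem_interior (neg_ne_zero.2 (gradX_ne_zero h hn))
      (c := o.1 + (l + 2) - n / 2) (fun p hp => by
        have := (hdom p hp).2.1; rw [cx] at this; rw [inner_neg_left]; linarith) hP
    have t3 := pos_of_mem_interior (gradY_ne_zero h hn) (c := n / 2 - o.2)
      (fun p hp => by have := (hdom p hp).2.2.1; rw [cy] at this; linarith) hP
    have t4 := pos_of_mem_interior (neg_ne_zero.2 (gradY_ne_zero h hn))
      (c := o.2 + (l + 2) - n / 2) (fun p hp => by
        have := (hdom p hp).2.2.2; rw [cy] at this; rw [inner_neg_left]; linarith) hP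
    rw [inner_neg_left] at t2 t4
    have ex := cx_nodePt h hn P
    have ey := cy_nodePt h hn P
    rw [cx] at ex
    rw [cy] at ey
    have u1 : (o.1 : ℝ) < P.1 := by linarith
    have u2 : (P.1 : ℝ) < o.1 + (l + 2) := by linarith
    have u3 : (o.2 : ℝ) < P.2 := by linarith
    have u4 : (P.2 : ℝ) < o.2 + (l + 2) := by linarith
    norm_cast at u1 u2 u3 u4
    exact ⟨by omega, by omega, by omega, by omega⟩

lemma covered_of_admissible {θ : ℝ} {n k : ℕ} {long : ℕ → ℕ → Prop} (h : IsAngle θ)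
    (hθ : θ < π / 2) (hn : 1 ≤ n) (hA : Admissible k θ (rhombusMesh θ n long)) :
    Covered n long k := by
  rw [rhombusMesh_eq] at hA
  intro P hP
  have hg : IsGrid θ n long false := ⟨h, hn, by simp, by simp⟩
  rcases hA _ ((mem_interiorVertices_iff hg).2 ⟨P, hP, rfl⟩) with
    ⟨l, hl1, hl2, s, hs, b, hsub, hint⟩ | hac
  · obtain ⟨o, ho, hblock⟩ := exists_hasPatch h hn hs hsub
    exact .inr ⟨l, o, hl1, hl2, ho, hblock P hint⟩
  · exact .inl (shortStar_of_acuteStar h hθ hn hP hac)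

/-! ### The stiffness matrices of the patches -/

lemma patchStiffness_eq {θ : ℝ} (h : IsAngle θ) (l : ℕ) :
    patchStiffness θ l =
      Matrix.of fun p q => stiffFactor θ (l + 2) * refStiff l (cos θ) p q := by
  have hg := defectPatch_isGrid h l
  have hnod : ∀ p : Fin (l + 1) × Fin (l + 1),
      IsNodal (defectPatch θ l) (nodePt θ (l + 2) (blockNode l (0, 0) p))
        (nodal (defectPatch θ l) (nodePt θ (l + 2) (blockNode l (0, 0) p))) := by
    intro p
    have hP : IsNode (l + 2) true (patchLong l) (blockNode l (0, 0) p) :=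
      (isInner_iff_inBlock.2 (inBlock_blockNode l (0, 0) p)).isNode hg.short
    obtain ⟨u, hu, huv⟩ := exists_feSpace hg.angle hg.pos (patchLong l) true
      (unit (blockNode l (0, 0) p))
    -- `nodal` is chosen by `Classical.epsilon`, so a nodal basis function has to exist
    refine Classical.epsilon_spec (p := IsNodal (defectPatch θ l) _) ⟨u, ?_⟩
    rw [defectPatch_eq h]
    exact (isNodal_iff hg hP).2 ⟨hu, huv⟩
  ext p q
  have hpt : ∀ p : Fin (l + 1) × Fin (l + 1), gridPt θ (l + 2) (p.1 + 1) (p.2 + 1) =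
      nodePt θ (l + 2) (blockNode l (0, 0) p) := by
    intro p; simp [nodePt, blockNode]
  have hp := hnod p
  have hq := hnod q
  rw [patchStiffness, hpt, hpt]
  generalize nodal (defectPatch θ l) (nodePt θ (l + 2) (blockNode l (0, 0) p)) = φ at hp
  generalize nodal (defectPatch θ l) (nodePt θ (l + 2) (blockNode l (0, 0) q)) = ψ at hq
  have hN : ∀ p, IsNode (l + 2) true (patchLong l) (blockNode l (0, 0) p) := fun p =>
    (isInner_iff_inBlock.2 (inBlock_blockNode l (0, 0) p)).isNode hg.short
  rw [defectPatch_eq h] at hp hq ⊢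
  rw [isNodal_iff hg (hN _)] at hp hq
  rw [dirichletForm_eq hg.angle hg.pos hq.1 hp.1, Matrix.of_apply, refStiff]
  congr 1
  exact form_congr (fun κ hκ v => hq.2 _ (isNode_vtx hκ v)) (fun κ hκ v => hp.2 _ (isNode_vtx hκ v))

lemma isDefectAngle_iff {l : ℕ} {t : ℝ} : IsDefectAngle l t ↔ 0 < t ∧ t < π / 2 ∧
    ∀ θ : ℝ, t < θ → θ ≤ π / 2 → InvPos (refStiff l (cos θ)) := by
  refine and_congr_right fun h0 => and_congr_right fun _ => forall_congr' fun θ =>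
    forall_congr' fun h1 => forall_congr' fun h2 => ?_
  have h : IsAngle θ := ⟨h0.trans h1, h2⟩
  rw [patchStiffness_eq h, ← invPos_iff, invPos_mul_iff _ (stiffFactor_pos h (by omega))]

/-! ### Unique solvability -/

section
variable {θ : ℝ} {n : ℕ} {long : ℕ → ℕ → Prop} {tr : Bool} {c : Plane → ℝ} {C : ℝ}

/-- The energy of nodal values vanishes only if the values at the vertices of each triangle are
equal. -/
lemma IsCoeff.eq_of_energy_eq_zero (hc : IsCoeff (gridMesh θ n long tr) c C)
    (h : IsAngle θ) (hn : 1 ≤ n) {U : Node → ℝ}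
    (hU : form (elems n tr) long (elemMatrix θ n long c) U U = 0) {P Q : Node}
    (hPQ : Joined n tr long P Q) : U P = U Q := by
  have hγ := stiffFactor_pos h hn
  have hc1 : cos θ < 1 := by
    have := h.sin_pos
    nlinarith [sin_sq_add_cos_sq θ, cos_le_one θ]
  have hc0 : 0 ≤ cos θ := cos_nonneg_of_mem_Icc ⟨by linarith [h.1, pi_pos], h.2⟩
  set D : Elem → ℝ := fun κ => elemForm (elemStiff (elemSign long κ * cos θ)) (U ∘ vtx long κ)
    (U ∘ vtx long κ) with hD
  have hDlow : ∀ κ, (1 - cos θ) * ((U (vtx long κ 1) - U (vtx long κ 0)) ^ 2 +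
      (U (vtx long κ 2) - U (vtx long κ 0)) ^ 2) ≤ D κ := by
    intro κ
    simp only [hD, elemForm_elemStiff, Function.comp]
    have hs : elemSign long κ = 1 ∨ elemSign long κ = -1 := by
      unfold elemSign; split_ifs <;> simp
    set a := U (vtx long κ 1) - U (vtx long κ 0)
    set b := U (vtx long κ 2) - U (vtx long κ 0)
    rcases hs with hs | hs <;> rw [hs]
    · nlinarith [mul_nonneg hc0 (sq_nonneg (a - b))]
    · nlinarith [mul_nonneg hc0 (sq_nonneg (a + b))]
  have hnn : ∀ κ ∈ elems n tr, 0 ≤ elemForm (elemMatrix θ n long c κ) (U ∘ vtx long κ)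
      (U ∘ vtx long κ) := by
    intro κ hκ
    rw [elemForm_elemMatrix]
    have h1 := hc.elemForm_moment_self_nonneg h hn hκ U
    have h2 : 0 ≤ D κ := le_trans (mul_nonneg (by linarith) (by positivity)) (hDlow κ)
    have h3 := mul_nonneg hγ.le h2
    linarith
  rw [form_apply] at hU
  obtain ⟨κ, hκ, ⟨v, hv⟩, w, hw⟩ := hPQ
  have h0 := (Finset.sum_eq_zero_iff_of_nonneg hnn).1 hU κ hκ
  rw [elemForm_elemMatrix] at h0
  have h1 := hc.elemForm_moment_self_nonneg h hn hκ U
  have h2 : D κ ≤ 0 := by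
    by_contra! hcon
    have := mul_pos hγ hcon
    simp only [hD] at this
    linarith
  have h3 := (hDlow κ).trans h2
  have h4 : (U (vtx long κ 1) - U (vtx long κ 0)) ^ 2 +
      (U (vtx long κ 2) - U (vtx long κ 0)) ^ 2 ≤ 0 := by
    by_contra! hcon
    have := mul_pos (sub_pos.2 hc1) hcon
    linarith
  have h5 : U (vtx long κ 1) - U (vtx long κ 0) = 0 :=
    pow_eq_zero_iff two_ne_zero |>.1 (le_antisymm (by nlinarith) (sq_nonneg _))
  have h6 : U (vtx long κ 2) - U (vtx long κ 0) = 0 :=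
    pow_eq_zero_iff two_ne_zero |>.1 (le_antisymm (by nlinarith) (sq_nonneg _))
  have hall : ∀ v, U (vtx long κ v) = U (vtx long κ 0) := by
    intro v
    fin_cases v
    · rfl
    · exact sub_eq_zero.1 h5
    · exact sub_eq_zero.1 h6
  rw [← hv, ← hw, hall v, hall w]

/-- Elements of `V_0^h` without energy vanish. -/
lemma IsCoeff.eq_zero_of_energy_eq_zero (hc : IsCoeff (gridMesh θ n long tr) c C)
    (hg : IsGrid θ n long tr) {u : Plane → ℝ} (hu : u ∈ feSpaceZero (gridMesh θ n long tr))
    (h0 : form (elems n tr) long (elemMatrix θ n long c) (nodalValues θ n u)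
      (nodalValues θ n u) = 0) : u = 0 := by
  refine feSpace_ext hg.angle hg.pos hu.1 (feSpace _).zero_mem fun P hP => ?_
  have hbd := (mem_feSpaceZero_iff hg hu.1).1 hu
  have heq : ∀ P Q, Joined n tr long P Q → u (nodePt θ n P) = u (nodePt θ n Q) := fun P Q h =>
    hc.eq_of_energy_eq_zero hg.angle hg.pos h0 h
  by_cases hi : IsInner n P
  · have hn : 1 < n := by obtain ⟨h1, h2, -⟩ := hi; omega
    have hstep : ∀ Q, IsInner n Q → u (nodePt θ n Q) = u (nodePt θ n P) →
        ∀ R, GridAdj Q R → u (nodePt θ n R) = u (nodePt θ n P) := fun Q hQ h R hR => by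
      rw [← h]; exact (heq Q R (hR.joined hg.short hQ)).symm
    have hall := all_of_gridAdj (Z := fun Q => u (nodePt θ n Q) = u (nodePt θ n P)) hstep hi rfl
    have h1 := (hall.2 1 le_rfl hn).1
    rw [← h1]
    have hin : IsInner n (1, 1) := ⟨le_rfl, hn, le_rfl, hn⟩
    obtain ⟨κ, hκ, -, hv⟩ := GridAdj.joined (tr := tr) (P := (1, 1)) (Q := (1, 0)) hg.short
      (.inr (.inr (.inr ⟨rfl, rfl⟩))) hin
    exact hbd _ ⟨κ, hκ, hv⟩ fun h => by have := h.2.2.1; simp at this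
  · exact hbd P hP hi

lemma finiteDimensional_feSpaceZero (hg : IsGrid θ n long tr) :
    FiniteDimensional ℝ (feSpaceZero (gridMesh θ n long tr)) := by
  set r : feSpaceZero (gridMesh θ n long tr) →ₗ[ℝ] (nodes n → ℝ) :=
    (LinearMap.funLeft ℝ ℝ (fun P : nodes n => nodePt θ n P.1)) ∘ₗ
      (feSpaceZero (gridMesh θ n long tr)).subtype with hr
  refine FiniteDimensional.of_injective r fun u v huv => ?_
  refine Subtype.ext (feSpace_ext hg.angle hg.pos u.2.1 v.2.1 fun P hP => ?_)
  obtain ⟨κ, hκ, w, rfl⟩ := hP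
  exact congrFun huv ⟨_, vtx_mem_nodes hκ w⟩

/-- The discrete problem has exactly one solution for all data. -/
lemma IsCoeff.existsUnique_solution (hc : IsCoeff (gridMesh θ n long tr) c C)
    (hg : IsGrid θ n long tr) :
    ∃! S, IsSolutionOperator (gridMesh θ n long tr) c S := by
  set M := gridMesh θ n long tr with hM
  have := finiteDimensional_feSpaceZero hg
  set E := form (elems n tr) long (elemMatrix θ n long c) with hE
  have hforms : ∀ u ∈ feSpace M, ∀ w ∈ feSpace M,
      dirichletForm M u w + reactionForm M c u w = E (nodalValues θ n u) (nodalValues θ n w) :=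
    fun u hu w hw => hc.forms_eq hg.angle hg.pos hu hw
  set nv : feSpaceZero M →ₗ[ℝ] (Node → ℝ) := nodalValues θ n ∘ₗ (feSpaceZero M).subtype with hnv
  set A : feSpaceZero M →ₗ[ℝ] Module.Dual ℝ (feSpaceZero M) := E.compl₁₂ nv nv with hA
  have hinj : Function.Injective A := by
    rw [← LinearMap.ker_eq_bot, LinearMap.ker_eq_bot']
    intro v hv
    have := LinearMap.congr_fun hv v
    exact Subtype.ext (hc.eq_zero_of_energy_eq_zero hg v.2 this)
  have hsurj : Function.Surjective A :=
    (LinearMap.injective_iff_surjective_of_finrank_eq_finrank Subspace.dual_finrank_eq.symm).1 hinj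
  have hex : ∀ (f : Module.Dual ℝ (feSpaceZero M)) (g : feBdry M), ∃ u : feSpace M,
      (∀ y : bdry M, (u : Plane → ℝ) y = (g : bdry M → ℝ) y) ∧
      ∀ v : feSpaceZero M, dirichletForm M u v + reactionForm M c u v = f v := by
    intro f g
    obtain ⟨G, hG, hGg⟩ := g.2
    obtain ⟨w, hw⟩ := hsurj (f - (E (nodalValues θ n G)) ∘ₗ nv)
    refine ⟨⟨G + w.1, (feSpace M).add_mem hG w.2.1⟩, fun y => ?_, fun v => ?_⟩
    · have h1 : G y = (g : bdry M → ℝ) y := congrFun hGg y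
      simp [h1, w.2.2 y y.2]
    · have h1 := LinearMap.congr_fun hw v
      rw [hforms _ ((feSpace M).add_mem hG w.2.1) _ v.2.1, map_add, map_add, LinearMap.add_apply]
      change E (nv w) (nv v) = f v - E (nodalValues θ n G) (nv v) at h1
      change E (nodalValues θ n G) (nv v) + E (nv w) (nv v) = f v
      linarith
  choose S hS1 hS2 using hex
  refine ⟨S, fun f g => ⟨hS1 f g, hS2 f g⟩, fun T hT => ?_⟩
  funext f g
  have hd : (T f g : Plane → ℝ) - S f g ∈ feSpaceZero M :=
    ⟨(feSpace M).sub_mem (T f g).2 (S f g).2, fun y hy => by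
      have h1 := (hT f g).1 ⟨y, hy⟩
      have h2 := hS1 f g ⟨y, hy⟩
      simp only at h1 h2
      simp [h1, h2]⟩
  have hz : A ⟨_, hd⟩ = 0 := by
    ext v
    have h1 := (hT f g).2 v
    have h2 := hS2 f g v
    rw [hforms _ (T f g).2 _ v.2.1] at h1
    rw [hforms _ (S f g).2 _ v.2.1] at h2
    change E (nodalValues θ n ((T f g : Plane → ℝ) - S f g)) (nodalValues θ n v) = 0
    rw [map_sub, map_sub, LinearMap.sub_apply, h1, h2, sub_self]
  have h0 := hinj (hz.trans (map_zero A).symm)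
  exact Subtype.ext (sub_eq_zero.1 (congrArg Subtype.val h0))

/-! ### Discrete maximum principles -/

/-- The mesh is so fine, in relation to the bound `C` for the coefficient of the reaction term,
that the off-diagonal entries belonging to short triangles stay negative and the inverses of the
patch matrices stay positive. -/
structure IsFine (θ : ℝ) (k n : ℕ) (C : ℝ) : Prop where
  short : C < (n : ℝ) ^ 2 / sin θ ^ 2 * min (cos θ) (1 - cos θ)
  patch : ∀ l, 1 ≤ l → l ≤ k → ∃ ε : ℝ,
    (∀ B : Fin (l + 1) × Fin (l + 1) → Fin (l + 1) × Fin (l + 1) → ℝ,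
      (∀ p q, |B p q - refStiff l (cos θ) p q| ≤ ε) → InvPos B) ∧
    18 * ((l : ℝ) + 2) ^ 2 * C ≤ (n : ℝ) ^ 2 / sin θ ^ 2 * ε

lemma IsFine.elemMatrix_neg {k : ℕ} (hf : IsFine θ k n C)
    (hc : IsCoeff (gridMesh θ n long tr) c C) (h : IsAngle θ) (hn : 1 ≤ n) {κ : Elem}
    (hκ : κ ∈ elems n tr) (hs : ¬ long κ.1 κ.2.1) {v w : Fin 3} (hvw : v ≠ w) :
    elemMatrix θ n long c κ v w < 0 := by
  have ha := area_pos h hn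
  have hN : (0 : ℝ) ≤ (n : ℝ) ^ 2 / sin θ ^ 2 := by positivity
  have h1 : elemStiff (elemSign long κ * cos θ) v w ≤ - min (cos θ) (1 - cos θ) := by
    have e1 := min_le_left (cos θ) (1 - cos θ)
    have e2 := min_le_right (cos θ) (1 - cos θ)
    have e3 : elemSign long κ = 1 := by simp [elemSign, hs]
    rw [e3, one_mul]
    fin_cases v <;> fin_cases w <;> simp [elemStiff] at hvw ⊢ <;> linarith
  have h2 := (le_abs_self _).trans (hc.abs_moment_le h hn hκ v w)
  have h3 := mul_lt_mul_of_pos_right hf.short ha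
  have h4 := mul_le_mul_of_nonneg_left h1 (stiffFactor_pos h hn).le
  rw [elemMatrix]
  rw [stiffFactor] at h4 ⊢
  nlinarith

lemma IsFine.invPos_patch {k : ℕ} (hf : IsFine θ k n C)
    (hc : IsCoeff (gridMesh θ n long tr) c C) (hC : 0 ≤ C) (h : IsAngle θ) (hn : 1 ≤ n)
    {l : ℕ} (hl1 : 1 ≤ l) (hl2 : l ≤ k) {o : Node} (hp : HasPatch n long l o) :
    InvPos fun p q => form (elems n tr) long (elemMatrix θ n long c) (unit (blockNode l o q))
      (unit (blockNode l o p)) := by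
  obtain ⟨ε, hε, hle⟩ := hf.patch l hl1 hl2
  have hγ := stiffFactor_pos h hn
  have ha := area_pos h hn
  have hsin := h.sin_pos
  have hn0 : (0 : ℝ) < n := by positivity
  set N : ℝ := (n : ℝ) ^ 2 / sin θ ^ 2 with hN
  have hN0 : 0 < N := by positivity
  have hμ : ∀ κ ∈ elems n tr, ∀ v w, |moment θ n long c κ v w / stiffFactor θ n| ≤ C / N := by
    intro κ hκ v w
    rw [abs_div, abs_of_pos hγ, stiffFactor, ← hN, div_le_div_iff₀ (by positivity) hN0]
    have := mul_le_mul_of_nonneg_right (hc.abs_moment_le h hn hκ v w) hN0.le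
    linarith
  have hb := hp.abs_sub_le (c := cos θ) (div_nonneg hC hN0.le) hμ
  -- divided by `stiffFactor`, the patch matrix is a perturbation of `refStiff`
  have hB := hε _ fun p q => (hb p q).trans (by
    rw [← mul_div_assoc, div_le_iff₀ hN0]; linarith)
  rw [← invPos_mul_iff _ hγ] at hB
  convert hB using 1
  funext p q
  rw [form_apply, form_apply, Finset.mul_sum]
  refine Finset.sum_congr rfl fun κ _ => ?_
  simp only [elemForm, Finset.mul_sum, elemMatrix]
  refine Finset.sum_congr rfl fun v _ => Finset.sum_congr rfl fun w _ => ?_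
  field_simp

/-- The strong minimum principle: if a solution with a nonnegative right hand side attains its
minimum at an inner node, then it is constant at the nodes except possibly at the acute corners;
in the presence of a reaction term, the minimum has to be nonpositive. -/
lemma eq_of_min_inner {k : ℕ} (hf : IsFine θ k n C) (hC : 0 ≤ C)
    (hc : IsCoeff (gridMesh θ n long tr) c C) (hg : IsGrid θ n long tr)
    (hcov : Covered n long k) {S : Operator (gridMesh θ n long tr)}
    (hS : IsSolutionOperator (gridMesh θ n long tr) c S)
    {f : Module.Dual ℝ (feSpaceZero (gridMesh θ n long tr))}
    (hf0 : NonnegFunctional (gridMesh θ n long tr) f) (g : feBdry (gridMesh θ n long tr))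
    {P₀ : Node} (hP₀ : IsInner n P₀)
    (hmin : ∀ P, IsNode n tr long P →
      (S f g : Plane → ℝ) (nodePt θ n P₀) ≤ (S f g : Plane → ℝ) (nodePt θ n P))
    (hm : C = 0 ∨ (S f g : Plane → ℝ) (nodePt θ n P₀) ≤ 0) {P : Node}
    (hP : IsNode n tr long P) (hP0 : P ≠ (0, 0)) (hPn : P ≠ (n, n)) :
    (S f g : Plane → ℝ) (nodePt θ n P) = (S f g : Plane → ℝ) (nodePt θ n P₀) := by
  set u : Plane → ℝ := (S f g : Plane → ℝ) with hu
  have humem : u ∈ feSpace (gridMesh θ n long tr) := (S f g).2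
  set m := u (nodePt θ n P₀) with hmdef
  set U := nodalValues θ n u with hU
  set W : Node → ℝ := U - fun _ => m with hW
  have hWapp : ∀ P, W P = u (nodePt θ n P) - m := fun _ => rfl
  -- the nodal values `W` of `u - m` form a supersolution
  have hform : ∀ P, IsInner n P →
      0 ≤ form (elems n tr) long (elemMatrix θ n long c) W (unit P) := by
    intro P hPi
    have hPn := hPi.isNode (tr := tr) hg.short
    obtain ⟨φ, hφ, hφv⟩ := exists_feSpace hg.angle hg.pos long tr (unit P)
    have hφ0 : φ ∈ feSpaceZero (gridMesh θ n long tr) := by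
      refine (mem_feSpaceZero_iff hg hφ).2 fun Q hQ hQi => ?_
      rw [hφv Q hQ, unit_apply, if_neg]
      rintro rfl
      exact hQi hPi
    have h1 : 0 ≤ f ⟨φ, hφ0⟩ := hf0 ⟨φ, hφ0⟩
      ⟨_, mem_vertices_iff.2 ⟨P, hPn, rfl⟩, (isNodal_iff hg hPn).2 ⟨hφ, hφv⟩⟩
    have h2 := (hS f g).2 ⟨φ, hφ0⟩
    rw [hc.forms_eq hg.angle hg.pos humem hφ] at h2
    have h3 : form (elems n tr) long (elemMatrix θ n long c) U (nodalValues θ n φ) =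
        form (elems n tr) long (elemMatrix θ n long c) U (unit P) :=
      form_congr (fun _ _ _ => rfl) fun κ hκ v => hφv _ (isNode_vtx hκ v)
    -- constants have no Dirichlet energy, and their reaction term is absent or has the sign of `m`
    have h4 : form (elems n tr) long (elemMatrix θ n long c) (fun _ => m) (unit P) ≤ 0 := by
      rw [form_elemMatrix, form_const, mul_zero, zero_add]
      rcases hm with hC0 | hm0
      · rw [form_apply]
        refine (Finset.sum_eq_zero fun κ hκ => Finset.sum_eq_zero fun v _ =>
          Finset.sum_eq_zero fun w _ => ?_).le
        have := hc.abs_moment_le hg.angle hg.pos hκ v w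
        rw [hC0, zero_mul] at this
        rw [abs_eq_zero.1 (le_antisymm this (abs_nonneg _))]
        simp
      · have h5 := hc.form_moment_nonneg hg.angle hg.pos (U := fun _ => -m) (W := unit P)
          (fun _ => by simpa using hm0) (unit_nonneg P)
        have h6 : (fun _ : Node => -m) = -(fun _ : Node => m) := rfl
        rw [h6, map_neg, LinearMap.neg_apply] at h5
        linarith
    rw [hW, map_sub, LinearMap.sub_apply]
    linarith
  obtain ⟨r1, r2, r3, r4⟩ := strong_minimum
    (fun κ hκ hs v w hvw => hf.elemMatrix_neg hc hg.angle hg.pos hκ hs hvw) hg.short hcov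
    (fun l o hl1 hl2 hp => hf.invPos_patch hc hC hg.angle hg.pos hl1 hl2 hp)
    (W := W) (fun κ hκ v => sub_nonneg.2 (hmin _ (isNode_vtx hκ v))) hform hP₀
    (by rw [hWapp, sub_self])
  suffices W P = 0 by rw [hWapp] at this; exact sub_eq_zero.1 this
  obtain ⟨i, j⟩ := P
  have hPb : i ≤ n ∧ j ≤ n := by
    obtain ⟨κ, hκ, v, hv⟩ := hP
    exact mem_nodes.1 (hv ▸ vtx_mem_nodes hκ v)
  by_cases hin : IsInner n (i, j)
  · exact r1 _ hin
  by_cases hi : 1 ≤ i ∧ i < n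
  · have hj : j = 0 ∨ j = n := by
      by_contra hcon
      exact hin ⟨hi.1, hi.2, by simp only; omega, by simp only; omega⟩
    rcases hj with rfl | rfl
    · exact (r2 i hi.1 hi.2).1
    · exact (r2 i hi.1 hi.2).2.1
  have hi' : i = 0 ∨ i = n := by omega
  by_cases hj : 1 ≤ j ∧ j < n
  · rcases hi' with rfl | rfl
    · exact (r2 j hj.1 hj.2).2.2.1
    · exact (r2 j hj.1 hj.2).2.2.2
  have hj' : j = 0 ∨ j = n := by omega
  rcases hi' with rfl | rfl <;> rcases hj' with rfl | rfl
  · exact absurd rfl hP0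
  · exact r4
  · exact r3
  · exact absurd rfl hPn

/-- The minimum of a finite element function over the nodes. -/
lemma exists_min_node (hg : IsGrid θ n long tr) (u : Plane → ℝ) :
    ∃ P, IsNode n tr long P ∧
      ∀ Q, IsNode n tr long Q → u (nodePt θ n P) ≤ u (nodePt θ n Q) := by
  have hfin : {P | IsNode n tr long P}.Finite :=
    (nodes n).finite_toSet.subset fun P hP => by
      obtain ⟨κ, hκ, v, rfl⟩ := hP
      exact vtx_mem_nodes hκ v
  have hne : {P | IsNode n tr long P}.Nonempty := by
    obtain ⟨κ, hκ⟩ : ∃ κ, κ ∈ elems n tr := by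
      cases tr with
      | false => exact ⟨(0, 0, false), mem_elems.2 ⟨hg.pos, hg.pos, by simp⟩⟩
      | true =>
        have := hg.two_le rfl
        exact ⟨(0, 0, true), mem_elems.2 ⟨hg.pos, hg.pos, fun _ => ⟨by simp, by
          simp only [ne_eq, Prod.mk.injEq, not_and]; omega⟩⟩⟩
    exact ⟨_, isNode_vtx hκ 0⟩
  exact hfin.exists_minimalFor (fun P => u (nodePt θ n P)) _ hne |>.imp fun P hP =>
    ⟨hP.1, fun Q hQ => by
      rcases le_total (u (nodePt θ n P)) (u (nodePt θ n Q)) with h | h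
      · exact h
      · exact hP.2 hQ h⟩

/-- A boundary node that is a neighbour of an inner node. -/
lemma isNode_one_zero (hs : tr = true → ShortCorners n long) (hn : 1 < n) :
    IsNode n tr long (1, 0) := by
  have hin : IsInner n (1, 1) := ⟨le_rfl, hn, le_rfl, hn⟩
  obtain ⟨κ, hκ, -, hv⟩ := GridAdj.joined (tr := tr) (P := (1, 1)) (Q := (1, 0)) hs
    (.inr (.inr (.inr ⟨rfl, rfl⟩))) hin
  exact ⟨κ, hκ, hv⟩

/-- The weak maximum principles in a common form: the values of a solution are bounded below by a
boundary value, or they are positive. -/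
lemma weak_minimum {k : ℕ} (hf : IsFine θ k n C) (hC : 0 ≤ C)
    (hc : IsCoeff (gridMesh θ n long tr) c C) (hg : IsGrid θ n long tr)
    (hcov : Covered n long k) {S : Operator (gridMesh θ n long tr)}
    (hS : IsSolutionOperator (gridMesh θ n long tr) c S)
    {f : Module.Dual ℝ (feSpaceZero (gridMesh θ n long tr))}
    (hf0 : NonnegFunctional (gridMesh θ n long tr) f) (g : feBdry (gridMesh θ n long tr))
    {x : Plane} (hx : x ∈ domain (gridMesh θ n long tr)) :
    ∃ y : bdry (gridMesh θ n long tr),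
      (g : bdry (gridMesh θ n long tr) → ℝ) y ≤ (S f g : Plane → ℝ) x ∨
      (C ≠ 0 ∧ 0 ≤ (S f g : Plane → ℝ) x) := by
  obtain ⟨P, hP, hmin⟩ := exists_min_node hg (S f g : Plane → ℝ)
  have hxP := le_of_le_nodes hg.angle hg.pos (S f g).2 hmin hx
  by_cases hi : IsInner n P
  · have hn : 1 < n := by obtain ⟨h1, h2, -⟩ := hi; omega
    have h10 := isNode_one_zero (tr := tr) (long := long) hg.short hn
    -- `(1, 0)` is a boundary node other than the acute corners, so the minimum is attained there
    have hb : nodePt θ n (1, 0) ∈ bdry (gridMesh θ n long tr) :=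
      (nodePt_mem_bdry_iff hg h10).2 fun h => by have := h.2.2.1; simp at this
    refine ⟨⟨_, hb⟩, ?_⟩
    by_cases hm : C = 0 ∨ (S f g : Plane → ℝ) (nodePt θ n P) ≤ 0
    · left
      rw [← (hS f g).1]
      simp only
      rw [eq_of_min_inner hf hC hc hg hcov hS hf0 g hi hmin hm h10 (by simp)
        (by simp only [ne_eq, Prod.mk.injEq, not_and]; omega)]
      exact hxP
    · right
      push Not at hm
      exact ⟨hm.1, hm.2.le.trans hxP⟩
  · refine ⟨⟨_, (nodePt_mem_bdry_iff hg hP).2 hi⟩, .inl ?_⟩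
    rw [← (hS f g).1]
    exact hxP

/-- The strong maximum principles on the truncated rhombus in a common form. -/
lemma constant_of_min {k : ℕ} (hf : IsFine θ k n C) (hC : 0 ≤ C)
    (hc : IsCoeff (gridMesh θ n long true) c C) (hg : IsGrid θ n long true)
    (hcov : Covered n long k) {S : Operator (gridMesh θ n long true)}
    (hS : IsSolutionOperator (gridMesh θ n long true) c S)
    {f : Module.Dual ℝ (feSpaceZero (gridMesh θ n long true))}
    (hf0 : NonnegFunctional (gridMesh θ n long true) f) (g : feBdry (gridMesh θ n long true))
    {q : Plane} (hq : q ∈ interiorVertices (gridMesh θ n long true))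
    (hmin : IsMinOn (S f g : Plane → ℝ) (domain (gridMesh θ n long true)) q)
    (hm : C = 0 ∨ (S f g : Plane → ℝ) q ≤ 0) :
    ∃ r : ℝ, ∀ x ∈ domain (gridMesh θ n long true), (S f g : Plane → ℝ) x = r := by
  obtain ⟨P, hP, rfl⟩ := (mem_interiorVertices_iff hg).1 hq
  refine ⟨(S f g : Plane → ℝ) (nodePt θ n P), fun x hx =>
    eq_of_eq_nodes hg.angle hg.pos (S f g).2 (fun Q hQ => ?_) hx⟩
  · have hne : Q ≠ (0, 0) ∧ Q ≠ (n, n) := by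
      obtain ⟨κ, hκ, v, rfl⟩ := hQ
      have := vtx_ne_corner (hg.two_le rfl) (hg.short rfl) hκ v
      constructor <;> intro h0 <;> rw [h0] at this <;> simp only at this <;> omega
    refine eq_of_min_inner hf hC hc hg hcov hS hf0 g hP (fun R hR => ?_) hm hQ hne.1 hne.2
    exact hmin (by rw [domain_gridMesh hg]; exact hR.mem_region hg)

lemma wdmpa {k : ℕ} (hf : IsFine θ k n 0)
    (hc : IsCoeff (gridMesh θ n long tr) c 0) (hg : IsGrid θ n long tr)
    (hcov : Covered n long k) {S : Operator (gridMesh θ n long tr)}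
    (hS : IsSolutionOperator (gridMesh θ n long tr) c S) : WDMPA (gridMesh θ n long tr) S := by
  intro f hf0 g x hx
  obtain ⟨y, hy | hy⟩ := weak_minimum hf le_rfl hc hg hcov hS hf0 g hx
  · exact ⟨y, hy⟩
  · exact absurd rfl hy.1

lemma wdmpb {k : ℕ} (hf : IsFine θ k n C) (hC : 0 ≤ C)
    (hc : IsCoeff (gridMesh θ n long tr) c C) (hg : IsGrid θ n long tr)
    (hcov : Covered n long k) {S : Operator (gridMesh θ n long tr)}
    (hS : IsSolutionOperator (gridMesh θ n long tr) c S) : WDMPB (gridMesh θ n long tr) S := by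
  intro f hf0 g x hx
  obtain ⟨y, hy⟩ := weak_minimum hf hC hc hg hcov hS hf0 g hx
  refine ⟨y, ?_⟩
  rw [neg_neg]
  rcases hy with hy | hy
  · exact (min_le_left _ _).trans hy
  · exact (min_le_right _ _).trans hy.2

/-! ### The degenerate truncated mesh -/

lemma truncatedMesh_one (θ : ℝ) (long : ℕ → ℕ → Prop) : truncatedMesh θ 1 long = ∅ := by
  rw [Set.eq_empty_iff_forall_notMem]
  rintro t ⟨⟨i, j, hi, hj, h⟩, h0, h1⟩
  obtain rfl : i = 0 := by omega
  obtain rfl : j = 0 := by omega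
  rcases h with ⟨-, rfl | rfl⟩ | ⟨-, rfl | rfl⟩ <;> simp at h0 h1

/-- On the empty mesh there is nothing to prove. -/
lemma empty_mesh (c : Plane → ℝ) : (∃! S, IsSolutionOperator (∅ : Mesh) c S) ∧
    ∀ S : Operator (∅ : Mesh), SDMPA ∅ S ∧ SDMPB ∅ S := by
  have hd : domain (∅ : Mesh) = ∅ := by simp [domain]
  have hb : bdry (∅ : Mesh) = ∅ := by rw [bdry, hd, frontier_empty]
  have hz : ∀ u ∈ feSpace (∅ : Mesh), u = 0 := fun u hu => funext fun x =>
    hu.2.2 x (by rw [hd]; exact Set.notMem_empty x)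
  have hi : interiorVertices (∅ : Mesh) = ∅ := by simp [interiorVertices, vertices]
  refine ⟨⟨fun _ _ => 0, fun f g => ⟨fun y => ?_, fun v => ?_⟩, fun T _ => ?_⟩, fun S =>
    ⟨⟨?_, ?_⟩, ?_, ?_⟩⟩
  · exact absurd (hb ▸ y.2 : (y : Plane) ∈ (∅ : Set Plane)) (Set.notMem_empty _)
  · have : v = 0 := Subtype.ext (hz v v.2.1)
    rw [this, map_zero, dirichletForm, reactionForm, hd]
    simp
  · funext f g
    exact Subtype.ext ((hz _ (T f g).2).trans (hz _ (0 : feSpace (∅ : Mesh)).2).symm)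
  · intro f _ g x hx
    exact absurd hx (by rw [hd]; exact Set.notMem_empty _)
  · intro f _ g q hq
    exact absurd hq (by rw [hi]; exact Set.notMem_empty _)
  · intro f _ g x hx
    exact absurd hx (by rw [hd]; exact Set.notMem_empty _)
  · intro f _ g q hq
    exact absurd hq (by rw [hi]; exact Set.notMem_empty _)

/-! ### Fine meshes -/

lemma isFine_zero {k : ℕ} (h : IsAngle θ) (hθ : θ < π / 2) (hn : 1 ≤ n)
    (hk : ∀ l, 1 ≤ l → l ≤ k → InvPos (refStiff l (cos θ))) : IsFine θ k n 0 := by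
  have hsin := h.sin_pos
  have hn0 : (0 : ℝ) < n := by positivity
  have hc0 : 0 < cos θ := cos_pos_of_mem_Ioo ⟨by linarith [h.1, pi_pos], hθ⟩
  have hc1 : 0 < 1 - cos θ := by nlinarith [sin_sq_add_cos_sq θ, cos_le_one θ]
  refine ⟨mul_pos (by positivity) (lt_min hc0 hc1), fun l hl1 hl2 => ?_⟩
  obtain ⟨ε, hε, hB⟩ := (hk l hl1 hl2).exists_ball
  exact ⟨ε, hB, by rw [mul_zero]; positivity⟩

/-- All sufficiently fine meshes satisfy `IsFine`. -/
lemma exists_isFine {k : ℕ} (h : IsAngle θ) (hθ : θ < π / 2)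
    (hk : ∀ l, 1 ≤ l → l ≤ k → InvPos (refStiff l (cos θ))) (C : ℝ) :
    ∃ n₀ : ℝ, ∀ n : ℕ, 1 ≤ n → n₀ ≤ n → IsFine θ k n C := by
  have hsin := h.sin_pos
  have hc0 : 0 < cos θ := cos_pos_of_mem_Ioo ⟨by linarith [h.1, pi_pos], hθ⟩
  have hc1 : 0 < 1 - cos θ := by nlinarith [sin_sq_add_cos_sq θ, cos_le_one θ]
  have hball : ∀ l : ℕ, ∃ ε > 0, 1 ≤ l → l ≤ k →
      ∀ B : Fin (l + 1) × Fin (l + 1) → Fin (l + 1) × Fin (l + 1) → ℝ,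
      (∀ p q, |B p q - refStiff l (cos θ) p q| ≤ ε) → InvPos B := by
    intro l
    by_cases hl : 1 ≤ l ∧ l ≤ k
    · obtain ⟨ε, hε, hB⟩ := (hk l hl.1 hl.2).exists_ball
      exact ⟨ε, hε, fun _ _ => hB⟩
    · exact ⟨1, one_pos, fun h1 h2 => absurd ⟨h1, h2⟩ hl⟩
  choose ε hε hB using hball
  have h1 : ∀ᶠ N : ℝ in Filter.atTop, C < N * min (cos θ) (1 - cos θ) :=
    (Filter.tendsto_id.atTop_mul_const (lt_min hc0 hc1)).eventually_gt_atTop C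
  have h2 : ∀ᶠ N : ℝ in Filter.atTop, ∀ l ∈ Finset.range (k + 1),
      18 * ((l : ℝ) + 2) ^ 2 * C ≤ N * ε l :=
    (Filter.eventually_all_finset _).2 fun l _ =>
      (Filter.tendsto_id.atTop_mul_const (hε l)).eventually_ge_atTop _
  obtain ⟨n₀, hn₀⟩ := Filter.eventually_atTop.1 (h1.and h2)
  refine ⟨n₀, fun n hn hn' => ?_⟩
  -- the quantity that has to be large is `n ^ 2 / sin θ ^ 2`, and it is at least `n`
  have hnN : (n : ℝ) ≤ (n : ℝ) ^ 2 / sin θ ^ 2 := by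
    have hn1 : (1 : ℝ) ≤ n := by exact_mod_cast hn
    have hs1 : sin θ ^ 2 ≤ 1 := sin_sq_le_one θ
    rw [le_div_iff₀ (by positivity)]
    nlinarith
  obtain ⟨h3, h4⟩ := hn₀ _ (hn'.trans hnN)
  exact ⟨h3, fun l hl1 hl2 => ⟨ε l, hB l hl1 hl2, h4 l (by simp; omega)⟩⟩

/-- The mesh size is at least the side length of the small rhombuses. -/
lemma inv_le_meshSize (hn : 1 ≤ n) : 1 / (n : ℝ) ≤ meshSize (gridMesh θ n long false) := by
  have hn0 : (0 : ℝ) < n := by positivity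
  set κ : Elem := (0, 0, false) with hκ
  have hmem : κ ∈ elems n false := mem_elems.2 ⟨hn, hn, by simp⟩
  have hdist : dist (nodePt θ n (vtx long κ 1)) (nodePt θ n (vtx long κ 0)) = 1 / n := by
    obtain ⟨s1, -, -, s4, -⟩ := side_facts long κ
    have e1 : nodePt θ n (vtx long κ 1) - nodePt θ n (vtx long κ 0) =
        (sideX long κ / n) • dir (-(θ / 2)) := by
      simp only [nodePt_eq_pt, pt, s4, sideX]; module
    have e2 : ‖dir (-(θ / 2))‖ = 1 := by
      simp [dir, EuclideanSpace.norm_eq, Fin.sum_univ_two]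
    have e3 : |sideX long κ| = 1 := by
      rcases sq_eq_sq_iff_eq_or_eq_neg.1 (s1.trans (one_pow 2).symm) with h1 | h1 <;> simp [h1]
    rw [dist_eq_norm, e1, norm_smul, e2, mul_one, Real.norm_eq_abs, abs_div, e3,
      abs_of_pos hn0]
  have hdiam : 1 / (n : ℝ) ≤ Metric.diam (tri θ n long κ) := by
    rw [← hdist]
    exact Metric.dist_le_diam_of_mem (Set.finite_range _).isBounded ⟨1, rfl⟩ ⟨0, rfl⟩
  refine hdiam.trans (le_csSup ?_ ⟨_, ⟨κ, hmem, rfl⟩, rfl⟩)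
  exact (((Finset.finite_toSet _).image _).image _).bddAbove

/-- All assertions about one mesh, version A. -/
lemma principles_a {k : ℕ} (h : IsAngle θ) (hn : 1 ≤ n) (hf : IsFine θ k n 0)
    (hcov : Covered n long k) :
    ((∃! S, IsSolutionOperator (truncatedMesh θ n long) (fun _ => 0) S) ∧
      ∀ S, IsSolutionOperator (truncatedMesh θ n long) (fun _ => 0) S →
        SDMPA (truncatedMesh θ n long) S) ∧
    ((∃! S, IsSolutionOperator (rhombusMesh θ n long) (fun _ => 0) S) ∧
      ∀ S, IsSolutionOperator (rhombusMesh θ n long) (fun _ => 0) S →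
        WDMPA (rhombusMesh θ n long) S) := by
  have hc : ∀ M : Mesh, IsCoeff M (fun _ => 0) 0 := fun M =>
    ⟨aemeasurable_const, Filter.Eventually.of_forall fun _ => by simp⟩
  constructor
  · rcases hn.eq_or_lt with rfl | hn2
    · rw [truncatedMesh_one]
      exact ⟨(empty_mesh _).1, fun S _ => ((empty_mesh fun _ => 0).2 S).1⟩
    · have hg : IsGrid θ n long true := ⟨h, hn, fun _ => hn2, fun _ => (hcov.corners hn2).1⟩
      rw [truncatedMesh_eq hg]
      exact ⟨(hc _).existsUnique_solution hg, fun S hS => ⟨wdmpa hf (hc _) hg hcov hS,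
        fun f hf0 g q hq hmin => constant_of_min hf le_rfl (hc _) hg hcov hS hf0 g hq hmin
          (.inl rfl)⟩⟩
  · have hg : IsGrid θ n long false := ⟨h, hn, by simp, by simp⟩
    rw [rhombusMesh_eq]
    exact ⟨(hc _).existsUnique_solution hg, fun S hS => wdmpa hf (hc _) hg hcov hS⟩

/-- All assertions about one mesh, version B. -/
lemma principles_b {k : ℕ} (h : IsAngle θ) (hn : 1 ≤ n) (hf : IsFine θ k n C) (hC : 0 ≤ C)
    (hcov : Covered n long k) (hc : IsCoeff (rhombusMesh θ n long) c C) :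
    ((∃! S, IsSolutionOperator (truncatedMesh θ n long) c S) ∧
      ∀ S, IsSolutionOperator (truncatedMesh θ n long) c S →
        SDMPB (truncatedMesh θ n long) S) ∧
    ((∃! S, IsSolutionOperator (rhombusMesh θ n long) c S) ∧
      ∀ S, IsSolutionOperator (rhombusMesh θ n long) c S →
        WDMPB (rhombusMesh θ n long) S) := by
  constructor
  · rcases hn.eq_or_lt with rfl | hn2
    · rw [truncatedMesh_one]
      exact ⟨(empty_mesh _).1, fun S _ => ((empty_mesh c).2 S).2⟩
    · have hg : IsGrid θ n long true := ⟨h, hn, fun _ => hn2, fun _ => (hcov.corners hn2).1⟩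
      have hle : (volume.restrict (domain (truncatedMesh θ n long)) : Measure Plane) ≤
          volume.restrict (domain (rhombusMesh θ n long)) :=
        Measure.restrict_mono (Set.biUnion_subset_biUnion_left fun t ht => ht.1) le_rfl
      have hc' : IsCoeff (truncatedMesh θ n long) c C :=
        ⟨hc.meas.mono_measure hle, ae_mono hle hc.bound⟩
      rw [truncatedMesh_eq hg] at hc' ⊢
      exact ⟨hc'.existsUnique_solution hg, fun S hS => ⟨wdmpb hf hC hc' hg hcov hS,
        fun f hf0 g q hq hmin hm => constant_of_min hf hC hc' hg hcov hS hf0 g hq hmin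
          (.inr hm)⟩⟩
  · have hg : IsGrid θ n long false := ⟨h, hn, by simp, by simp⟩
    rw [rhombusMesh_eq] at hc ⊢
    exact ⟨hc.existsUnique_solution hg, fun S hS => wdmpb hf hC hc hg hcov hS⟩

end

end DMP

end

theorem theorem5p3 :
    (∀ l : ℕ, 1 ≤ l → ∃ t : ℝ, DMP.IsDefectAngle l t) ∧
    ∀ (k : ℕ), 1 ≤ k → ∀ (ϑ : ℕ → ℝ),
      (∀ l, 1 ≤ l → l ≤ k → DMP.IsDefectAngle l (ϑ l)) →
      ∀ θ : ℝ, (∀ l, 1 ≤ l → l ≤ k → ϑ l < θ) → θ < Real.pi / 2 →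
      -- part (i)
      (∀ (n : ℕ), 1 ≤ n → ∀ (long : ℕ → ℕ → Prop),
        DMP.Admissible k θ (DMP.rhombusMesh θ n long) →
        ((∃! S, DMP.IsSolutionOperator (DMP.truncatedMesh θ n long) (fun _ => 0) S) ∧
          ∀ S, DMP.IsSolutionOperator (DMP.truncatedMesh θ n long) (fun _ => 0) S →
            DMP.SDMPA (DMP.truncatedMesh θ n long) S) ∧
        ((∃! S, DMP.IsSolutionOperator (DMP.rhombusMesh θ n long) (fun _ => 0) S) ∧
          ∀ S, DMP.IsSolutionOperator (DMP.rhombusMesh θ n long) (fun _ => 0) S →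
            DMP.WDMPA (DMP.rhombusMesh θ n long) S)) ∧
      -- part (ii)
      (∀ cmax : ℝ, ∃ hmax : ℝ, 0 < hmax ∧
        ∀ (n : ℕ), 1 ≤ n → ∀ (long : ℕ → ℕ → Prop),
        DMP.Admissible k θ (DMP.rhombusMesh θ n long) →
        DMP.meshSize (DMP.rhombusMesh θ n long) < hmax →
        ∀ c : DMP.Plane → ℝ,
        AEMeasurable c (MeasureTheory.volume.restrict
          (DMP.domain (DMP.rhombusMesh θ n long))) →
        (∀ᵐ x ∂(MeasureTheory.volume.restrict (DMP.domain (DMP.rhombusMesh θ n long))),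
          0 ≤ c x ∧ c x ≤ cmax) →
        ((∃! S, DMP.IsSolutionOperator (DMP.truncatedMesh θ n long) c S) ∧
          ∀ S, DMP.IsSolutionOperator (DMP.truncatedMesh θ n long) c S →
            DMP.SDMPB (DMP.truncatedMesh θ n long) S) ∧
        ((∃! S, DMP.IsSolutionOperator (DMP.rhombusMesh θ n long) c S) ∧
          ∀ S, DMP.IsSolutionOperator (DMP.rhombusMesh θ n long) c S →
            DMP.WDMPB (DMP.rhombusMesh θ n long) S)) := by
  refine ⟨fun l _ => ?_, fun k hk ϑ hϑ θ hθ hθ2 => ?_⟩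
  · obtain ⟨t, ht⟩ := DMP.exists_angle_invPos l
    exact ⟨t, DMP.isDefectAngle_iff.2 ht⟩
  have hang : DMP.IsAngle θ :=
    ⟨(hϑ 1 le_rfl hk).1.trans (hθ 1 le_rfl hk), hθ2.le⟩
  have hinv : ∀ l, 1 ≤ l → l ≤ k → DMP.InvPos (DMP.refStiff l (cos θ)) := fun l hl1 hl2 =>
    (DMP.isDefectAngle_iff.1 (hϑ l hl1 hl2)).2.2 θ (hθ l hl1 hl2) hθ2.le
  refine ⟨fun n hn long hA => ?_, fun cmax => ?_⟩
  · exact DMP.principles_a hang hn (DMP.isFine_zero hang hθ2 hn hinv)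
      (DMP.covered_of_admissible hang hθ2 hn hA)
  · obtain ⟨n₀, hn₀⟩ := DMP.exists_isFine hang hθ2 hinv (max cmax 0)
    refine ⟨1 / max n₀ 1, by positivity, fun n hn long hA hh c hcm hcb => ?_⟩
    have hn0 : (0 : ℝ) < n := by positivity
    have hle : n₀ ≤ n := by
      rw [DMP.rhombusMesh_eq] at hh
      have h1 := (DMP.inv_le_meshSize hn).trans_lt hh
      rw [one_div_lt_one_div hn0 (by positivity)] at h1
      exact (le_max_left _ _).trans h1.le
    exact DMP.principles_b hang hn (hn₀ n hn hle) (le_max_right _ _)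
      (DMP.covered_of_admissible hang hθ2 hn hA)
      ⟨hcm, hcb.mono fun x hx => ⟨hx.1, hx.2.trans (le_max_left _ _)⟩⟩
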